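/- Let $M$ be a transitive model of ZFC (a set or a proper class). For a topological space $\langle X,\tau\rangle$ of $M$, a \emph{preinterpretation} over $M$ is a $T_0$ topological space $\hat X$ with a map $\pi$ sending points of $X$ to points of $\hat X$ and elements of $\tau$ to open subsets of $\hat X$ such that: $x\in O\iff\pi(x)\in\pi(O)$; $\pi$ commutes with finite intersections, and with unions of those families of open sets which belong to $M$; $\pi(\emptyset)=\emptyset$, $\pi(X)=\hat X$; and $\{\pi(O)\colon O\in\tau\}$ is a basis of $\hat X$. A preinterpretation $\pi_0\colon X\to\hat X_0$ reduces to $\pi_1\colon X\to\hat X_1$ if there is $h\colon\hat X_0\to\hat X_1$ with $\pi_1=h\circ\pi_0$ on points and $h^{-1}(\pi_1(O))=\pi_0(O)$ for all $O\in\tau$; an \emph{interpretation} is a preinterpretation to which every preinterpretation reduces. A map on points \emph{extends to an interpretation} if it is the point part of one. If $\pi\colon X\to\hat X$ and $\chi\colon Y\to\hat Y$ are interpretations and $f\colon X\to Y$ is a continuous function of $M$, an interpretation of $f$ is a continuous $\hat f\colon\hat X\to\hat Y$ with $\hat f(\pi(x))=\chi(f(x))$ for all $x\in X$. \textbf{Theorem.}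 Suppose that $M\models X$ is a real normed Banach space, and let $Y$ be the closed unit ball of its dual with the weak${}^*$ topology, both in the sense of $M$. Let $\pi\colon X\to\hat X$ be an interpretation of $X$ with its norm topology. Then $\hat X$ carries a real Banach space structure which induces its topology and interprets that of $X$: $\pi$ is additive, commutes with multiplication by the reals of $M$, and preserves the norm. For any real normed space structure on $\hat X$ which induces its topology and has these properties of $\pi$, let $\hat Y$ be the closed unit ball of the dual of $\hat X$ with the weak${}^*$ topology. Every $y\in Y$ has a unique interpretation $\pi(y)\colon\hat X\to\mathbb R$ (with $\mathbb R^M$ interpreted by its inclusion in $\mathbb R$), and $\pi(y)\in\hat Y$. Moreover: \begin{enumerate} \item the map $y\mapsto\pi(y)$ from $Y$ to $\hat Y$ extends to an interpretation of $Y$; \item the inclusion $\mathbb R^M\to\mathbb R$ and the product map $(x,y)\mapsto(\pi(x),\pi(y))$ from $X\times Y$ (with the product topology of $M$) to $\hat X\times\hat Y$ extend to interpretations, and the unique interpretation of the bracket $X\times Y\to\mathbb R^M$, $(x,y)\mapsto y(x)$, with respect to them is the bracket $\hat X\times\hat Y\to\mathbb R$, $(x,y)\mapsto y(x)$. \end{enumerate}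 -/

import Mathlib

universe u v w

noncomputable section

namespace ZModel

/-! ### Transitive models of ZFC

A class `M` of sets is a `Set ZFSet`; it may be (small) a set or a proper class.
-/

/-- The only non-logical symbol of the language of set theory. -/
inductive MemSymbol : ℕ → Type
  | mem : MemSymbol 2

/-- The first-order language of set theory. -/
def setLanguage : FirstOrder.Language := ⟨fun _ => Empty, MemSymbol⟩

/-- The `∈`-structure with underlying class `M`. -/
instance memStructure (M : Set ZFSet.{u}) : setLanguage.Structure M where
  funMap := fun f => nomatch f
  RelMap := fun
    | .mem, v => (v 0 : ZFSet.{u}) ∈ (v 1 : ZFSet.{u})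

/-- `M ⊨ ZFC`: every axiom is relativised to `M`. The two schemes range over the classes and
class relations which are first-order definable over `(M, ∈)` with parameters from `M`. -/
structure SatisfiesZFC (M : Set ZFSet.{u}) : Prop where
  extensionality : ∀ a b : M, (∀ z : M, z.1 ∈ a.1 ↔ z.1 ∈ b.1) → a = b
  foundation : ∀ a : M, (∃ x : M, x.1 ∈ a.1) → ∃ x : M, x.1 ∈ a.1 ∧ ∀ z : M, z.1 ∈ x.1 → z.1 ∉ a.1
  pairing : ∀ a b : M, ∃ c : M, ∀ z : M, z.1 ∈ c.1 ↔ z = a ∨ z = b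
  union : ∀ a : M, ∃ b : M, ∀ z : M, z.1 ∈ b.1 ↔ ∃ x : M, x.1 ∈ a.1 ∧ z.1 ∈ x.1
  powerset : ∀ a : M, ∃ b : M, ∀ z : M, z.1 ∈ b.1 ↔ ∀ x : M, x.1 ∈ z.1 → x.1 ∈ a.1
  infinity : ∃ a : M, (∃ e : M, e.1 ∈ a.1 ∧ ∀ z : M, z.1 ∉ e.1) ∧
    ∀ x : M, x.1 ∈ a.1 → ∃ y : M, y.1 ∈ a.1 ∧ ∀ z : M, z.1 ∈ y.1 ↔ z.1 ∈ x.1 ∨ z = x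
  separation : ∀ D : Set M, (Set.univ : Set M).Definable₁ setLanguage D →
    ∀ a : M, ∃ b : M, ∀ z : M, z.1 ∈ b.1 ↔ z.1 ∈ a.1 ∧ z ∈ D
  replacement : ∀ R : Set (M × M), (Set.univ : Set M).Definable₂ setLanguage R →
    ∀ a : M, (∀ x : M, x.1 ∈ a.1 → ∃! y : M, (x, y) ∈ R) →
      ∃ b : M, ∀ y : M, y.1 ∈ b.1 ↔ ∃ x : M, x.1 ∈ a.1 ∧ (x, y) ∈ R
  choice : ∀ a : M, (∀ x : M, x.1 ∈ a.1 → ∃ z : M, z.1 ∈ x.1) →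
    (∀ x y : M, x.1 ∈ a.1 → y.1 ∈ a.1 → (∃ z : M, z.1 ∈ x.1 ∧ z.1 ∈ y.1) → x = y) →
      ∃ c : M, ∀ x : M, x.1 ∈ a.1 → ∃! z : M, z.1 ∈ x.1 ∧ z.1 ∈ c.1

/-- `M` is a transitive model of ZFC. -/
structure IsTransitiveModel (M : Set ZFSet.{u}) : Prop where
  transitive : ∀ x ∈ M, ∀ y ∈ x, y ∈ M
  satisfiesZFC : SatisfiesZFC M

/-! ### Topological spaces of `M` and their interpretations

A topological space of `M` is given by its set `X` of points and its set `τ` of open sets. -/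

/-- `p` (on points) and `P` (on open sets) form a topological preinterpretation over `M` of the
space `(X, τ)` of `M` in the topological space `E`. Families of open sets lying in `M` enter
through their range `A ∈ M`. All spaces are required to be `T₀`. -/
structure IsPreinterpretation (M : Set ZFSet.{u}) (X τ : ZFSet.{u}) {E : Type v}
    [TopologicalSpace E] (p : X → E) (P : τ → Set E) : Prop where
  t0 : T0Space E
  isOpen : ∀ O : τ, IsOpen (P O)
  mem_iff : ∀ (x : X) (O : τ), x.1 ∈ O.1 ↔ p x ∈ P O
  inter : ∀ O₁ O₂ O₃ : τ, O₃.1 = O₁.1 ∩ O₂.1 → P O₃ = P O₁ ∩ P O₂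
  sUnion : ∀ A ∈ M, A ⊆ τ → ∀ O : τ, O.1 = ZFSet.sUnion A →
    P O = {e | ∃ U : τ, U.1 ∈ A ∧ e ∈ P U}
  empty : ∀ O : τ, O.1 = ∅ → P O = ∅
  univ : ∀ O : τ, O.1 = X → P O = Set.univ
  basis : TopologicalSpace.IsTopologicalBasis (Set.range P)

/-- `h` is a reduction of the preinterpretation `(p₀, P₀)` to the preinterpretation `(p₁, P₁)`. -/
def IsReduction {X τ : ZFSet.{u}} {E₀ : Type v} {E₁ : Type w} (p₀ : X → E₀) (P₀ : τ → Set E₀)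
    (p₁ : X → E₁) (P₁ : τ → Set E₁) (h : E₀ → E₁) : Prop :=
  (∀ x, p₁ x = h (p₀ x)) ∧ ∀ O, h ⁻¹' (P₁ O) = P₀ O

/-- An interpretation is a largest preinterpretation: every preinterpretation reduces to it. -/
def IsInterpretation (M : Set ZFSet.{u}) (X τ : ZFSet.{u}) {E : Type v} [TopologicalSpace E]
    (p : X → E) (P : τ → Set E) : Prop :=
  IsPreinterpretation M X τ p P ∧
    ∀ (E' : Type u) (_ : TopologicalSpace E') (p' : X → E') (P' : τ → Set E'),
      IsPreinterpretation M X τ p' P' → ∃ h : E' → E, IsReduction p' P' p P h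

/-- The map `p`, given on points only, extends to an interpretation. -/
def ExtendsToInterpretation (M : Set ZFSet.{u}) (X τ : ZFSet.{u}) {E : Type v}
    [TopologicalSpace E] (p : X → E) : Prop :=
  ∃ P : τ → Set E, IsInterpretation M X τ p P

/-- Given maps `p`, `q` on the points of two spaces `X`, `Y` of `M`, the function `g` is an
interpretation of the function of `M` from `X` to `Y` whose graph is `f`. -/
def InterpretsMap {X Y : ZFSet.{u}} {E : Type v} {F : Type w} [TopologicalSpace E]
    [TopologicalSpace F] (p : X → E) (q : Y → F) (f : ZFSet.{u}) (g : E → F) : Prop :=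
  Continuous g ∧ ∀ (x : X) (y : Y), ZFSet.pair x.1 y.1 ∈ f → g (p x) = q y

/-! ### Products of spaces of `M` -/

theorem exists_of_prod {X Y : ZFSet.{u}} (z : X.prod Y) :
    ∃ c : X × Y, z.1 = ZFSet.pair c.1.1 c.2.1 := by
  obtain ⟨a, ha, b, hb, h⟩ := ZFSet.mem_prod.1 z.2
  exact ⟨(⟨a, ha⟩, ⟨b, hb⟩), h⟩

/-- The two coordinates of an element of `X × Y`. -/
def coords {X Y : ZFSet.{u}} (z : X.prod Y) : X × Y := Classical.choose (exists_of_prod z)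

theorem pair_coords {X Y : ZFSet.{u}} (z : X.prod Y) :
    z.1 = ZFSet.pair (coords z).1.1 (coords z).2.1 := Classical.choose_spec (exists_of_prod z)

/-- The open sets of the product, formed in `M`, of the spaces `(X, τ)` and `(Y, σ)`. -/
def prodOpens (M : Set ZFSet.{u}) (X τ Y σ : ZFSet.{u}) : ZFSet.{u} :=
  (X.prod Y).powerset.sep fun O => O ∈ M ∧ ∀ (x : X) (y : Y), ZFSet.pair x.1 y.1 ∈ O →
    ∃ U ∈ τ, ∃ V ∈ σ, x.1 ∈ U ∧ y.1 ∈ V ∧ U.prod V ⊆ O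

/-- The product of two maps. -/
def prodMap {X Y : ZFSet.{u}} {E : Type v} {F : Type w} (p : X → E) (q : Y → F) :
    X.prod Y → E × F :=
  fun z => (p (coords z).1, q (coords z).2)

/-! ### The real numbers of `M`

Numbers are coded by sets in the usual way: natural numbers as von Neumann ordinals, a rational
number `a / d` in lowest terms by `((a⁺, a⁻), d)`, a real number by its left Dedekind cut. -/

def natCode : ℕ → ZFSet.{u}
  | 0 => ∅
  | n + 1 => insert (natCode n) (natCode n)

def ratCode (q : ℚ) : ZFSet.{u} :=
  ZFSet.pair (ZFSet.pair (natCode q.num.toNat) (natCode (-q.num).toNat)) (natCode q.den)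

def realCode (r : ℝ) : ZFSet.{u} := ZFSet.range fun q : {q : ℚ // (q : ℝ) < r} => ratCode q.1

/-- The real numbers which belong to `M`. -/
def realsIn (M : Set ZFSet.{u}) : Set ℝ := {r | realCode.{u} r ∈ M}

/-- The set of all real numbers, as formed in `M`. -/
def realSet (M : Set ZFSet.{u}) : ZFSet.{u} := ZFSet.range fun r : realsIn M => realCode r.1

theorem exists_of_realSet {M : Set ZFSet.{u}} (c : realSet M) : ∃ r : ℝ, realCode r = c.1 := by
  obtain ⟨r, hr⟩ := ZFSet.mem_range.1 c.2
  exact ⟨r.1, hr⟩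

/-- The inclusion of the reals of `M` into the reals. -/
def realVal {M : Set ZFSet.{u}} (c : realSet M) : ℝ := Classical.choose (exists_of_realSet c)

theorem realCode_realVal {M : Set ZFSet.{u}} (c : realSet M) : realCode (realVal c) = c.1 :=
  Classical.choose_spec (exists_of_realSet c)

/-- The usual topology of the reals of `M`, as formed in `M`. -/
def realOpens (M : Set ZFSet.{u}) : ZFSet.{u} :=
  (realSet M).powerset.sep fun O => O ∈ M ∧ ∀ a : realSet M, a.1 ∈ O →
    ∃ ε : ℚ, 0 < ε ∧ ∀ b : realSet M, |realVal b - realVal a| < ε → b.1 ∈ O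

/-! ### Banach spaces of `M` -/

/-- A (real) normed Banach space in the sense of `M`: the set of vectors and the graphs of
addition, of scalar multiplication (by the reals of `M`) and of the norm belong to `M`,
and every Cauchy sequence which belongs to `M` converges. -/
structure BanachIn (M : Set ZFSet.{u}) where
  carrier : ZFSet.{u}
  carrier_mem : carrier ∈ M
  [group : AddCommGroup carrier]
  smul : realsIn M → carrier → carrier
  norm : carrier → ℝ
  add_mem : (ZFSet.range fun c : carrier × carrier =>
    ZFSet.pair (ZFSet.pair c.1.1 c.2.1) (c.1 + c.2).1) ∈ M
  smul_mem : (ZFSet.range fun c : realsIn M × carrier =>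
    ZFSet.pair (ZFSet.pair (realCode c.1.1) c.2.1) (smul c.1 c.2).1) ∈ M
  norm_mem : (ZFSet.range fun x : carrier => ZFSet.pair x.1 (realCode (norm x))) ∈ M
  smul_add : ∀ r x y, smul r (x + y) = smul r x + smul r y
  add_smul : ∀ (r s t : realsIn M) (x), (t : ℝ) = r + s → smul t x = smul r x + smul s x
  mul_smul : ∀ (r s t : realsIn M) (x), (t : ℝ) = r * s → smul t x = smul r (smul s x)
  one_smul : ∀ (t : realsIn M) (x), (t : ℝ) = 1 → smul t x = x
  norm_eq_zero : ∀ x, norm x = 0 ↔ x = 0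
  norm_smul : ∀ (r : realsIn M) (x), norm (smul r x) = |(r : ℝ)| * norm x
  norm_add_le : ∀ x y, norm (x + y) ≤ norm x + norm y
  complete : ∀ s : ℕ → carrier, (ZFSet.range fun n : ℕ => ZFSet.pair (natCode n) (s n).1) ∈ M →
    (∀ ε : ℚ, 0 < ε → ∃ N, ∀ m ≥ N, ∀ n ≥ N, norm (s m - s n) < ε) →
      ∃ x, ∀ ε : ℚ, 0 < ε → ∃ N, ∀ n ≥ N, norm (s n - x) < ε

attribute [instance] BanachIn.group

namespace BanachIn

variable {M : Set ZFSet.{u}} (X : BanachIn M)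

/-- The norm topology of `X`, as formed in `M`. -/
def opens : ZFSet.{u} :=
  X.carrier.powerset.sep fun O => O ∈ M ∧ ∀ x : X.carrier, x.1 ∈ O →
    ∃ ε : ℚ, 0 < ε ∧ ∀ y : X.carrier, X.norm (y - x) < ε → y.1 ∈ O

/-- The graph of a real-valued function on `X`. -/
def graph (f : X.carrier → ℝ) : ZFSet.{u} :=
  ZFSet.range fun x : X.carrier => ZFSet.pair x.1 (realCode (f x))

/-- `f` is a linear functional on `X` of norm at most one. -/
structure IsUnitFunctional (f : X.carrier → ℝ) : Prop where
  map_add : ∀ x y, f (x + y) = f x + f y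
  map_smul : ∀ (r : realsIn M) (x), f (X.smul r x) = r * f x
  bound : ∀ x, |f x| ≤ X.norm x

/-- The closed unit ball of the dual of `X`, as formed in `M`. -/
def dualBall : ZFSet.{u} :=
  ZFSet.range fun f : {f : X.carrier → ℝ // X.IsUnitFunctional f ∧ X.graph f ∈ M} => X.graph f.1

theorem exists_of_dualBall (y : X.dualBall) :
    ∃ f : X.carrier → ℝ, (X.IsUnitFunctional f ∧ X.graph f ∈ M) ∧ X.graph f = y.1 := by
  obtain ⟨f, hf⟩ := ZFSet.mem_range.1 y.2
  exact ⟨f.1, f.2, hf⟩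

/-- The value `y(x)` for `y` in the dual ball of `M`. -/
def eval (y : X.dualBall) : X.carrier → ℝ := Classical.choose (X.exists_of_dualBall y)

theorem graph_eval (y : X.dualBall) : X.graph (X.eval y) = y.1 :=
  (Classical.choose_spec (X.exists_of_dualBall y)).2

/-- The weak-star topology (pointwise convergence) of the dual ball, as formed in `M`. -/
def weakStarOpens : ZFSet.{u} :=
  X.dualBall.powerset.sep fun O => O ∈ M ∧ ∀ y : X.dualBall, y.1 ∈ O →
    ∃ (s : Finset X.carrier) (ε : ℚ), 0 < ε ∧
      ∀ z : X.dualBall, (∀ x ∈ s, |X.eval z x - X.eval y x| < ε) → z.1 ∈ O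

/-- The graph of the bracket `(x, y) ↦ y(x)` on the product of `X` and its dual ball, in `M`. -/
def bracket : ZFSet.{u} :=
  ZFSet.range fun c : X.carrier × X.dualBall =>
    ZFSet.pair (ZFSet.pair c.1.1 c.2.1) (realCode (X.eval c.2 c.1))

/-- The vector space operations and the norm of `E` are interpretations of those of `X` along `p`.
(They are continuous for the norm topology of `E`.) -/
structure PreservesStructure {E : Type v} [NormedAddCommGroup E] [NormedSpace ℝ E]
    (p : X.carrier → E) : Prop where
  map_add : ∀ x y, p (x + y) = p x + p y
  map_smul : ∀ (r : realsIn M) (x), p (X.smul r x) = (r : ℝ) • p x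
  norm_map : ∀ x, ‖p x‖ = X.norm x

end BanachIn

/-- The closed unit ball of the dual of `E`; as a subset of `WeakDual ℝ E` it carries the
weak-star topology. -/
def weakStarBall (E : Type v) [NormedAddCommGroup E] [NormedSpace ℝ E] : Set (WeakDual ℝ E) :=
  WeakDual.toStrongDual ⁻¹' Metric.closedBall (0 : StrongDual ℝ E) 1

end ZModel

end

-- Everything rests on one criterion, `InterpretedBasis.isInterpretation`. Let a space of `M` have a
-- basis indexed by a set of `M`, let `E` be a regular space with a basis indexed by the same set,
-- and let the map on points respect membership in basic sets. Suppose that (a) whenever a family of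
-- basic sets lying in `M` covers a basic set in `M`, the corresponding subsets of `E` still cover,
-- and (b) every family of basic sets which is prime for the coverings in `M` admits a point of `E`
-- all of whose basic neighbourhoods belong to it. By (a), sending an open set to the union of the
-- basic sets it contains is a preinterpretation. A point of any other preinterpretation determines
-- a prime family, and (b) provides its image in `E`.
--
-- For a complete metric space with the balls as basis, (b) is completeness and (a) is the
-- absoluteness of well-foundedness. If a point `e` of a ball escapes a cover `G` of that ball in
-- `M`, consider the pairs `(x, ε)` such that no ball of `G` contains the `ε`-ball around `x` by the
-- triangle inequality alone. Points of `M` converging to `e` give an infinite branch through such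
-- pairs. By `exists_descending` there is then a branch in `M`; its centres converge in `M` to a
-- point of the ball which lies in no member of `G`. This applies to the reals and to `X` itself.
--
-- For the dual ball the basic sets are given by finitely many bounds `q < y x`, and (a) is
-- compactness. A functional is a valuation of the atoms `(x, q)`, and additivity, the norm bound
-- and avoidance of a basic set are finite clauses. If no finite part of a cover in `M` covers the
-- true closed box, then functionals outside `M` satisfy every finite set of clauses. Satisfiability
-- of finitely many finite clauses is absolute, so propositional compactness inside `M`
-- (`exists_valuation`) yields a functional of `M` that escapes the cover. This is
-- `exists_finite_cover`. For (b), a prime family determines a cut at every vector, and the cuts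
-- form an additive function (`exists_additive`). For the product, the tube lemma combines the
-- metric and the compact cases (`cover_prodMem`).
--
-- The completion of `X` interprets `X`, and interpretations are unique up to homeomorphism, so each
-- of them carries the Banach space structure of the completion. A compatible norm makes this
-- homeomorphism an isometry. Interpretations of functions are unique because the points of `M` are
-- dense.
--
-- Every set formed in `M` needs its definition to be first-order over `M`. The classes `DefRel`,
-- `DefPred` and `DefFun` leave this to instance search: types are coded by definable classes of
-- `M`, and definability passes through connectives, quantifiers and substitution.

universe w₁ w₂ w₃

set_option synthInstance.maxSize 10000
set_option synthInstance.maxHeartbeats 200000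

noncomputable section

namespace ZModel

open Set

/-! ### Definable classes over a transitive model -/

/-- A relation on the model `M` which is first-order definable with parameters. -/
class DefRel {M : Set ZFSet.{u}} {ι : Type} (φ : (ι → M) → Prop) : Prop where
  definable : (Set.univ : Set M).Definable setLanguage {v | φ v}

/-- A subclass of the model `M` which is first-order definable with parameters. -/
class DefClass {M : Set ZFSet.{u}} (S : Set M) : Prop where
  definable : (Set.univ : Set M).Definable₁ setLanguage S

namespace DefRel

variable {M : Set ZFSet.{u}} {ι : Type}

instance and {φ ψ : (ι → M) → Prop} [hφ : DefRel φ] [hψ : DefRel ψ] :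
    DefRel fun v => φ v ∧ ψ v := ⟨hφ.1.inter hψ.1⟩

instance or {φ ψ : (ι → M) → Prop} [hφ : DefRel φ] [hψ : DefRel ψ] :
    DefRel fun v => φ v ∨ ψ v := ⟨hφ.1.union hψ.1⟩

instance not {φ : (ι → M) → Prop} [hφ : DefRel φ] : DefRel fun v => ¬ φ v := ⟨hφ.1.compl⟩

theorem congr {φ ψ : (ι → M) → Prop} (hφ : DefRel φ) (h : ∀ v, ψ v ↔ φ v) : DefRel ψ := by
  have : ψ = φ := funext fun v => propext (h v)
  rwa [this]

instance imp {φ ψ : (ι → M) → Prop} [DefRel φ] [DefRel ψ] : DefRel fun v => φ v → ψ v :=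
  congr (φ := fun v => ¬ φ v ∨ ψ v) inferInstance fun _ => imp_iff_not_or

instance iff {φ ψ : (ι → M) → Prop} [DefRel φ] [DefRel ψ] : DefRel fun v => φ v ↔ ψ v :=
  congr (φ := fun v => (φ v → ψ v) ∧ (ψ v → φ v)) inferInstance fun _ => iff_iff_implies_and_implies

/-- Quantification is projection: the bound variable is the coordinate `none` of `Option ι`, which
is forgotten along `some`. -/
instance ex [Finite ι] {φ : (ι → M) → M → Prop}
    [h : DefRel fun w : Option ι → M => φ (fun i => w (some i)) (w none)] :
    DefRel fun v => ∃ x, φ v x := by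
  refine ⟨?_⟩
  convert! h.1.image_comp (some : ι → Option ι) using 1
  ext v
  constructor
  · rintro ⟨x, hx⟩
    exact ⟨fun o => o.elim x v, hx, rfl⟩
  · rintro ⟨w, hw, rfl⟩
    exact ⟨w none, hw⟩

instance all [Finite ι] {φ : (ι → M) → M → Prop}
    [DefRel fun w : Option ι → M => φ (fun i => w (some i)) (w none)] :
    DefRel fun v => ∀ x, φ v x :=
  congr (φ := fun v => ¬ ∃ x, ¬ φ v x) inferInstance fun _ => by push Not; rfl

/-- The membership symbol. -/
def memSymbol : setLanguage.Relations 2 := MemSymbol.mem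

instance mem (i j : ι) : DefRel fun v : ι → M => (v i).1 ∈ (v j).1 := by
  refine ⟨⟨FirstOrder.Language.Relations.formula
    ((setLanguage.lhomWithConstants (Set.univ : Set M)).onRelation memSymbol)
    ![FirstOrder.Language.Term.var i, FirstOrder.Language.Term.var j], ?_⟩⟩
  ext v
  change _ ↔ FirstOrder.Language.Formula.Realize _ v
  rw [FirstOrder.Language.Formula.realize_rel, FirstOrder.Language.LHom.map_onRelation]
  rfl

instance eq (i j : ι) : DefRel fun v : ι → M => v i = v j := by
  refine ⟨⟨FirstOrder.Language.Term.equal (.var i) (.var j), ?_⟩⟩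
  ext v
  simp

instance memClass {S : Set M} [h : DefClass S] (i : ι) : DefRel fun v : ι → M => v i ∈ S := by
  have := h.1.preimage_comp (fun _ : Fin 1 => i)
  exact ⟨this⟩

instance singleton (c : M) : DefClass ({c} : Set M) :=
  ⟨Set.Definable.singleton_of_mem _ (Set.mem_univ _)⟩

instance eqConst (i : ι) (c : M) : DefRel fun v : ι → M => v i = c :=
  congr (φ := fun v => v i ∈ ({c} : Set M)) inferInstance fun _ => by simp

instance memConst (i : ι) (c : M) : DefRel fun v : ι → M => (v i).1 ∈ c.1 := by
  refine ⟨?_⟩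
  have : DefClass {x : M | x.1 ∈ c.1} := by
    refine ⟨?_⟩
    have h : DefRel fun v : Fin 1 → M => ∃ y : M, y = c ∧ (v 0).1 ∈ y.1 := inferInstance
    change (Set.univ : Set M).Definable setLanguage {v : Fin 1 → M | (v 0).1 ∈ c.1}
    convert! h.1 using 1
    ext v; simp
  exact (memClass (S := {x : M | x.1 ∈ c.1}) i).1

end DefRel

theorem DefClass.of {M : Set ZFSet.{u}} {S : Set M} (φ : (Fin 1 → M) → Prop) (hφ : DefRel φ)
    (h : ∀ x, x ∈ S ↔ φ fun _ => x) : DefClass S := by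
  refine ⟨?_⟩
  change (Set.univ : Set M).Definable setLanguage {v : Fin 1 → M | v 0 ∈ S}
  convert! hφ.1 using 1
  ext v
  simp only [Set.mem_ofPred_eq, h]
  rw [show (fun _ => v 0) = v from funext fun i => by rw [Subsingleton.elim i 0]]

/-! ### Closure of a transitive model under elementary set operations -/

section Transitive

variable {M : Set ZFSet.{u}} [hM : Fact (IsTransitiveModel M)]

theorem mem_of_mem {x y : ZFSet.{u}} (hy : y ∈ M) (h : x ∈ y) : x ∈ M :=
  hM.1.transitive y hy x h

/-- A class of `M` which coincides on `M` with an element of `M`. -/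
theorem eq_of_mem_iff {a b : M} (h : ∀ z : M, z.1 ∈ a.1 ↔ z.1 ∈ b.1) : a = b :=
  hM.1.satisfiesZFC.extensionality a b h

theorem upair_mem {a b : ZFSet.{u}} (ha : a ∈ M) (hb : b ∈ M) : ({a, b} : ZFSet.{u}) ∈ M := by
  obtain ⟨c, hc⟩ := hM.1.satisfiesZFC.pairing ⟨a, ha⟩ ⟨b, hb⟩
  convert! c.2
  ext z
  rw [ZFSet.mem_pair]
  constructor
  · rintro (rfl | rfl)
    · exact (hc ⟨_, ha⟩).2 (Or.inl rfl)
    · exact (hc ⟨_, hb⟩).2 (Or.inr rfl)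
  · intro hz
    simpa [Subtype.ext_iff] using (hc ⟨z, mem_of_mem c.2 hz⟩).1 hz

theorem singleton_mem {a : ZFSet.{u}} (ha : a ∈ M) : ({a} : ZFSet.{u}) ∈ M := by
  simpa using upair_mem ha ha

theorem pair_mem {a b : ZFSet.{u}} (ha : a ∈ M) (hb : b ∈ M) : ZFSet.pair a b ∈ M :=
  upair_mem (singleton_mem ha) (upair_mem ha hb)

theorem union_mem {a b : ZFSet.{u}} (ha : a ∈ M) (hb : b ∈ M) : a ∪ b ∈ M := by
  obtain ⟨c, hc⟩ := hM.1.satisfiesZFC.union ⟨_, upair_mem ha hb⟩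
  convert! c.2
  ext z
  constructor
  · intro hz
    rcases ZFSet.mem_union.1 hz with h | h
    · exact (hc ⟨z, mem_of_mem ha h⟩).2 ⟨⟨a, ha⟩, by simp, h⟩
    · exact (hc ⟨z, mem_of_mem hb h⟩).2 ⟨⟨b, hb⟩, by simp, h⟩
  · intro hz
    obtain ⟨x, hx, hz⟩ := (hc ⟨z, mem_of_mem c.2 hz⟩).1 hz
    rcases ZFSet.mem_pair.1 hx with h | h <;> rw [h] at hz <;> simp [hz]

theorem insert_mem {a b : ZFSet.{u}} (ha : a ∈ M) (hb : b ∈ M) : insert a b ∈ M := by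
  rw [ZFSet.insert_eq]
  exact union_mem (singleton_mem ha) hb

theorem right_mem_of_pair_mem {a b : ZFSet.{u}} (h : ZFSet.pair a b ∈ M) : b ∈ M :=
  mem_of_mem (mem_of_mem h (y := ZFSet.pair a b) (x := {a, b}) (by simp [ZFSet.pair])) (by simp)

/-- The ordered pair, as an operation of `M`. -/
def mpair (a b : M) : M := ⟨ZFSet.pair a.1 b.1, pair_mem a.2 b.2⟩

theorem mpair_inj {a b c d : M} : mpair a b = mpair c d ↔ a = c ∧ b = d := by
  simp [mpair, Subtype.ext_iff]

/-- The Kuratowski pair is described by its two elements. By transitivity, extensionality in `M`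
identifies a set which has the right elements within `M` with the true singleton or unordered pair.
-/
instance DefRel.pair {ι : Type} [Finite ι] (i j k : ι) :
    DefRel fun v : ι → M => v i = mpair (v j) (v k) := by
  refine DefRel.congr (φ := fun v => ∀ w : M, w.1 ∈ (v i).1 ↔
    ((∀ z : M, z.1 ∈ w.1 ↔ z = v j) ∨ (∀ z : M, z.1 ∈ w.1 ↔ (z = v j ∨ z = v k)))) inferInstance ?_
  intro v
  have h1 : ∀ w : M, (∀ z : M, z.1 ∈ w.1 ↔ z = v j) ↔ w.1 = {(v j).1} := by
    intro w
    constructor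
    · intro h
      have := eq_of_mem_iff (a := w) (b := ⟨_, singleton_mem (v j).2⟩) (fun z => by
        rw [h z]; simp [Subtype.ext_iff])
      rw [this]
    · intro h z
      rw [h]; simp [Subtype.ext_iff]
  have h2 : ∀ w : M, (∀ z : M, z.1 ∈ w.1 ↔ (z = v j ∨ z = v k)) ↔ w.1 = {(v j).1, (v k).1} := by
    intro w
    constructor
    · intro h
      have := eq_of_mem_iff (a := w) (b := ⟨_, upair_mem (v j).2 (v k).2⟩) (fun z => by
        rw [h z]; simp [Subtype.ext_iff])
      rw [this]
    · intro h z
      rw [h]; simp [Subtype.ext_iff]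
  simp only [h1, h2]
  constructor
  · intro h w
    rw [h]
    simp [mpair, ZFSet.pair]
  · intro h
    refine eq_of_mem_iff fun z => ?_
    rw [h z]
    simp [mpair, ZFSet.pair]

end Transitive

/-! ### Types coded in the model -/

/-- The elements of the type `A` are coded by the elements of a definable class of `M`. -/
class Coded (M : Set ZFSet.{u}) (A : Type w) where
  code : A → M
  injective : Function.Injective code
  range_definable : DefClass (Set.range code)

open Coded (code)

section

variable (M : Set ZFSet.{u}) {A : Type w} {B : Type w₁} {C : Type w₂}

/-- The class of the codes of the objects with a given property. -/
def codes [Coded M A] (φ : A → Prop) : Set M := {x | ∃ a, φ a ∧ Coded.code a = x}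

/-- The property `φ` of coded objects is definable over `M`. -/
class DefPred [Coded M A] (φ : A → Prop) : Prop where
  definable : DefClass (codes M φ)

variable {M}

theorem code_inj [Coded M A] {a b : A} : (Coded.code a : M) = Coded.code b ↔ a = b :=
  Coded.injective.eq_iff

theorem code_mem_codes [Coded M A] {φ : A → Prop} {a : A} : Coded.code a ∈ codes M φ ↔ φ a :=
  ⟨fun ⟨_, hb, h⟩ => code_inj.1 h ▸ hb, fun h => ⟨a, h, rfl⟩⟩

instance [Coded M A] : DefClass (Set.range (Coded.code : A → M)) := Coded.range_definable

instance [Coded M A] {φ : A → Prop} [h : DefPred M φ] : DefClass (codes M φ) := h.1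

theorem DefPred.congr [Coded M A] {φ ψ : A → Prop} (hφ : DefPred M φ) (h : ∀ a, ψ a ↔ φ a) :
    DefPred M ψ := by
  have : ψ = φ := funext fun v => propext (h v)
  rwa [this]

instance Coded.self : Coded M M where
  code := id
  injective := Function.injective_id
  range_definable := DefClass.of (fun v => v 0 = v 0) inferInstance fun x => by simp

variable [hM : Fact (IsTransitiveModel M)] [Coded M A] [Coded M B] [Coded M C]

instance Coded.prod : Coded M (A × B) where
  code p := mpair (code p.1) (code p.2)
  injective := by
    intro p q h
    obtain ⟨h₁, h₂⟩ := mpair_inj.1 h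
    exact Prod.ext (Coded.injective h₁) (Coded.injective h₂)
  range_definable := DefClass.of (fun v => ∃ x y : M, (x ∈ Set.range (code : A → M) ∧
      y ∈ Set.range (code : B → M)) ∧ v 0 = mpair x y) inferInstance fun z => by
    constructor
    · rintro ⟨p, rfl⟩
      exact ⟨_, _, ⟨⟨p.1, rfl⟩, ⟨p.2, rfl⟩⟩, rfl⟩
    · rintro ⟨_, _, ⟨⟨a, rfl⟩, ⟨b, rfl⟩⟩, h⟩
      exact ⟨(a, b), h.symm⟩

theorem code_prod (a : A) (b : B) : (code (a, b) : M) = mpair (code a) (code b) := rfl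

theorem mem_codes_graph {f : A → B} {z : M} :
    z ∈ codes M (fun p : A × B => f p.1 = p.2) ↔ ∃ a, z = mpair (code a) (code (f a)) := by
  constructor
  · rintro ⟨⟨a, b⟩, h, rfl⟩
    exact ⟨a, congrArg (fun b => mpair (code a : M) (code b)) (Eq.symm h)⟩
  · rintro ⟨a, rfl⟩
    exact ⟨(a, f a), rfl, rfl⟩

variable (M) in
/-- The function `f` between coded types is definable over `M`. -/
class DefFun (f : A → B) : Prop where
  definable : DefPred M fun p : A × B => f p.1 = p.2

-- The last hypothesis is needed because the class of codes of `φ` contains nothing but codes, so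
-- `ψ` has to exclude all other elements of `M` by itself.
omit hM in
theorem DefPred.of_rel {φ : A → Prop} (ψ : (Fin 1 → M) → Prop) (hψ : DefRel ψ)
    (h : ∀ a, φ a ↔ ψ fun _ => code a) (h' : ∀ v, ψ v → ∃ a : A, code a = v 0) : DefPred M φ := by
  refine ⟨DefClass.of ψ hψ fun x => ?_⟩
  constructor
  · rintro ⟨a, ha, rfl⟩
    exact (h a).1 ha
  · intro hx
    obtain ⟨a, ha⟩ := h' _ hx
    refine ⟨a, (h a).2 ?_, ha⟩
    rwa [ha]

/-! ### Closure properties of definable predicates -/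

namespace DefPred

omit hM in
instance and {φ ψ : A → Prop} [DefPred M φ] [DefPred M ψ] : DefPred M fun a => φ a ∧ ψ a :=
  of_rel (fun v => v 0 ∈ codes M φ ∧ v 0 ∈ codes M ψ) inferInstance
    (fun a => by simp only [code_mem_codes]) (fun v h => by
      obtain ⟨a, -, ha⟩ := h.1
      exact ⟨a, ha⟩)

omit hM in
instance not {φ : A → Prop} [DefPred M φ] : DefPred M fun a => ¬ φ a :=
  of_rel (fun v => v 0 ∈ Set.range (code : A → M) ∧ ¬ v 0 ∈ codes M φ) inferInstance
    (fun a => by simp [code_mem_codes]) (fun v h => h.1)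

omit hM in
instance or {φ ψ : A → Prop} [DefPred M φ] [DefPred M ψ] : DefPred M fun a => φ a ∨ ψ a :=
  DefPred.congr (φ := fun a => ¬ (¬ φ a ∧ ¬ ψ a)) inferInstance fun _ => by tauto

omit hM in
instance (priority := low) imp {φ ψ : A → Prop} [DefPred M φ] [DefPred M ψ] :
    DefPred M fun a => φ a → ψ a :=
  DefPred.congr (φ := fun a => ¬ (φ a ∧ ¬ ψ a)) inferInstance fun _ => by tauto

omit hM in
instance iff {φ ψ : A → Prop} [DefPred M φ] [DefPred M ψ] : DefPred M fun a => φ a ↔ ψ a :=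
  DefPred.congr (φ := fun a => (φ a → ψ a) ∧ (ψ a → φ a)) inferInstance fun _ => by tauto

instance ex {φ : A → B → Prop} [DefPred M fun p : A × B => φ p.1 p.2] :
    DefPred M fun a => ∃ b, φ a b :=
  of_rel (fun v => v 0 ∈ Set.range (code : A → M) ∧
      ∃ z y : M, z ∈ codes M (fun p : A × B => φ p.1 p.2) ∧ z = mpair (v 0) y) inferInstance
    (fun a => by
      constructor
      · rintro ⟨b, hb⟩
        exact ⟨⟨a, rfl⟩, _, code b, code_mem_codes (a := (a, b)).2 hb, rfl⟩
      · rintro ⟨-, _, _, ⟨⟨a', b⟩, h, rfl⟩, h'⟩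
        rw [code_prod, mpair_inj, code_inj] at h'
        exact ⟨b, h'.1 ▸ h⟩)
    (fun v h => h.1)

instance all {φ : A → B → Prop} [DefPred M fun p : A × B => φ p.1 p.2] :
    DefPred M fun a => ∀ b, φ a b :=
  DefPred.congr (φ := fun a => ¬ ∃ b, ¬ φ a b) inferInstance fun _ => by push Not; rfl

-- The proposition need not be expressible over `M`: its truth value is decided outside, and only
-- the full or the empty class has to be definable.
omit hM in
instance (priority := high) const (P : Prop) : DefPred M fun _ : A => P := by
  by_cases h : P
  · exact of_rel (fun v => v 0 ∈ Set.range (code : A → M)) inferInstance (fun a => by simp [h])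
      (fun v h => h)
  · exact of_rel (fun v => ¬ v 0 = v 0) inferInstance (fun a => by simp [h])
      (fun v h => by simp at h)

theorem comp {f : A → B} [hf : DefFun M f] {φ : B → Prop} [DefPred M φ] :
    DefPred M fun a => φ (f a) := by
  have := hf.1
  refine of_rel (fun v => v 0 ∈ Set.range (code : A → M) ∧
      ∃ z y : M, z ∈ codes M (fun p : A × B => f p.1 = p.2) ∧ z = mpair (v 0) y ∧ y ∈ codes M φ)
    inferInstance (fun a => ?_) (fun v h => h.1)
  constructor
  · intro h
    exact ⟨⟨a, rfl⟩, _, _, mem_codes_graph.2 ⟨a, rfl⟩, rfl, code_mem_codes.2 h⟩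
  · rintro ⟨-, z, y, hz, h', hφ⟩
    obtain ⟨a', rfl⟩ := mem_codes_graph.1 hz
    rw [mpair_inj, code_inj] at h'
    rw [← h'.2, code_mem_codes] at hφ
    exact h'.1 ▸ hφ

end DefPred

theorem DefFun.of_rel {f : A → B} (ψ : (Fin 2 → M) → Prop) (hψ : DefRel ψ)
    (h : ∀ a b, ψ ![code a, code b] ↔ f a = b) : DefFun M f := by
  have : DefRel fun w : Option (Option (Fin 1)) → M => ψ ![w (some none), w none] := by
    refine ⟨?_⟩
    convert! hψ.1.preimage_comp ![some none, none] using 1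
    ext w
    refine iff_of_eq (congrArg ψ ?_)
    ext i
    fin_cases i <;> rfl
  refine ⟨DefPred.of_rel (fun v => ∃ x y : M, ψ ![x, y] ∧ v 0 = mpair x y ∧
    x ∈ Set.range (code : A → M) ∧ y ∈ Set.range (code : B → M)) inferInstance ?_ ?_⟩
  · rintro ⟨a, b⟩
    constructor
    · intro e
      exact ⟨_, _, (h a b).2 e, rfl, ⟨a, rfl⟩, ⟨b, rfl⟩⟩
    · rintro ⟨x, y, hxy, e, -, -⟩
      obtain ⟨rfl, rfl⟩ := mpair_inj.1 (show mpair (code a) (code b) = mpair x y from e)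
      exact (h a b).1 hxy
  · rintro v ⟨_, _, -, e, ⟨a, rfl⟩, ⟨b, rfl⟩⟩
    exact ⟨(a, b), e.symm⟩

/-- A function is definable when it preserves codes. -/
theorem DefFun.of_code {f : A → B} (h : ∀ a, (code (f a) : M) = code a) : DefFun M f :=
  .of_rel (fun v => v 0 = v 1) inferInstance fun a b => by
    change code a = code b ↔ _
    rw [← h, code_inj]

/-! ### Closure properties of definable functions -/

namespace DefFun

instance id : DefFun M fun a : A => a := .of_code fun _ => rfl

instance (priority := high) const (b : B) : DefFun M fun _ : A => b :=
  .of_rel (fun v => v 1 = code b) inferInstance fun a b' => by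
    change code b' = code b ↔ _
    rw [code_inj, eq_comm]

theorem of_pred {f : A → B} (h : DefPred M fun p : A × B => f p.1 = p.2) : DefFun M f := ⟨h⟩

instance fst' : DefFun M (Prod.fst : A × B → A) :=
  .of_rel (fun v => ∃ y : M, v 0 = mpair (v 1) y) inferInstance fun a b => by
    change (∃ y, mpair (code a.1) (code a.2) = mpair (code b) y) ↔ _
    simp [mpair_inj, code_inj]

instance snd' : DefFun M (Prod.snd : A × B → B) :=
  .of_rel (fun v => ∃ y : M, v 0 = mpair y (v 1)) inferInstance fun a b => by
    change (∃ y, mpair (code a.1) (code a.2) = mpair y (code b)) ↔ _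
    simp [mpair_inj, code_inj]

theorem comp {g : B → C} {f : A → B} [hg : DefFun M g] [hf : DefFun M f] :
    DefFun M fun a => g (f a) := by
  have h1 := hf.1
  have h2 := hg.1
  refine .of_rel (fun v => ∃ y z z' : M, z ∈ codes M (fun p : A × B => f p.1 = p.2) ∧
    z = mpair (v 0) y ∧ z' ∈ codes M (fun p : B × C => g p.1 = p.2) ∧ z' = mpair y (v 1))
    inferInstance fun a c => ?_
  constructor
  · rintro ⟨y, z, z', hz, e, hz', e'⟩
    obtain ⟨a', rfl⟩ := mem_codes_graph.1 hz
    obtain ⟨b', rfl⟩ := mem_codes_graph.1 hz'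
    obtain ⟨e1, e2⟩ := mpair_inj.1 (show _ = mpair (code a) _ from e)
    obtain ⟨e3, e4⟩ := mpair_inj.1 (show _ = mpair _ (code c) from e')
    rw [← e2, code_inj] at e3
    rw [code_inj] at e1 e4
    rw [← e4, e3, e1]
  · rintro rfl
    exact ⟨code (f a), _, _, mem_codes_graph.2 ⟨a, rfl⟩, rfl, mem_codes_graph.2 ⟨f a, rfl⟩, rfl⟩

instance fst {f : A → B × C} [DefFun M f] : DefFun M fun a => (f a).1 := comp (g := Prod.fst)

instance snd {f : A → B × C} [DefFun M f] : DefFun M fun a => (f a).2 := comp (g := Prod.snd)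

instance pair {f : A → B} {g : A → C} [hf : DefFun M f] [hg : DefFun M g] :
    DefFun M fun a => (f a, g a) := by
  have h1 := hf.1
  have h2 := hg.1
  refine .of_rel (fun v => ∃ y y' z z' : M, z ∈ codes M (fun p : A × B => f p.1 = p.2) ∧
    z = mpair (v 0) y ∧ z' ∈ codes M (fun p : A × C => g p.1 = p.2) ∧ z' = mpair (v 0) y' ∧
    v 1 = mpair y y') inferInstance fun a p => ?_
  constructor
  · rintro ⟨y, y', z, z', hz, e, hz', e', e''⟩
    obtain ⟨a', rfl⟩ := mem_codes_graph.1 hz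
    obtain ⟨b', rfl⟩ := mem_codes_graph.1 hz'
    obtain ⟨e1, rfl⟩ := mpair_inj.1 (show _ = mpair (code a) _ from e)
    obtain ⟨e3, rfl⟩ := mpair_inj.1 (show _ = mpair (code a) _ from e')
    obtain ⟨e5, e6⟩ := mpair_inj.1 (show mpair (code p.1) (code p.2) = mpair _ _ from e'')
    rw [code_inj] at e1 e3 e5 e6
    rw [e1] at e5
    rw [e3] at e6
    exact Prod.ext e5.symm e6.symm
  · rintro rfl
    exact ⟨code (f a), code (g a), _, _, mem_codes_graph.2 ⟨a, rfl⟩, rfl,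
      mem_codes_graph.2 ⟨a, rfl⟩, rfl, rfl⟩

instance pair_left (a : A) : DefFun M (Prod.mk a : B → A × B) :=
  pair (f := fun _ => a) (g := fun x => x)

end DefFun

/-- The low priority makes this apply only to variables `g`. -/
instance (priority := 50) DefFun.app {g : B → C} {f : A → B} [hg : DefFun M g] [hf : DefFun M f] :
    DefFun M fun a => g (f a) := DefFun.comp

instance (priority := 50) DefPred.app {φ : B → Prop} {f : A → B} [hg : DefPred M φ]
    [hf : DefFun M f] : DefPred M fun a => φ (f a) := DefPred.comp

instance DefFun.code_apply {f : A → B} [DefFun M f] : DefFun M fun a => (code (f a) : M) :=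
  have : DefFun M fun b : B => (Coded.code b : M) := .of_code fun _ => rfl
  DefFun.comp

namespace DefPred

instance eq {f g : A → B} [DefFun M f] [hg : DefFun M g] : DefPred M fun a => f a = g a := by
  have := hg.1
  exact DefPred.congr (comp (M := M) (f := fun a => (a, f a)) (φ := fun p : A × B => g p.1 = p.2))
    fun a => eq_comm

/-- Membership between codes. -/
theorem code_mem' : DefPred M fun p : A × B => (code p.1 : M).1 ∈ (code p.2 : M).1 :=
  of_rel (fun v => ∃ x y : M, v 0 = mpair x y ∧ x.1 ∈ y.1 ∧
    x ∈ Set.range (code : A → M) ∧ y ∈ Set.range (code : B → M)) inferInstance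
    (by
      rintro ⟨a, b⟩
      constructor
      · intro h
        exact ⟨_, _, rfl, h, ⟨a, rfl⟩, ⟨b, rfl⟩⟩
      · rintro ⟨x, y, e, h, -, -⟩
        obtain ⟨rfl, rfl⟩ := mpair_inj.1 (show mpair (code a) (code b) = mpair x y from e)
        exact h)
    (by
      rintro v ⟨_, _, e, -, ⟨a, rfl⟩, ⟨b, rfl⟩⟩
      exact ⟨(a, b), e.symm⟩)

instance code_mem {f : A → B} {g : A → C} [DefFun M f] [DefFun M g] :
    DefPred M fun a => (code (f a) : M).1 ∈ (code (g a) : M).1 := by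
  have := code_mem' (M := M) (A := B) (B := C)
  exact comp (f := fun a => (f a, g a))
    (φ := fun p : B × C => (code p.1 : M).1 ∈ (code p.2 : M).1)

end DefPred

end

section

variable {M : Set ZFSet.{u}} [hM : Fact (IsTransitiveModel M)]
  {A : Type w} {B : Type w₁} {C : Type w₂}

/-! ### Sets of the model -/

variable (M) in
/-- The codes of the elements of `A` form a set of the model. -/
class SetCoded (A : Type w) [Coded M A] : Prop where
  exists_range : ∃ s : M, ∀ x : M, x.1 ∈ s.1 ↔ x ∈ Set.range (code : A → M)

theorem exists_codes [Coded M A] [SetCoded M A] (φ : A → Prop) [h : DefPred M φ] :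
    ∃ s : M, ∀ x : M, x.1 ∈ s.1 ↔ x ∈ codes M φ := by
  obtain ⟨s, hs⟩ := SetCoded.exists_range (M := M) (A := A)
  obtain ⟨t, ht⟩ := hM.1.satisfiesZFC.separation (codes M φ) h.1.1 s
  refine ⟨t, fun x => ?_⟩
  rw [ht x, hs x]
  exact ⟨fun h => h.2, fun h => ⟨by obtain ⟨a, -, rfl⟩ := h; exact ⟨a, rfl⟩, h⟩⟩

theorem exists_codes_of_subset [Coded M A] (φ : A → Prop) [h : DefPred M φ] (s : M)
    (hs : ∀ a, φ a → (code a : M).1 ∈ s.1) :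
    ∃ s : M, ∀ x : M, x.1 ∈ s.1 ↔ x ∈ codes M φ := by
  obtain ⟨t, ht⟩ := hM.1.satisfiesZFC.separation (codes M φ) h.1.1 s
  refine ⟨t, fun x => ?_⟩
  rw [ht x]
  exact ⟨fun h => h.2, fun h => ⟨by obtain ⟨a, ha, rfl⟩ := h; exact hs a ha, h⟩⟩

/-- Replacement. -/
theorem exists_image [Coded M A] [Coded M C] [SetCoded M A] (φ : A → C → Prop)
    [DefPred M fun p : A × C => φ p.1 p.2] (hφ : ∀ a c c', φ a c → φ a c' → c = c') :
    ∃ s : M, ∀ x : M, x.1 ∈ s.1 ↔ x ∈ codes M fun c => ∃ a, φ a c := by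
  obtain ⟨t, ht⟩ := exists_codes (M := M) fun a : A => ∃ c, φ a c
  obtain ⟨s, hs⟩ := hM.1.satisfiesZFC.replacement
    {p | ∃ z : M, z ∈ codes M (fun p : A × C => φ p.1 p.2) ∧ z = mpair p.1 p.2}
    (by
      have : DefRel fun v : Fin 2 → M =>
        ∃ z : M, z ∈ codes M (fun p : A × C => φ p.1 p.2) ∧ z = mpair (v 0) (v 1) := inferInstance
      exact this.1) t
    (by
      intro x hx
      obtain ⟨a, ⟨c, hc⟩, rfl⟩ := (ht x).1 hx
      refine ⟨code c, ⟨_, code_mem_codes (a := (a, c)).2 hc, rfl⟩, ?_⟩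
      rintro y ⟨_, ⟨⟨a', c'⟩, h, rfl⟩, e⟩
      obtain ⟨e1, rfl⟩ := mpair_inj.1 e
      rw [code_inj] at e1
      simp only at e1 h
      subst e1
      exact congrArg code (hφ _ _ _ h hc))
  refine ⟨s, fun y => ?_⟩
  rw [hs y]
  constructor
  · rintro ⟨x, -, _, ⟨⟨a', c'⟩, h, rfl⟩, e⟩
    obtain ⟨e1, rfl⟩ := mpair_inj.1 e
    exact ⟨c', ⟨a', h⟩, rfl⟩
  · rintro ⟨c, ⟨a, h⟩, rfl⟩
    exact ⟨code a, (ht _).2 ⟨a, ⟨c, h⟩, rfl⟩, _, code_mem_codes (a := (a, c)).2 h, rfl⟩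

/-- Finiteness is meant in the outer universe. That `M` contains all of its finite subsets is what
makes finiteness, iteration and finite satisfiability absolute. -/
theorem exists_finite {S : Set M} (hS : S.Finite) : ∃ s : M, ∀ x : M, x.1 ∈ s.1 ↔ x ∈ S := by
  induction S, hS using Set.Finite.induction_on with
  | empty =>
    obtain ⟨-, ⟨e, -, he⟩, -⟩ := hM.1.satisfiesZFC.infinity
    exact ⟨e, fun x => by simp [he x]⟩
  | @insert a s _ _ ih =>
    obtain ⟨t, ht⟩ := ih
    refine ⟨⟨insert a.1 t.1, insert_mem a.2 t.2⟩, fun x => ?_⟩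
    simp [ht x, Subtype.ext_iff]

theorem empty_mem : (∅ : ZFSet.{u}) ∈ M := by
  obtain ⟨s, hs⟩ := exists_finite (M := M) Set.finite_empty
  convert! s.2
  ext z
  simp only [ZFSet.notMem_empty, false_iff]
  intro hz
  exact (hs ⟨z, mem_of_mem s.2 hz⟩).1 hz

/-! ### Elements of sets of the model -/

instance Coded.coe (X : ZFSet.{u}) [hX : Fact (X ∈ M)] : Coded M X where
  code x := ⟨x.1, mem_of_mem hX.1 x.2⟩
  injective := fun x y h => Subtype.ext (congrArg (fun z : M => z.1) h)
  range_definable := DefClass.of (fun v => (v 0).1 ∈ (⟨X, hX.1⟩ : M).1) inferInstance fun x =>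
    ⟨by rintro ⟨y, rfl⟩; exact y.2, fun h => ⟨⟨x.1, h⟩, rfl⟩⟩

instance SetCoded.coe (X : ZFSet.{u}) [hX : Fact (X ∈ M)] : SetCoded M X where
  exists_range := ⟨⟨X, hX.1⟩, fun x =>
    ⟨fun h => ⟨⟨x.1, h⟩, rfl⟩, by rintro ⟨y, rfl⟩; exact y.2⟩⟩

/-- Replacement gives each slice `{a} × B`, a second replacement collects the slices, and the axiom
of union assembles the product. -/
instance SetCoded.prod [Coded M A] [Coded M B] [SetCoded M A] [SetCoded M B] :
    SetCoded M (A × B) where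
  exists_range := by
    have h (a : A) : ∃ s : M, ∀ x : M, x.1 ∈ s.1 ↔ x ∈ codes M fun p : A × B => ∃ b, p = (a, b) := by
      obtain ⟨s, hs⟩ := exists_image (M := M) (A := B) (C := A × B) (fun b p => p = (a, b))
        (fun _ _ _ h h' => h.trans h'.symm)
      exact ⟨s, fun x => by rw [hs x]⟩
    obtain ⟨t, ht⟩ := exists_image (M := M) (A := A) (C := M)
      (fun a s => ∀ x : M, (code x : M).1 ∈ (code s : M).1 ↔ ∃ b : B, x = code (a, b)) (by
        intro a s s' h h'
        refine eq_of_mem_iff fun z => ?_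
        exact (h z).trans (h' z).symm)
    obtain ⟨r, hr⟩ := hM.1.satisfiesZFC.union t
    refine ⟨r, fun x => ?_⟩
    rw [hr x]
    constructor
    · rintro ⟨s, hs, hx⟩
      obtain ⟨s, ⟨a, ha⟩, rfl⟩ := (ht s).1 hs
      obtain ⟨b, rfl⟩ := (ha x).1 hx
      exact ⟨(a, b), rfl⟩
    · rintro ⟨⟨a, b⟩, rfl⟩
      obtain ⟨s, hs⟩ := h a
      refine ⟨s, (ht s).2 ⟨s, ⟨a, fun x => ?_⟩, rfl⟩, (hs _).2 ⟨(a, b), ⟨b, rfl⟩, rfl⟩⟩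
      refine (hs x).trans ?_
      constructor
      · rintro ⟨_, ⟨b, rfl⟩, rfl⟩
        exact ⟨b, rfl⟩
      · rintro ⟨b, rfl⟩
        exact ⟨_, ⟨b, rfl⟩, rfl⟩

/-! ### Subsets which belong to the model -/

variable (M A) in
/-- The subsets of the coded type `A` which belong to the model. -/
structure MSet [Coded M A] where
  carrier : Set A
  exists_code : ∃ z : M, ∀ x : M, x.1 ∈ z.1 ↔ x ∈ codes M (· ∈ carrier)

namespace MSet

variable [Coded M A] [Coded M B] [Coded M C]

instance : SetLike (MSet M A) A where
  coe := carrier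
  coe_injective := by
    rintro ⟨_, _⟩ ⟨_, _⟩ rfl
    rfl

omit hM in
@[ext] theorem ext {s t : MSet M A} (h : ∀ a, a ∈ s ↔ a ∈ t) : s = t := SetLike.ext h

/-- The set of the model which codes `s`. -/
def toM (s : MSet M A) : M := s.exists_code.choose

omit hM in
theorem mem_toM {s : MSet M A} {x : M} : x.1 ∈ s.toM.1 ↔ x ∈ codes M (· ∈ s) :=
  s.exists_code.choose_spec x

omit hM in
theorem code_mem_toM {s : MSet M A} {a : A} : (code a : M).1 ∈ s.toM.1 ↔ a ∈ s := by
  rw [mem_toM, code_mem_codes]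

instance : Coded M (MSet M A) where
  code := toM
  injective := by
    intro s t h
    ext a
    rw [← code_mem_toM, h, code_mem_toM]
  range_definable := DefClass.of (fun v => ∀ x : M, x.1 ∈ (v 0).1 → x ∈ Set.range (code : A → M))
    inferInstance fun z => by
      constructor
      · rintro ⟨s, rfl⟩ x hx
        obtain ⟨a, -, rfl⟩ := mem_toM.1 hx
        exact ⟨a, rfl⟩
      · intro h
        have hz : ∀ x : M, x.1 ∈ z.1 ↔ x ∈ codes M fun a : A => (code a : M).1 ∈ z.1 := fun x =>
          ⟨fun hx => by obtain ⟨a, rfl⟩ := h x hx; exact ⟨a, hx, rfl⟩,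
            fun ⟨a, ha, e⟩ => e ▸ ha⟩
        refine ⟨⟨{a | (code a : M).1 ∈ z.1}, z, hz⟩, eq_of_mem_iff fun x => ?_⟩
        rw [mem_toM, hz]
        rfl

instance [SetCoded M A] : SetCoded M (MSet M A) where
  exists_range := by
    obtain ⟨s, hs⟩ := SetCoded.exists_range (M := M) (A := A)
    obtain ⟨t, ht⟩ := hM.1.satisfiesZFC.powerset s
    obtain ⟨r, hr⟩ := exists_codes_of_subset (M := M) (fun _ : MSet M A => True) t (fun a _ => by
      refine (ht _).2 fun x hx => ?_
      obtain ⟨a, -, rfl⟩ := mem_toM.1 hx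
      exact (hs _).2 ⟨a, rfl⟩)
    exact ⟨r, fun x => by rw [hr x]; simp [codes]⟩

instance defPred_mem {f : A → B} {g : A → MSet M B} [DefFun M f] [DefFun M g] :
    DefPred M fun a => f a ∈ g a :=
  DefPred.congr (φ := fun a => (code (f a) : M).1 ∈ (code (g a) : M).1) inferInstance
    fun _ => code_mem_toM.symm

instance defPred_mem_left (s : MSet M A) : DefPred M (Membership.mem s) :=
  defPred_mem (f := fun a => a) (g := fun _ => s)

/-- The set of all objects with a given property. -/
def sep [SetCoded M A] (φ : A → Prop) [DefPred M φ] : MSet M A := ⟨{a | φ a}, exists_codes φ⟩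

@[simp] theorem mem_sep [SetCoded M A] {φ : A → Prop} [DefPred M φ] {a : A} :
    a ∈ sep (M := M) φ ↔ φ a := Iff.rfl

/-- A finite set of objects. -/
def ofFinite (s : Set A) (hs : s.Finite) : MSet M A := ⟨s, by
  obtain ⟨z, hz⟩ := exists_finite (M := M) (hs.image code)
  exact ⟨z, fun x => by rw [hz x]; rfl⟩⟩

@[simp] theorem mem_ofFinite {s : Set A} {hs : s.Finite} {a : A} :
    a ∈ ofFinite (M := M) s hs ↔ a ∈ s := Iff.rfl

end MSet

/-! ### Natural numbers -/

theorem natCode_mem (n : ℕ) : natCode n ∈ M := by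
  induction n with
  | zero => exact empty_mem
  | succ n ih => exact insert_mem ih ih

theorem mem_natCode {n : ℕ} {z : ZFSet.{u}} : z ∈ natCode n ↔ ∃ k < n, z = natCode k := by
  induction n with
  | zero => simp [natCode]
  | succ n ih =>
    rw [natCode, ZFSet.mem_insert_iff, ih]
    constructor
    · rintro (rfl | ⟨k, hk, rfl⟩)
      · exact ⟨n, by omega, rfl⟩
      · exact ⟨k, by omega, rfl⟩
    · rintro ⟨k, hk, rfl⟩
      rcases Nat.lt_succ_iff_lt_or_eq.1 hk with h | rfl
      · exact Or.inr ⟨k, h, rfl⟩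
      · exact Or.inl rfl

theorem natCode_injective : Function.Injective natCode.{u} := by
  intro m n h
  have key : ∀ {m n : ℕ}, natCode.{u} m = natCode n → ¬ m < n := by
    intro m n h hlt
    have : natCode.{u} m ∈ natCode.{u} n := mem_natCode.2 ⟨m, hlt, rfl⟩
    rw [h] at this
    exact ZFSet.mem_irrefl _ this
  exact le_antisymm (not_lt.1 (key h.symm)) (not_lt.1 (key h))

-- Separation yields the least inductive set `W` of `M`. It has no nonstandard element, because an
-- `∈`-minimal one could be removed without destroying inductivity.
variable (M) in
theorem exists_omega : ∃ s : M, ∀ x : M, x.1 ∈ s.1 ↔ ∃ n, natCode n = x.1 := by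
  let IsInd : M → Prop := fun a => (∃ e : M, e.1 ∈ a.1 ∧ ∀ z : M, z.1 ∉ e.1) ∧
    ∀ x : M, x.1 ∈ a.1 → ∃ y : M, y.1 ∈ a.1 ∧ ∀ z : M, z.1 ∈ y.1 ↔ z.1 ∈ x.1 ∨ z = x
  have emp : ∀ e : M, (∀ z : M, z.1 ∉ e.1) → e.1 = ∅ := by
    intro e he
    rw [ZFSet.eq_empty]
    exact fun y hy => he ⟨y, mem_of_mem e.2 hy⟩ hy
  have ins : ∀ x y : M, (∀ z : M, z.1 ∈ y.1 ↔ z.1 ∈ x.1 ∨ z = x) → y.1 = insert x.1 x.1 := by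
    intro x y h
    have := eq_of_mem_iff (a := y) (b := ⟨_, insert_mem x.2 x.2⟩) (fun z => by
      rw [h z]; simp [Subtype.ext_iff, or_comm])
    rw [this]
  have hind : ∀ a : M, IsInd a → ∀ n, natCode n ∈ a.1 := by
    rintro a ⟨⟨e, he, he'⟩, hs⟩ n
    induction n with
    | zero => rwa [emp e he'] at he
    | succ n ih =>
      obtain ⟨y, hy, hy'⟩ := hs ⟨_, natCode_mem n⟩ ih
      rwa [ins _ y hy'] at hy
  obtain ⟨a, ha⟩ := hM.1.satisfiesZFC.infinity
  obtain ⟨W, hW⟩ := hM.1.satisfiesZFC.separation {z | ∀ w : M, IsInd w → z.1 ∈ w.1} (by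
    have : DefClass {z : M | ∀ w : M, IsInd w → z.1 ∈ w.1} :=
      DefClass.of (fun v => ∀ w : M, ((∃ e : M, e.1 ∈ w.1 ∧ ∀ z : M, ¬ z.1 ∈ e.1) ∧
    ∀ x : M, x.1 ∈ w.1 → ∃ y : M, y.1 ∈ w.1 ∧ ∀ z : M, z.1 ∈ y.1 ↔ z.1 ∈ x.1 ∨ z = x) →
      (v 0).1 ∈ w.1) inferInstance fun x => Iff.rfl
    exact this.1) a
  have hW' : ∀ z : M, z.1 ∈ W.1 ↔ ∀ w : M, IsInd w → z.1 ∈ w.1 := fun z => by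
    rw [hW z]
    exact ⟨fun h => h.2, fun h => ⟨h a ha, h⟩⟩
  refine ⟨W, fun x => ⟨?_, ?_⟩⟩
  swap
  · rintro ⟨n, hn⟩
    rw [hW']
    intro w hw
    rw [← hn]
    exact hind w hw n
  obtain ⟨x, hxM⟩ := x
  induction x using ZFSet.inductionOn with
  | h z ih =>
    intro hz
    by_contra hne
    -- `V` is `W` without `z`. It stays inductive: were `z` the successor of some `y ∈ W`, then `y ∈
    -- z` would be a true natural number by the induction hypothesis, and so would `z`.
    obtain ⟨V, hV⟩ := hM.1.satisfiesZFC.separation {y | ¬ y = ⟨z, hxM⟩} (by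
      have : DefClass {y : M | ¬ y = ⟨z, hxM⟩} :=
        DefClass.of (fun v => ¬ v 0 = ⟨z, hxM⟩) inferInstance fun x => Iff.rfl
      exact this.1) W
    have hVind : IsInd V := by
      refine ⟨⟨⟨∅, empty_mem⟩, ?_, fun z => ZFSet.notMem_empty _⟩, ?_⟩
      · refine (hV _).2 ⟨(hW' _).2 fun w hw => hind w hw 0, fun h => hne ⟨0, ?_⟩⟩
        exact congrArg Subtype.val h
      · intro y hy
        obtain ⟨hyW, hyz⟩ := (hV y).1 hy
        refine ⟨⟨_, insert_mem y.2 y.2⟩, (hV _).2 ⟨?_, ?_⟩, fun z => by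
          simp [Subtype.ext_iff, or_comm]⟩
        · refine (hW' _).2 fun w hw => ?_
          obtain ⟨t, ht, ht'⟩ := hw.2 y ((hW' y).1 hyW w hw)
          rwa [ins y t ht'] at ht
        · intro h
          have h' : insert y.1 y.1 = z := congrArg Subtype.val h
          obtain ⟨n, hn⟩ := ih y.1 (by rw [← h']; simp) y.2 hyW
          refine hne ⟨n + 1, ?_⟩
          rw [natCode, hn]
          exact h'
    exact ((hV _).1 ((hW' _).1 hz V hVind)).2 rfl

instance Coded.nat : Coded M ℕ where
  code n := ⟨natCode n, natCode_mem n⟩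
  injective := fun m n h => natCode_injective (congrArg Subtype.val h)
  range_definable := by
    obtain ⟨s, hs⟩ := exists_omega M
    exact DefClass.of (fun v => (v 0).1 ∈ s.1) inferInstance fun x => by
      rw [hs x]
      exact exists_congr fun n => Subtype.ext_iff

instance SetCoded.nat : SetCoded M ℕ where
  exists_range := by
    obtain ⟨s, hs⟩ := exists_omega M
    refine ⟨s, fun x => (hs x).trans (exists_congr fun n => ?_)⟩
    exact (Subtype.ext_iff (a1 := ⟨natCode n, natCode_mem n⟩)).symm

instance DefPred.nat_lt [Coded M A] {f g : A → ℕ} [DefFun M f] [DefFun M g] :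
    DefPred M fun a => f a < g a :=
  DefPred.congr (φ := fun a => (code (f a) : M).1 ∈ (code (g a) : M).1) inferInstance
    fun a => by
      change _ ↔ natCode _ ∈ natCode _
      rw [mem_natCode]
      exact ⟨fun h => ⟨_, h, rfl⟩, fun ⟨k, h, e⟩ => natCode_injective e ▸ h⟩

instance DefFun.succ [Coded M A] {f : A → ℕ} [DefFun M f] : DefFun M fun a => f a + 1 := by
  refine .of_pred (DefPred.congr
    (φ := fun p : A × ℕ => f p.1 < p.2 ∧ ¬ ∃ k : ℕ, f p.1 < k ∧ k < p.2) inferInstance fun p => ?_)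
  constructor
  · intro h
    exact ⟨by omega, by rintro ⟨k, hk⟩; omega⟩
  · rintro ⟨h1, h2⟩
    by_contra h
    exact h2 ⟨f p.1 + 1, by omega, by omega⟩

/-! ### Finite sets -/

/-- Finiteness is absolute: an enumeration by a natural number is a finite set of pairs, hence
belongs to `M`. The relation `f` need only be single-valued in its index. -/
instance MSet.defPred_finite [Coded M A] : DefPred M fun s : MSet M A => (s : Set A).Finite := by
  refine DefPred.congr (φ := fun s : MSet M A => ∃ (n : ℕ) (f : M),
    (∀ a : A, a ∈ s → ∃ k : ℕ, k < n ∧ (code (k, a) : M).1 ∈ (code f : M).1) ∧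
    ∀ (k : ℕ) (a a' : A), (code (k, a) : M).1 ∈ (code f : M).1 →
      (code (k, a') : M).1 ∈ (code f : M).1 → a = a') inferInstance fun s => ?_
  constructor
  · intro hs
    have : Finite (s : Set A) := hs
    obtain ⟨n, ⟨e⟩⟩ := Finite.exists_equiv_fin (s : Set A)
    obtain ⟨f, hf⟩ := exists_finite (M := M)
      (Set.finite_range fun a : (s : Set A) => (code ((e a : ℕ), a.1) : M))
    refine ⟨n, f, fun a ha => ⟨e ⟨a, ha⟩, (e _).2, (hf _).2 ⟨⟨a, ha⟩, rfl⟩⟩, ?_⟩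
    intro k a a' h h'
    obtain ⟨b, hb⟩ := (hf _).1 h
    obtain ⟨b', hb'⟩ := (hf _).1 h'
    simp only [code_inj, Prod.mk.injEq] at hb hb'
    rw [← hb.2, ← hb'.2, e.injective (Fin.ext (hb.1.trans hb'.1.symm))]
  · rintro ⟨n, f, h, h'⟩
    choose! k hk hk' using h
    refine Set.Finite.of_finite_image (f := k) ((Set.finite_lt_nat n).subset ?_) ?_
    · rintro _ ⟨a, ha, rfl⟩
      exact hk a ha
    · intro a ha a' ha' e
      exact h' (k a) a a' (hk' a ha) (e ▸ hk' a' ha')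

/-- A finite set, as a set of the model. -/
def finToMSet [Coded M A] (s : Finset A) : MSet M A := .ofFinite (s : Set A) s.finite_toSet

instance Coded.finset [Coded M A] : Coded M (Finset A) where
  code s := code (finToMSet s : MSet M A)
  injective := by
    intro s t h
    rw [code_inj] at h
    ext a
    have : a ∈ (finToMSet s : MSet M A) ↔ a ∈ (finToMSet t : MSet M A) := by rw [h]
    simpa [finToMSet] using this
  range_definable := by
    have := (MSet.defPred_finite (M := M) (A := A)).1
    convert! this using 1
    ext x
    constructor
    · rintro ⟨s, rfl⟩
      exact ⟨_, s.finite_toSet, rfl⟩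
    · rintro ⟨s, hs, rfl⟩
      refine ⟨hs.toFinset, ?_⟩
      change (code (finToMSet hs.toFinset : MSet M A) : M) = code s
      exact congrArg code (MSet.ext fun a => by simp [finToMSet])

instance SetCoded.finset [Coded M A] [SetCoded M A] : SetCoded M (Finset A) where
  exists_range := by
    obtain ⟨s, hs⟩ := exists_codes (M := M) fun s : MSet M A => (s : Set A).Finite
    refine ⟨s, fun x => ?_⟩
    rw [hs x]
    constructor
    · rintro ⟨s, hs, rfl⟩
      refine ⟨hs.toFinset, ?_⟩
      change (code (finToMSet hs.toFinset : MSet M A) : M) = code s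
      exact congrArg code (MSet.ext fun a => by simp [finToMSet])
    · rintro ⟨s, rfl⟩
      exact ⟨finToMSet s, s.finite_toSet, rfl⟩

instance DefPred.finset_mem [Coded M A] [Coded M B] {f : A → B} {g : A → Finset B} [DefFun M f]
    [DefFun M g] : DefPred M fun a => f a ∈ g a :=
  DefPred.congr (φ := fun a => (code (f a) : M).1 ∈ (code (g a) : M).1) inferInstance
    fun a => (MSet.code_mem_toM (s := (finToMSet (g a) : MSet M B))).symm

/-! ### Iteration -/

/-- A definable function. -/
structure MFun (M : Set ZFSet.{u}) [Fact (IsTransitiveModel M)] (A : Type w) (B : Type w₁)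
    [Coded M A] [Coded M B] where
  toFun : A → B
  defFun : DefFun M toFun

instance MFun.app [Coded M A] [Coded M B] [Coded M C] (F : MFun M B C) {f : A → B} [DefFun M f] :
    DefFun M fun a => F.toFun (f a) :=
  have := F.defFun
  DefFun.comp

/-- The value is certified by a set `s` of pairs, each of which is either the initial one or
obtained from an earlier pair by one step. Every pair in such a set is correct by induction, and the
true computation is finite, hence available in `M`. -/
instance DefFun.iterate [Coded M A] [Coded M B] (F : MFun M B B) {f : A → ℕ} {g : A → B}
    [DefFun M f] [DefFun M g] : DefFun M fun a => F.toFun^[f a] (g a) := by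
  refine .of_pred (DefPred.congr (φ := fun p : A × B => ∃ s : M,
    (code (f p.1, p.2) : M).1 ∈ (code s : M).1 ∧ ∀ (k : ℕ) (b : B),
      (code (k, b) : M).1 ∈ (code s : M).1 → (k = 0 ∧ b = g p.1) ∨ ∃ (j : ℕ) (c : B),
        (code (j, c) : M).1 ∈ (code s : M).1 ∧ k = j + 1 ∧ b = F.toFun c) inferInstance fun p => ?_)
  constructor
  · intro h
    obtain ⟨s, hs⟩ := exists_finite (M := M)
      ((Set.finite_le_nat (f p.1)).image fun k => (code (k, F.toFun^[k] (g p.1)) : M))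
    refine ⟨s, (hs _).2 ⟨f p.1, le_refl (f p.1), by simp only [h]⟩, fun k b hb => ?_⟩
    obtain ⟨j, hj, e⟩ := (hs _).1 hb
    simp only [code_inj, Prod.mk.injEq] at e
    obtain ⟨rfl, rfl⟩ := e
    cases j with
    | zero => exact Or.inl ⟨rfl, rfl⟩
    | succ j =>
      refine Or.inr ⟨j, F.toFun^[j] (g p.1), (hs _).2 ⟨j, ?_, rfl⟩, rfl, ?_⟩
      · have : j + 1 ≤ f p.1 := hj
        exact Nat.le_of_succ_le this
      · exact Function.iterate_succ_apply' _ _ _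
  · rintro ⟨s, h1, h2⟩
    have : ∀ k b, (code (k, b) : M).1 ∈ (code s : M).1 → F.toFun^[k] (g p.1) = b := by
      intro k
      induction k with
      | zero =>
        intro b hb
        rcases h2 _ _ hb with ⟨-, rfl⟩ | ⟨j, c, -, e, -⟩
        · rfl
        · omega
      | succ k ih =>
        intro b hb
        rcases h2 _ _ hb with ⟨e, -⟩ | ⟨j, c, h, e, rfl⟩
        · omega
        · obtain rfl : k = j := by omega
          rw [Function.iterate_succ_apply', ih c h]
    exact this _ _ h1

end

section

variable {M : Set ZFSet.{u}} [hM : Fact (IsTransitiveModel M)]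
  {A : Type w} {B : Type w₁} [Coded M A] [Coded M B]

/-! ### Arithmetic of the model -/

instance DefFun.nat_add {f g : A → ℕ} [DefFun M f] [DefFun M g] : DefFun M fun a => f a + g a := by
  let F : MFun M ℕ ℕ := ⟨fun n => n + 1, inferInstance⟩
  have h : DefFun M fun a => F.toFun^[g a] (f a) := inferInstance
  convert! h using 2 with a
  exact (Nat.succ_iterate _ _).symm

instance DefFun.nat_mul {f g : A → ℕ} [DefFun M f] [DefFun M g] : DefFun M fun a => f a * g a := by
  let F : MFun M (ℕ × ℕ) (ℕ × ℕ) := ⟨fun p => (p.1, p.2 + p.1), inferInstance⟩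
  have h : DefFun M fun a => (F.toFun^[g a] (f a, 0)).2 := inferInstance
  have key : ∀ m n, F.toFun^[n] (m, 0) = (m, m * n) := by
    intro m n
    induction n with
    | zero => rfl
    | succ n ih => rw [Function.iterate_succ_apply', ih]; rfl
  convert! h using 2 with a
  rw [key]

/-- The three natural numbers which code a rational number. -/
def ratTriple (q : ℚ) : (ℕ × ℕ) × ℕ := ((q.num.toNat, (-q.num).toNat), q.den)

theorem ratTriple_injective : Function.Injective ratTriple := by
  intro p q h
  simp only [ratTriple, Prod.mk.injEq] at h
  exact Rat.ext (by omega) h.2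

-- Lowest terms are expressed by multiplication alone so that the condition is visibly definable
-- over `ℕ`; one of the two numerator parts vanishes, so their sum is the absolute value of the
-- numerator.
theorem exists_ratTriple {t : (ℕ × ℕ) × ℕ} : (∃ q, ratTriple q = t) ↔
    (0 < t.2 ∧ (t.1.1 = 0 ∨ t.1.2 = 0)) ∧
      ∀ k x y : ℕ, k * x = t.1.1 + t.1.2 → k * y = t.2 → k = 1 := by
  constructor
  · rintro ⟨q, rfl⟩
    refine ⟨⟨q.den_pos, ?_⟩, ?_⟩
    · simp only [ratTriple]
      omega
    · intro k x y hx hy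
      have h : k ∣ q.num.natAbs := ⟨x, by simp only [ratTriple] at hx; omega⟩
      have h' : k ∣ q.den := ⟨y, by simp only [ratTriple] at hy; omega⟩
      exact Nat.eq_one_of_dvd_coprimes q.reduced h h'
  · obtain ⟨⟨a, b⟩, d⟩ := t
    rintro ⟨⟨hd, hab⟩, hk⟩
    simp only at hd hab hk
    refine ⟨⟨(a : ℤ) - b, d, by omega, ?_⟩, ?_⟩
    · have : ((a : ℤ) - b).natAbs = a + b := by omega
      rw [this]
      obtain ⟨x, hx⟩ := Nat.gcd_dvd_left (a + b) d
      obtain ⟨y, hy⟩ := Nat.gcd_dvd_right (a + b) d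
      exact hk _ x y hx.symm hy.symm
    · simp only [ratTriple, Prod.mk.injEq]
      exact ⟨⟨by omega, by omega⟩, trivial⟩

/-- A type is coded when it embeds definably in a coded type. -/
@[reducible] def Coded.ofInjective {A : Type w} (f : A → B) (hf : Function.Injective f)
    (h : DefPred M fun b => ∃ a, f a = b) : Coded M A where
  code a := code (f a)
  injective := Coded.injective.comp hf
  range_definable := by
    convert! h.1 using 1
    ext x
    constructor
    · rintro ⟨a, rfl⟩
      exact ⟨f a, ⟨a, rfl⟩, rfl⟩
    · rintro ⟨_, ⟨a, rfl⟩, rfl⟩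
      exact ⟨a, rfl⟩

instance Coded.rat : Coded M ℚ := .ofInjective ratTriple ratTriple_injective
  (DefPred.congr inferInstance fun _ => exists_ratTriple)

instance SetCoded.rat : SetCoded M ℚ where
  exists_range := by
    have : DefPred M fun t => ∃ q, ratTriple q = t :=
      DefPred.congr inferInstance fun _ => exists_ratTriple
    obtain ⟨s, hs⟩ := exists_codes (M := M) fun t => ∃ q, ratTriple q = t
    refine ⟨s, fun x => ?_⟩
    rw [hs x]
    constructor
    · rintro ⟨_, ⟨a, rfl⟩, rfl⟩
      exact ⟨a, rfl⟩
    · rintro ⟨a, rfl⟩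
      exact ⟨_, ⟨a, rfl⟩, rfl⟩

instance DefFun.ratTriple_apply {f : A → ℚ} [DefFun M f] : DefFun M fun a => ratTriple (f a) :=
  have : DefFun M ratTriple := .of_code fun _ => rfl
  DefFun.comp

theorem num_eq_ratTriple (q : ℚ) : q.num = (ratTriple q).1.1 - (ratTriple q).1.2 := by
  simp only [ratTriple]
  omega

instance DefPred.rat_lt {f g : A → ℚ} [DefFun M f] [DefFun M g] :
    DefPred M fun a => f a < g a := by
  refine DefPred.congr (φ := fun a =>
    (ratTriple (f a)).1.1 * (ratTriple (g a)).2 + (ratTriple (g a)).1.2 * (ratTriple (f a)).2 <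
    (ratTriple (g a)).1.1 * (ratTriple (f a)).2 + (ratTriple (f a)).1.2 * (ratTriple (g a)).2)
    inferInstance fun a => ?_
  rw [Rat.lt_iff, num_eq_ratTriple, num_eq_ratTriple]
  change _ * ((ratTriple (g a)).2 : ℤ) < _ * ((ratTriple (f a)).2 : ℤ) ↔ _
  zify
  constructor <;> intro h <;> linarith

instance DefPred.rat_le {f g : A → ℚ} [DefFun M f] [DefFun M g] :
    DefPred M fun a => f a ≤ g a :=
  DefPred.congr (φ := fun a => ¬ g a < f a) inferInstance fun _ => not_lt.symm

instance DefFun.rat_add {f g : A → ℚ} [DefFun M f] [DefFun M g] :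
    DefFun M fun a => f a + g a := by
  have h : DefFun M fun p : ℚ × ℚ => p.1 + p.2 := by
    -- Denominators are cleared and negative parts are moved across, which leaves an equation
    -- between natural numbers.
    refine .of_pred (DefPred.congr (φ := fun p : (ℚ × ℚ) × ℚ =>
      (ratTriple p.1.1).1.1 * (ratTriple p.1.2).2 * (ratTriple p.2).2 +
        (ratTriple p.1.2).1.1 * (ratTriple p.1.1).2 * (ratTriple p.2).2 +
        (ratTriple p.2).1.2 * (ratTriple p.1.1).2 * (ratTriple p.1.2).2 =
      (ratTriple p.1.1).1.2 * (ratTriple p.1.2).2 * (ratTriple p.2).2 +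
        (ratTriple p.1.2).1.2 * (ratTriple p.1.1).2 * (ratTriple p.2).2 +
        (ratTriple p.2).1.1 * (ratTriple p.1.1).2 * (ratTriple p.1.2).2) inferInstance ?_)
    rintro ⟨⟨x, y⟩, z⟩
    simp only
    have e : ∀ q : ℚ, q = ((ratTriple q).1.1 - (ratTriple q).1.2 : ℚ) / (ratTriple q).2 := by
      intro q
      conv_lhs => rw [← Rat.num_div_den q, num_eq_ratTriple]
      push_cast
      rfl
    have hd : ∀ q : ℚ, ((ratTriple q).2 : ℚ) ≠ 0 := fun q => by exact_mod_cast q.den_nz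
    have hx := hd x
    have hy := hd y
    have hz := hd z
    conv_lhs => rw [e x, e y, e z]
    rw [div_add_div _ _ hx hy, div_eq_div_iff (mul_ne_zero hx hy) hz, ← Nat.cast_inj (R := ℚ)]
    push_cast
    constructor <;> intro h <;> linarith
  exact DefFun.comp (g := fun p : ℚ × ℚ => p.1 + p.2) (f := fun a => (f a, g a))

instance DefFun.rat_neg {f : A → ℚ} [DefFun M f] : DefFun M fun a => - f a := by
  refine .of_pred (DefPred.congr (φ := fun p : A × ℚ => f p.1 + p.2 = 0) inferInstance fun p => ?_)
  rw [add_eq_zero_iff_neg_eq]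

instance DefFun.rat_sub {f g : A → ℚ} [DefFun M f] [DefFun M g] :
    DefFun M fun a => f a - g a := by
  simp only [sub_eq_add_neg]
  infer_instance

/-! ### Real numbers of the model -/

theorem mem_realCode {r : ℝ} {z : ZFSet.{u}} : z ∈ realCode r ↔ ∃ q : ℚ, (q : ℝ) < r ∧ ratCode q = z := by
  simp [realCode, ZFSet.mem_range]

theorem ratCode_injective : Function.Injective ratCode.{u} := by
  intro p q h
  simp only [ratCode, ZFSet.pair_inj] at h
  apply ratTriple_injective
  simp only [ratTriple, natCode_injective h.1.1, natCode_injective h.1.2, natCode_injective h.2]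

theorem ratCode_mem_realCode {q : ℚ} {r : ℝ} : ratCode.{u} q ∈ realCode r ↔ (q : ℝ) < r := by
  rw [mem_realCode]
  constructor
  · rintro ⟨p, hp, e⟩
    rwa [← ratCode_injective e]
  · exact fun h => ⟨q, h, rfl⟩

theorem realCode_injective : Function.Injective realCode.{u} := by
  intro r s h
  have key : ∀ q : ℚ, (q : ℝ) < r ↔ (q : ℝ) < s := fun q => by
    rw [← ratCode_mem_realCode, h, ratCode_mem_realCode]
  refine le_antisymm ?_ ?_
  · exact le_of_forall_rat_lt_imp_le fun q hq => ((key q).1 hq).le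
  · exact le_of_forall_rat_lt_imp_le fun q hq => ((key q).2 hq).le

theorem MSet.toM_eq_realCode {c : MSet M ℚ} {r : ℝ} (h : ∀ q : ℚ, q ∈ c ↔ (q : ℝ) < r) :
    c.toM.1 = realCode r := by
  ext z
  rw [mem_realCode]
  constructor
  · intro hz
    obtain ⟨q, hq, e⟩ := MSet.mem_toM (x := ⟨z, mem_of_mem c.toM.2 hz⟩).1 hz
    exact ⟨q, (h q).1 hq, congrArg (fun z : M => z.1) e⟩
  · rintro ⟨q, hq, rfl⟩
    exact MSet.code_mem_toM.2 ((h q).2 hq)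

/-- A real number with a definable cut belongs to the model. -/
theorem realCode_mem (r : ℝ) [DefPred M fun q : ℚ => (q : ℝ) < r] : realCode r ∈ M := by
  rw [← MSet.toM_eq_realCode (c := (MSet.sep fun q : ℚ => (q : ℝ) < r : MSet M ℚ)) fun q => MSet.mem_sep]
  exact (MSet.toM _).2

variable (M) in
theorem ratCast_mem_realsIn (q : ℚ) : (q : ℝ) ∈ realsIn M :=
  have : DefPred M fun p : ℚ => (p : ℝ) < q :=
    DefPred.congr (φ := fun p : ℚ => p < q) inferInstance fun _ => Rat.cast_lt
  realCode_mem (M := M) (q : ℝ)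

omit hM in
theorem mem_realSet {z : ZFSet.{u}} : z ∈ realSet M ↔ ∃ r, realCode r ∈ M ∧ realCode r = z := by
  rw [realSet, ZFSet.mem_range]
  exact ⟨fun ⟨r, h⟩ => ⟨r.1, r.2, h⟩, fun ⟨r, hr, h⟩ => ⟨⟨r, hr⟩, h⟩⟩

theorem exists_real_cut (c : Set ℚ) (h₁ : ∃ q, q ∈ c) (h₂ : ∃ q, q ∉ c)
    (h₃ : ∀ q, q ∈ c → ∀ p, p < q → p ∈ c) (h₄ : ∀ q, q ∈ c → ∃ p, p ∈ c ∧ q < p) :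
    ∃ r : ℝ, ∀ q : ℚ, q ∈ c ↔ (q : ℝ) < r := by
  obtain ⟨q₀, hq₀⟩ := h₁
  obtain ⟨q₁, hq₁⟩ := h₂
  have hb : ∀ q ∈ c, (q : ℝ) ≤ q₁ := by
    intro q hq
    by_contra h
    exact hq₁ (h₃ q hq q₁ (by exact_mod_cast not_le.1 h))
  have hbdd : BddAbove ((fun q : ℚ => (q : ℝ)) '' {q | q ∈ c}) :=
    ⟨q₁, by rintro _ ⟨q, hq, rfl⟩; exact hb q hq⟩
  refine ⟨sSup ((fun q : ℚ => (q : ℝ)) '' {q | q ∈ c}), fun q => ⟨fun hq => ?_, fun hq => ?_⟩⟩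
  · obtain ⟨p, hp, hqp⟩ := h₄ q hq
    exact lt_of_lt_of_le (Rat.cast_lt.2 hqp) (le_csSup hbdd ⟨p, hp, rfl⟩)
  · obtain ⟨_, ⟨p, hp, rfl⟩, hqp⟩ := exists_lt_of_lt_csSup (Set.Nonempty.image _ ⟨q₀, hq₀⟩) hq
    exact h₃ p hp q (Rat.cast_lt.1 hqp)

-- The reals of `M` are precisely the left Dedekind cuts which belong to `M`, and being a cut is a
-- definable condition on subsets of `ℚ`.
variable (M) in
theorem realSet_mem : realSet M ∈ M := by
  obtain ⟨s, hs⟩ := exists_codes (M := M) fun c : MSet M ℚ => ((∃ q, q ∈ c) ∧ (∃ q, ¬ q ∈ c)) ∧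
    (∀ q, q ∈ c → ∀ p, p < q → p ∈ c) ∧ (∀ q, q ∈ c → ∃ p, p ∈ c ∧ q < p)
  convert! s.2
  ext z
  rw [mem_realSet]
  constructor
  · rintro ⟨r, hr, rfl⟩
    have : DefPred M fun q : ℚ => (q : ℝ) < r :=
      DefPred.congr (φ := fun q : ℚ => (code q : M).1 ∈ (code (⟨_, hr⟩ : M) : M).1) inferInstance
        fun q => (ratCode_mem_realCode).symm
    refine (hs ⟨_, hr⟩).2 ⟨MSet.sep fun q : ℚ => (q : ℝ) < r, ?_, ?_⟩
    · simp only [MSet.mem_sep]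
      refine ⟨⟨exists_rat_lt r, ?_⟩, ?_, ?_⟩
      · obtain ⟨q, hq⟩ := exists_rat_gt r
        exact ⟨q, not_lt.2 hq.le⟩
      · intro q hq p hp
        exact lt_trans (by exact_mod_cast hp) hq
      · intro q hq
        obtain ⟨p, h1, h2⟩ := exists_rat_btwn hq
        exact ⟨p, h2, by exact_mod_cast h1⟩
    · exact Subtype.ext (MSet.toM_eq_realCode fun q => MSet.mem_sep)
  · intro hz
    obtain ⟨c, ⟨⟨h1, h2⟩, h3, h4⟩, e⟩ := (hs ⟨z, mem_of_mem s.2 hz⟩).1 hz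
    obtain ⟨r, hr⟩ := exists_real_cut c h1 h2 h3 h4
    have e' : c.toM.1 = z := congrArg (fun z : M => z.1) e
    rw [MSet.toM_eq_realCode hr] at e'
    exact ⟨r, e' ▸ mem_of_mem s.2 hz, e'⟩

instance : Fact (realSet M ∈ M) := ⟨realSet_mem M⟩

instance DefPred.lt_realVal {f : A → ℚ} {g : A → realSet M} [DefFun M f] [DefFun M g] :
    DefPred M fun a => (f a : ℝ) < realVal (g a) :=
  DefPred.congr (φ := fun a => (code (f a) : M).1 ∈ (code (g a) : M).1) inferInstance fun a => by
    change _ ↔ ratCode (f a) ∈ (g a).1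
    rw [← realCode_realVal, ratCode_mem_realCode]

omit hM in
theorem realVal_injective : Function.Injective (realVal (M := M)) := by
  intro a b h
  rw [Subtype.ext_iff, ← realCode_realVal a, ← realCode_realVal b, h]

/-- A real number of the model, as an element of its set of real numbers. -/
def toRealSet (r : ℝ) (hr : realCode r ∈ M) : realSet M := ⟨realCode r, mem_realSet.2 ⟨r, hr, rfl⟩⟩

omit hM in
theorem realVal_toRealSet (r : ℝ) (hr : realCode r ∈ M) : realVal (toRealSet r hr) = r :=
  realCode_injective (realCode_realVal _)

end

section

variable {M : Set ZFSet.{u}} [hM : Fact (IsTransitiveModel M)]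
  {A : Type w} {B : Type w₁} [Coded M A] [Coded M B]

/-! ### Choice in the model -/

/-- The fibres of `R`, kept as sets of pairs, are nonempty and pairwise disjoint. A transversal of
them given by the axiom of choice in `M` is the graph of the choice function. -/
theorem exists_choice [SetCoded M A] [SetCoded M B] (R : MSet M (A × B)) (h : ∀ a, ∃ b, (a, b) ∈ R) :
    ∃ F : MFun M A B, ∀ a, (a, F.toFun a) ∈ R := by
  let fib (a : A) : MSet M (A × B) := MSet.sep fun p => p ∈ R ∧ p.1 = a
  have hfib : DefFun M fib := .of_pred (DefPred.congr
    (φ := fun p : A × MSet M (A × B) => ∀ x, x ∈ p.2 ↔ x ∈ R ∧ x.1 = p.1) inferInstance fun p => by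
      rw [MSet.ext_iff]
      exact forall_congr' fun x => Iff.comm.trans (Iff.of_eq (by simp [fib])))
  obtain ⟨𝒜, h𝒜⟩ := exists_image (M := M) (fun a s => fib a = s)
    (fun _ _ _ h h' => h.symm.trans h')
  obtain ⟨c, hc⟩ := hM.1.satisfiesZFC.choice 𝒜 (by
      intro x hx
      obtain ⟨_, ⟨a, rfl⟩, rfl⟩ := (h𝒜 x).1 hx
      obtain ⟨b, hb⟩ := h a
      exact ⟨code (a, b), MSet.code_mem_toM.2 ⟨hb, rfl⟩⟩) (by
      rintro x y hx hy ⟨z, hzx, hzy⟩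
      obtain ⟨_, ⟨a, rfl⟩, rfl⟩ := (h𝒜 x).1 hx
      obtain ⟨_, ⟨b, rfl⟩, rfl⟩ := (h𝒜 y).1 hy
      obtain ⟨p, hp, rfl⟩ := MSet.mem_toM.1 hzx
      have hp' := MSet.code_mem_toM.1 hzy
      have : a = b := hp.2.symm.trans hp'.2
      rw [this])
  have key : ∀ a, ∃! b, (a, b) ∈ R ∧ (code (a, b) : M).1 ∈ c.1 := by
    intro a
    obtain ⟨z, ⟨hz, hzc⟩, huniq⟩ := hc (code (fib a)) ((h𝒜 _).2 ⟨_, ⟨a, rfl⟩, rfl⟩)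
    obtain ⟨⟨a', b⟩, ⟨hR, rfl⟩, rfl⟩ := MSet.mem_toM.1 hz
    refine ⟨b, ⟨hR, hzc⟩, fun b' hb' => ?_⟩
    have := huniq (code (a', b')) ⟨MSet.code_mem_toM.2 ⟨hb'.1, rfl⟩, hb'.2⟩
    rw [code_inj] at this
    exact congrArg Prod.snd this
  choose f hf hf' using key
  refine ⟨⟨f, .of_pred (DefPred.congr (φ := fun p : A × B => (p.1, p.2) ∈ R ∧
    (code (p.1, p.2) : M).1 ∈ (code c : M).1) inferInstance fun p => ?_)⟩, fun a => (hf a).1⟩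
  exact ⟨fun e => e ▸ hf p.1, fun e => (hf' p.1 p.2 e).symm⟩

/-! ### Absoluteness of well-foundedness -/

/-- `g` is a partial Mostowski collapse of the relation `R`. -/
def IsCollapse (R : MSet M (A × A)) (g : M) : Prop :=
  ∀ (x : A) (v : M), (code (x, v) : M).1 ∈ (code g : M).1 →
    (∀ w : M, (code w : M).1 ∈ (code v : M).1 ↔
      ∃ y : A, (y, x) ∈ R ∧ (code (y, w) : M).1 ∈ (code g : M).1) ∧
    ∀ y : A, (y, x) ∈ R → ∃ w : M, (code (y, w) : M).1 ∈ (code g : M).1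

instance (R : MSet M (A × A)) {f : B → M} [DefFun M f] : DefPred M fun b => IsCollapse R (f b) := by
  unfold IsCollapse
  infer_instance

/-- If every nonempty set of `M` had an `R`-minimal element, recursion in `M` would build the full
Mostowski collapse of `R`. The collapse turns the outer sequence `t` into a descending `∈`-chain,
against foundation. -/
theorem exists_not_collapsed [SetCoded M A] (R : MSet M (A × A)) {t : ℕ → A}
    (ht : ∀ k, (t (k + 1), t k) ∈ R) :
    ∃ D : MSet M A, (∃ x, x ∈ D) ∧ ∀ x ∈ D, ∃ y ∈ D, (y, x) ∈ R := by
  by_contra! hD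
  -- At a minimal point of disagreement both values are the set of the same values of predecessors.
  have hunique : ∀ g g' : M, IsCollapse R g → IsCollapse R g' → ∀ (x : A) (v v' : M),
      (code (x, v) : M).1 ∈ g.1 → (code (x, v') : M).1 ∈ g'.1 → v = v' := by
    intro g g' hg hg'
    by_contra! hne
    obtain ⟨x, v, v', h⟩ := hne
    obtain ⟨x, hx, hmin⟩ := hD (MSet.sep fun x => ∃ v v' : M, (code (x, v) : M).1 ∈ (code g : M).1 ∧
      (code (x, v') : M).1 ∈ (code g' : M).1 ∧ ¬ v = v') ⟨x, v, v', h⟩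
    obtain ⟨v, v', hv, hv', hne⟩ := hx
    have hmin' : ∀ y, (y, x) ∈ R → ∀ w w' : M, (code (y, w) : M).1 ∈ g.1 →
        (code (y, w') : M).1 ∈ g'.1 → w = w' := fun y hy w w' hw hw' => by
      by_contra hww
      exact hmin y ⟨w, w', hw, hw', hww⟩ hy
    obtain ⟨h1, h2⟩ := hg x v hv
    obtain ⟨h1', h2'⟩ := hg' x v' hv'
    refine hne (eq_of_mem_iff fun w => (h1 w).trans (Iff.trans ?_ (h1' w).symm))
    constructor
    · rintro ⟨y, hy, hw⟩
      obtain ⟨w', hw'⟩ := h2' y hy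
      exact ⟨y, hy, hmin' y hy w w' hw hw' ▸ hw'⟩
    · rintro ⟨y, hy, hw⟩
      obtain ⟨w', hw'⟩ := h2 y hy
      exact ⟨y, hy, hmin' y hy w' w hw' hw ▸ hw'⟩
  let Val (x : A) (v : M) : Prop := ∃ g : M, IsCollapse R g ∧ (code (x, v) : M).1 ∈ (code g : M).1
  have hVal : DefPred M fun p : A × M => Val p.1 p.2 := by
    change DefPred M fun p : A × M =>
      ∃ g : M, IsCollapse R g ∧ (code (p.1, p.2) : M).1 ∈ (code g : M).1
    infer_instance
  have Val_unique : ∀ x v v', Val x v → Val x v' → v = v' := by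
    rintro x v v' ⟨g, hg, h⟩ ⟨g', hg', h'⟩
    exact hunique g g' hg hg' x v v' h h'
  have Val_iff : ∀ x v, Val x v → ∀ w : M, w.1 ∈ v.1 ↔ ∃ y : A, (y, x) ∈ R ∧ Val y w := by
    rintro x v ⟨g, hg, h⟩ w
    refine ((hg x v h).1 w).trans ⟨?_, ?_⟩
    · rintro ⟨y, hy, hw⟩
      exact ⟨y, hy, g, hg, hw⟩
    · rintro ⟨y, hy, hw⟩
      obtain ⟨w', hw'⟩ := (hg x v h).2 y hy
      have := Val_unique y w w' hw ⟨g, hg, hw'⟩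
      exact ⟨y, hy, this ▸ hw'⟩
  have Val_exists : ∀ x v, Val x v → ∀ y : A, (y, x) ∈ R → ∃ w, Val y w := by
    rintro x v ⟨g, hg, h⟩ y hy
    obtain ⟨w', hw'⟩ := (hg x v h).2 y hy
    exact ⟨w', g, hg, hw'⟩
  have total : ∀ x, ∃ v, Val x v := by
    by_contra! hne
    obtain ⟨x, hx⟩ := hne
    have hE : DefPred M fun x : A => ∃ v : M, Val x v := by infer_instance
    obtain ⟨x, hx, hmin⟩ := hD (MSet.sep fun x => ¬ ∃ v : M, Val x v) ⟨x, by simpa using hx⟩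
    have hmin' : ∀ y, (y, x) ∈ R → ∃ v, Val y v := fun y hy => by
      by_contra h
      exact hmin y h hy
    obtain ⟨v, hv⟩ := exists_image (M := M) (A := A) (C := M) (fun y w => (y, x) ∈ R ∧ Val y w)
      fun y w w' h h' => Val_unique y w w' h.2 h'.2
    -- The class of values already defined, extended by the value `v` at the minimal point `x`
    -- without one. The relation is functional because `x` had no value before.
    obtain ⟨g, hg⟩ := exists_image (M := M) (A := A) (C := A × M)
      (fun y p => y = p.1 ∧ ((y = x ∧ p.2 = v) ∨ Val y p.2)) (by
        rintro y ⟨_, w⟩ ⟨_, w'⟩ ⟨rfl, h | h⟩ ⟨rfl, h' | h'⟩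
        · exact Prod.ext rfl (h.2.trans h'.2.symm)
        · exact (hx ⟨_, h.1 ▸ h'⟩).elim
        · exact (hx ⟨_, h'.1 ▸ h⟩).elim
        · exact Prod.ext rfl (Val_unique _ _ _ h h'))
    have hg' : ∀ (y : A) (w : M), (code (y, w) : M).1 ∈ g.1 ↔ (y = x ∧ w = v) ∨ Val y w := by
      intro y w
      rw [hg, code_mem_codes]
      simp
    have hv' : ∀ w : M, w.1 ∈ v.1 ↔ ∃ y, (y, x) ∈ R ∧ Val y w := by
      intro w
      rw [hv w]
      exact code_mem_codes (a := w)
    refine hx ⟨v, g, ?_, (hg' x v).2 (Or.inl ⟨rfl, rfl⟩)⟩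
    intro y w hyw
    rcases (hg' y w).1 hyw with ⟨rfl, rfl⟩ | hyw
    · refine ⟨fun w' => (hv' w').trans (exists_congr fun z => and_congr_right fun hz => ?_),
        fun z hz => ?_⟩
      · refine Iff.trans ?_ (hg' z w').symm
        refine ⟨Or.inr, ?_⟩
        rintro (⟨rfl, -⟩ | h)
        · exact (hx (hmin' z hz)).elim
        · exact h
      · obtain ⟨w', hw'⟩ := hmin' z hz
        exact ⟨w', (hg' z w').2 (Or.inr hw')⟩
    · refine ⟨fun w' => (Val_iff y w hyw w').trans (exists_congr fun z => and_congr_right fun hz => ?_),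
        fun z hz => ?_⟩
      · refine Iff.trans ?_ (hg' z w').symm
        refine ⟨Or.inr, ?_⟩
        rintro (⟨rfl, -⟩ | h)
        · exact (hx (Val_exists y w hyw z hz)).elim
        · exact h
      · obtain ⟨w', hw'⟩ := Val_exists y w hyw z hz
        exact ⟨w', (hg' z w').2 (Or.inr hw')⟩
  choose F hF using total
  have hdesc : ∀ k, (F (t (k + 1))).1 ∈ (F (t k)).1 := fun k =>
    (Val_iff _ _ (hF (t k)) _).2 ⟨_, ht k, hF _⟩
  obtain ⟨m, ⟨k, rfl⟩, hm⟩ := ZFSet.mem_wf.has_min (Set.range fun k => (F (t k)).1) ⟨_, 0, rfl⟩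
  exact hm _ ⟨k + 1, rfl⟩ (hdesc k)

/-- A relation of the model which has an infinite descending sequence has one in the model. -/
theorem exists_descending [SetCoded M A] (R : MSet M (A × A)) {t : ℕ → A}
    (ht : ∀ k, (t (k + 1), t k) ∈ R) :
    ∃ s : ℕ → A, DefFun M s ∧ ∀ k, (s (k + 1), s k) ∈ R := by
  obtain ⟨D, ⟨x₀, hx₀⟩, hD⟩ := exists_not_collapsed R ht
  -- Dependent choice in `M`: a choice function picks a predecessor within `D`, and it is iterated
  -- from a point of `D`. Outside `D` the value is irrelevant.
  obtain ⟨F, hF⟩ := exists_choice (M := M) (MSet.sep fun p : A × A => p.1 ∈ D → (p.2 ∈ D ∧ (p.2, p.1) ∈ R))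
    (fun x => by
      by_cases hx : x ∈ D
      · obtain ⟨y, hy, hyx⟩ := hD x hx
        exact ⟨y, fun _ => ⟨hy, hyx⟩⟩
      · exact ⟨x, fun h => (hx h).elim⟩)
  have hmem : ∀ k, F.toFun^[k] x₀ ∈ D := by
    intro k
    induction k with
    | zero => exact hx₀
    | succ k ih =>
      rw [Function.iterate_succ_apply']
      exact (hF _ ih).1
  refine ⟨fun k => F.toFun^[k] x₀, inferInstance, fun k => ?_⟩
  simp only [Function.iterate_succ_apply']
  exact (hF _ (hmem k)).2

end

section

variable {M : Set ZFSet.{u}} [hM : Fact (IsTransitiveModel M)]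
  {A : Type w} {B : Type w₁} [Coded M A] [Coded M B]

/-! ### Maximal consistent sets in the model -/

instance : PartialOrder (MSet M A) := .ofSetLike _ _

omit hM in
theorem MSet.le_iff {s t : MSet M A} : s ≤ t ↔ ∀ a, a ∈ s → a ∈ t := Iff.rfl

instance DefPred.mset_le {f g : B → MSet M A} [DefFun M f] [DefFun M g] :
    DefPred M fun b => f b ≤ g b :=
  DefPred.congr (φ := fun b => ∀ a, a ∈ f b → a ∈ g b) inferInstance fun _ => MSet.le_iff

instance DefPred.mset_le_left (s : MSet M A) : DefPred M (LE.le s) :=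
  mset_le (f := fun _ => s) (g := fun t => t)

/-- The family `C` is a chain with union `u`. -/
def IsChainUnion (C : MSet M (MSet M A)) (u : MSet M A) : Prop :=
  (∀ s t, s ∈ C → t ∈ C → s ≤ t ∨ t ≤ s) ∧ ∀ a, a ∈ u ↔ ∃ s, s ∈ C ∧ a ∈ s

instance {f : B → MSet M (MSet M A)} {g : B → MSet M A} [DefFun M f] [DefFun M g] :
    DefPred M fun b => IsChainUnion (f b) (g b) := by
  unfold IsChainUnion
  infer_instance

theorem IsChainUnion.le {C : MSet M (MSet M A)} {u s : MSet M A} (h : IsChainUnion C u)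
    (hs : s ∈ C) : s ≤ u := fun a ha => (h.2 a).2 ⟨s, hs, ha⟩

theorem IsChainUnion.le_of {C : MSet M (MSet M A)} {u t : MSet M A} (h : IsChainUnion C u)
    (ht : ∀ s ∈ C, s ≤ t) : u ≤ t := fun a ha => by
  obtain ⟨s, hs, has⟩ := (h.2 a).1 ha
  exact ht s hs has

/-- The family `T` is closed under `N` and under unions of chains. -/
def IsTower (N : MFun M (MSet M A) (MSet M A)) (T : MSet M (MSet M A)) : Prop :=
  (∀ s, s ∈ T → N.toFun s ∈ T) ∧
    ∀ (C : MSet M (MSet M A)) (u : MSet M A), C ≤ T → IsChainUnion C u → u ∈ T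

instance {N : MFun M (MSet M A) (MSet M A)} {f : B → MSet M (MSet M A)} [DefFun M f] :
    DefPred M fun b => IsTower N (f b) := by
  unfold IsTower
  infer_instance

/-- Zermelo's argument, carried out with towers and chains which belong to `M`. Since `N` adds
nothing in several stages (`hN'`), the least tower is a chain. Its union is again in the tower and
is therefore fixed by `N`. -/
theorem IsTower.exists_fixed [SetCoded M A] {N : MFun M (MSet M A) (MSet M A)}
    (hN : ∀ s, s ≤ N.toFun s) (hN' : ∀ s r, s ≤ r → r ≤ N.toFun s → r = s ∨ r = N.toFun s)
    {Q : MSet M (MSet M A)} (hQ : IsTower N Q) : ∃ m ∈ Q, N.toFun m = m := by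
  let 𝒯 : MSet M (MSet M A) := MSet.sep fun s => ∀ T, IsTower N T → s ∈ T
  have h𝒯 : IsTower N 𝒯 := ⟨fun s hs T hT => hT.1 _ (hs T hT), fun C u hC hu T hT =>
    hT.2 C u (fun s hs => hC hs T hT) hu⟩
  have hmin : ∀ T, IsTower N T → 𝒯 ≤ T := fun T hT s hs => hs T hT
  -- No member of the least tower lies strictly between a comparable element `c` and `N c`.
  have step : ∀ c ∈ 𝒯, (∀ s ∈ 𝒯, s ≤ c ∨ c ≤ s) → ∀ s ∈ 𝒯, s ≤ c ∨ N.toFun c ≤ s := by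
    intro c hc hcomp
    have : IsTower N (MSet.sep fun s => s ∈ 𝒯 ∧ (s ≤ c ∨ N.toFun c ≤ s)) := by
      refine ⟨?_, ?_⟩
      · rintro s ⟨hs, h | h⟩
        · refine ⟨h𝒯.1 s hs, ?_⟩
          rcases hcomp _ (h𝒯.1 s hs) with h' | h'
          · exact Or.inl h'
          · rcases hN' s c h h' with rfl | rfl
            · exact Or.inr le_rfl
            · exact Or.inl le_rfl
        · exact ⟨h𝒯.1 s hs, Or.inr (h.trans (hN s))⟩
      · intro C u hC hu
        refine ⟨h𝒯.2 C u (fun s hs => (hC hs).1) hu, ?_⟩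
        by_cases h : ∀ s ∈ C, s ≤ c
        · exact Or.inl (hu.le_of h)
        · push Not at h
          obtain ⟨s, hs, hsc⟩ := h
          exact Or.inr (((hC hs).2.resolve_left hsc).trans (hu.le hs))
    exact fun s hs => (hmin _ this hs).2
  have chain : ∀ c ∈ 𝒯, ∀ s ∈ 𝒯, s ≤ c ∨ c ≤ s := by
    have : IsTower N (MSet.sep fun c => c ∈ 𝒯 ∧ ∀ s, s ∈ 𝒯 → s ≤ c ∨ c ≤ s) := by
      refine ⟨?_, ?_⟩
      · rintro c ⟨hc, hcomp⟩
        refine ⟨h𝒯.1 c hc, fun s hs => ?_⟩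
        exact (step c hc hcomp s hs).imp_left fun h => h.trans (hN c)
      · intro C u hC hu
        refine ⟨h𝒯.2 C u (fun s hs => (hC hs).1) hu, fun s hs => ?_⟩
        by_cases h : ∃ c ∈ C, s ≤ c
        · obtain ⟨c, hc, hsc⟩ := h
          exact Or.inl (hsc.trans (hu.le hc))
        · push Not at h
          exact Or.inr (hu.le_of fun c hc => ((hC hc).2 s hs).resolve_left (h c hc))
    exact fun c hc => (hmin _ this hc).2
  let m : MSet M A := MSet.sep fun a => ∃ s, s ∈ 𝒯 ∧ a ∈ s
  have hm : IsChainUnion 𝒯 m := ⟨fun s t hs ht => chain t ht s hs, fun a => Iff.rfl⟩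
  have hm' : m ∈ 𝒯 := h𝒯.2 𝒯 m le_rfl hm
  exact ⟨m, hmin Q hQ hm', le_antisymm (hm.le (h𝒯.1 m hm')) (hN m)⟩

/-- Tukey's lemma in the model. -/
theorem exists_maximal [SetCoded M A] (Con : MSet M (Finset A)) (hempty : ∅ ∈ Con) :
    ∃ m : MSet M A, (∀ t : Finset A, (∀ a ∈ t, a ∈ m) → t ∈ Con) ∧
      ∀ a, (∀ t : Finset A, (∀ c ∈ t, c ∈ m ∨ c = a) → t ∈ Con) → a ∈ m := by
  have empty_of : ∀ m : MSet M A, (∀ a, a ∉ m) → ∀ t : Finset A, (∀ a ∈ t, a ∈ m) → t ∈ Con := by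
    intro m hm t ht
    rwa [Finset.eq_empty_of_forall_notMem fun a ha => hm a (ht a ha)]
  rcases isEmpty_or_nonempty A with hA | ⟨⟨a₀⟩⟩
  · exact ⟨.ofFinite ∅ Set.finite_empty, empty_of _ fun a => hA.elim a, fun a => hA.elim a⟩
  obtain ⟨F, hF⟩ := exists_choice (M := M) (MSet.sep fun p : MSet M A × A =>
      (∃ b, ¬ b ∈ p.1 ∧ ∀ t : Finset A, (∀ c, c ∈ t → c ∈ p.1 ∨ c = b) → t ∈ Con) →
      (¬ p.2 ∈ p.1 ∧ ∀ t : Finset A, (∀ c, c ∈ t → c ∈ p.1 ∨ c = p.2) → t ∈ Con)) (fun s => by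
    by_cases h : ∃ b, ¬ b ∈ s ∧ ∀ t : Finset A, (∀ c, c ∈ t → c ∈ s ∨ c = b) → t ∈ Con
    · exact ⟨h.choose, fun _ => h.choose_spec⟩
    · exact ⟨a₀, fun h' => (h h').elim⟩)
  -- One admissible element at a time is adjoined, so nothing lies strictly between a set and the
  -- next one; a set without an admissible element is fixed.
  let next (s : MSet M A) : MSet M A := MSet.sep fun a => a ∈ s ∨
    ((∃ b, ¬ b ∈ s ∧ ∀ t : Finset A, (∀ c, c ∈ t → c ∈ s ∨ c = b) → t ∈ Con) ∧ a = F.toFun s)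
  let N : MFun M (MSet M A) (MSet M A) := ⟨next, .of_pred (DefPred.congr
    (φ := fun p : MSet M A × MSet M A => ∀ a, a ∈ p.2 ↔ a ∈ p.1 ∨
      ((∃ b, ¬ b ∈ p.1 ∧ ∀ t : Finset A, (∀ c, c ∈ t → c ∈ p.1 ∨ c = b) → t ∈ Con) ∧
        a = F.toFun p.1)) inferInstance fun p => by
      rw [MSet.ext_iff]
      exact forall_congr' fun a => Iff.comm)⟩
  have hQ : IsTower N (MSet.sep fun s : MSet M A =>
      ∀ t : Finset A, (∀ a, a ∈ t → a ∈ s) → t ∈ Con) := by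
    refine ⟨fun s hs t ht => ?_, fun C u hC hu t ht => ?_⟩
    · by_cases h : ∃ b, ¬ b ∈ s ∧ ∀ t : Finset A, (∀ c, c ∈ t → c ∈ s ∨ c = b) → t ∈ Con
      · exact (hF s h).2 t fun a ha => (ht a ha).imp_right fun h => h.2
      · exact hs t fun a ha => (ht a ha).resolve_right fun h' => h h'.1
    -- A finite subset of the union lies in a single member of the chain. The chain may be empty,
    -- which is why the empty set is treated apart.
    · have : ∀ t : Finset A, (∀ a ∈ t, ∃ s ∈ C, a ∈ s) → t = ∅ ∨ ∃ s ∈ C, ∀ a ∈ t, a ∈ s := by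
        classical
        intro t
        induction t using Finset.induction_on with
        | empty => exact fun _ => Or.inl rfl
        | insert a t _ ih =>
          intro h
          obtain ⟨s, hs, has⟩ := h a (Finset.mem_insert_self _ _)
          rcases ih fun b hb => h b (Finset.mem_insert_of_mem hb) with rfl | ⟨s', hs', h'⟩
          · exact Or.inr ⟨s, hs, by simpa using has⟩
          · rcases hu.1 s s' hs hs' with hle | hle
            · refine Or.inr ⟨s', hs', fun b hb => ?_⟩
              rcases Finset.mem_insert.1 hb with rfl | hb
              · exact hle has
              · exact h' b hb
            · refine Or.inr ⟨s, hs, fun b hb => ?_⟩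
              rcases Finset.mem_insert.1 hb with rfl | hb
              · exact has
              · exact hle (h' b hb)
      rcases this t fun a ha => (hu.2 a).1 (ht a ha) with rfl | ⟨s, hs, h⟩
      · exact hempty
      · exact hC hs t h
  obtain ⟨m, hm, hfix⟩ := IsTower.exists_fixed (N := N) (fun s a ha => Or.inl ha) (by
    intro s r hsr hrs
    by_cases h : ∀ a ∈ r, a ∈ s
    · exact Or.inl (le_antisymm h hsr)
    · push Not at h
      obtain ⟨a, har, has⟩ := h
      refine Or.inr (le_antisymm hrs fun b hb => ?_)
      rcases hb with hb | hb
      · exact hsr hb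
      · rw [hb.2]
        obtain ⟨-, rfl⟩ := (hrs har).resolve_left has
        exact har) hQ
  refine ⟨m, hm, fun a ha => ?_⟩
  by_contra ham
  have h : ∃ b, ¬ b ∈ m ∧ ∀ t : Finset A, (∀ c, c ∈ t → c ∈ m ∨ c = b) → t ∈ Con := ⟨a, ham, ha⟩
  have : F.toFun m ∈ N.toFun m := Or.inr ⟨h, rfl⟩
  rw [hfix] at this
  exact (hF m h).1 this

/-! ### Propositional compactness in the model -/

instance Coded.bool : Coded M Bool := .ofInjective (fun b => if b then 1 else 0 : Bool → ℕ)
  (by intro a b; cases a <;> cases b <;> simp)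
  (DefPred.congr (φ := fun n : ℕ => n = 0 ∨ n = 1) inferInstance fun n => by simp [eq_comm])

instance SetCoded.bool : SetCoded M Bool where
  exists_range := by
    obtain ⟨s, hs⟩ := exists_finite (M := M) (Set.finite_range (code : Bool → M))
    exact ⟨s, hs⟩

/-- If the clauses in `Γ` (given by their positive and their negative atoms) are finitely
satisfiable, then they are satisfied by a valuation in the model. -/
theorem exists_valuation [SetCoded M A] (Γ : MSet M (Finset A × Finset A))
    (h : ∀ G : Finset (Finset A × Finset A), (∀ γ ∈ G, γ ∈ Γ) →
      ∃ v : Set A, ∀ γ ∈ G, (∃ i ∈ γ.1, i ∈ v) ∨ ∃ i ∈ γ.2, i ∉ v) :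
    ∃ v : MSet M A, ∀ γ ∈ Γ, (∃ i ∈ γ.1, i ∈ v) ∨ ∃ i ∈ γ.2, i ∉ v := by
  classical
  -- A finite partial assignment is consistent if it extends to a solution of each finite part of
  -- `Γ`. Solutions are taken to be finite sets, as only these can be quantified over in `M`; the
  -- atoms that occur are finite in number, so nothing is lost.
  let Con : MSet M (Finset (A × Bool)) := MSet.sep fun t =>
    ∀ G : Finset (Finset A × Finset A), (∀ γ, γ ∈ G → γ ∈ Γ) →
      ∃ v : Finset A, (∀ p, p ∈ t → (p.1 ∈ v ↔ p.2 = true)) ∧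
        ∀ γ, γ ∈ G → (∃ i, i ∈ γ.1 ∧ i ∈ v) ∨ ∃ i, i ∈ γ.2 ∧ ¬ i ∈ v
  obtain ⟨m, hm, hmax⟩ := exists_maximal Con (by
    intro G hG
    obtain ⟨v, hv⟩ := h G hG
    refine ⟨(G.biUnion fun γ => γ.1 ∪ γ.2).filter (· ∈ v), by simp, fun γ hγ => ?_⟩
    rcases hv γ hγ with ⟨i, hi, hiv⟩ | ⟨i, hi, hiv⟩
    · exact Or.inl ⟨i, hi, by simp only [Finset.mem_filter, Finset.mem_biUnion]
                              exact ⟨⟨γ, hγ, Finset.mem_union_left _ hi⟩, hiv⟩⟩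
    · exact Or.inr ⟨i, hi, by simp [hiv]⟩)
  -- If neither value of `i` could be added, two finite assignments and two finite sets of clauses
  -- would witness this; a common solution for their union decides `i` and refutes one of the
  -- witnesses.
  have total : ∀ i, (i, true) ∈ m ∨ (i, false) ∈ m := by
    intro i
    by_contra! hne
    have h1 : ¬ _ := fun h => hne.1 (hmax _ h)
    have h0 : ¬ _ := fun h => hne.2 (hmax _ h)
    push Not at h1 h0
    obtain ⟨t₁, ht₁, hc₁⟩ := h1
    obtain ⟨t₀, ht₀, hc₀⟩ := h0
    have hc₁' : ¬ ∀ G : Finset (Finset A × Finset A), (∀ γ, γ ∈ G → γ ∈ Γ) →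
      ∃ v : Finset A, (∀ p, p ∈ t₁ → (p.1 ∈ v ↔ p.2 = true)) ∧
        ∀ γ, γ ∈ G → (∃ i, i ∈ γ.1 ∧ i ∈ v) ∨ ∃ i, i ∈ γ.2 ∧ ¬ i ∈ v := hc₁
    have hc₀' : ¬ ∀ G : Finset (Finset A × Finset A), (∀ γ, γ ∈ G → γ ∈ Γ) →
      ∃ v : Finset A, (∀ p, p ∈ t₀ → (p.1 ∈ v ↔ p.2 = true)) ∧
        ∀ γ, γ ∈ G → (∃ i, i ∈ γ.1 ∧ i ∈ v) ∨ ∃ i, i ∈ γ.2 ∧ ¬ i ∈ v := hc₀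
    rw [not_forall] at hc₁' hc₀'
    obtain ⟨G₁, hG₁⟩ := hc₁'
    obtain ⟨G₀, hG₀⟩ := hc₀'
    rw [Classical.not_imp] at hG₁ hG₀
    obtain ⟨v, hv, hvG⟩ := hm (t₁.erase (i, true) ∪ t₀.erase (i, false)) (by
      intro p hp
      rcases Finset.mem_union.1 hp with hp | hp
      · exact (ht₁ p (Finset.mem_of_mem_erase hp)).resolve_right (Finset.ne_of_mem_erase hp)
      · exact (ht₀ p (Finset.mem_of_mem_erase hp)).resolve_right (Finset.ne_of_mem_erase hp))
      (G₁ ∪ G₀) (by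
        intro γ hγ
        rcases Finset.mem_union.1 hγ with hγ | hγ
        · exact hG₁.1 γ hγ
        · exact hG₀.1 γ hγ)
    by_cases hi : i ∈ v
    · refine hG₁.2 ⟨v, fun p hp => ?_, fun γ hγ => hvG γ (Finset.mem_union_left _ hγ)⟩
      by_cases e : p = (i, true)
      · rw [e]; simp [hi]
      · exact hv p (Finset.mem_union_left _ (Finset.mem_erase.2 ⟨e, hp⟩))
    · refine hG₀.2 ⟨v, fun p hp => ?_, fun γ hγ => hvG γ (Finset.mem_union_right _ hγ)⟩
      by_cases e : p = (i, false)
      · rw [e]; simp [hi]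
      · exact hv p (Finset.mem_union_right _ (Finset.mem_erase.2 ⟨e, hp⟩))
  refine ⟨MSet.sep fun i => (i, true) ∈ m, fun γ hγ => ?_⟩
  obtain ⟨v, hv, hvG⟩ := hm ((γ.1 ∪ γ.2).image fun i => (i, decide ((i, true) ∈ m))) (by
    intro p hp
    obtain ⟨i, -, rfl⟩ := Finset.mem_image.1 hp
    by_cases h : (i, true) ∈ m
    · simp [h]
    · simpa [h] using (total i).resolve_left h) {γ} (by simpa using hγ)
  have hv' : ∀ i, i ∈ γ.1 ∪ γ.2 → (i ∈ v ↔ (i, true) ∈ m) := fun i hi => by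
    have := hv _ (Finset.mem_image_of_mem (fun i => (i, decide ((i, true) ∈ m))) hi)
    simpa using this
  rcases hvG γ (Finset.mem_singleton_self _) with ⟨i, hi, hiv⟩ | ⟨i, hi, hiv⟩
  · exact Or.inl ⟨i, hi, (hv' i (Finset.mem_union_left _ hi)).1 hiv⟩
  · exact Or.inr ⟨i, hi, fun h => hiv ((hv' i (Finset.mem_union_right _ hi)).2 h)⟩

end

section

open TopologicalSpace

variable {M : Set ZFSet.{u}} [hM : Fact (IsTransitiveModel M)]

/-! ### A criterion for interpretations -/

theorem mem_toM_coe {X : ZFSet.{u}} [Fact (X ∈ M)] {s : MSet M X} {z : ZFSet.{u}} :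
    z ∈ s.toM.1 ↔ ∃ x : X, x ∈ s ∧ x.1 = z := by
  constructor
  · intro hz
    obtain ⟨x, hx, e⟩ := MSet.mem_toM (x := ⟨z, mem_of_mem s.toM.2 hz⟩).1 hz
    exact ⟨x, hx, congrArg (fun z : M => z.1) e⟩
  · rintro ⟨x, hx, rfl⟩
    exact MSet.code_mem_toM.2 hx

theorem coe_mem_toM {X : ZFSet.{u}} [Fact (X ∈ M)] {s : MSet M X} {x : X} :
    x.1 ∈ s.toM.1 ↔ x ∈ s := MSet.code_mem_toM

/-- A family of basic sets of the space `(X, τ)` of `M`, indexed by a set of `M`, which is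
interpreted by a basis of the space `E` so that coverings are preserved. -/
structure InterpretedBasis {X : ZFSet.{u}} [Fact (X ∈ M)] {B : Type w} [Coded M B]
    (mem : MSet M (X × B)) (τ : ZFSet.{u}) {E : Type v} [TopologicalSpace E] (p : X → E)
    (P : B → Set E) : Prop where
  mem_opens : ∀ O, O ∈ τ ↔ (O ∈ M ∧ O ⊆ X) ∧
    ∀ x : X, x.1 ∈ O → ∃ b, (x, b) ∈ mem ∧ ∀ y, (y, b) ∈ mem → y.1 ∈ O
  basis : IsTopologicalBasis (Set.range P)
  mem_iff : ∀ x b, (x, b) ∈ mem ↔ p x ∈ P b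
  cover : ∀ (e : E) (b₀ : B) (G : MSet M B), e ∈ P b₀ →
    (∀ x, (x, b₀) ∈ mem → ∃ b ∈ G, (x, b) ∈ mem) → ∃ b ∈ G, e ∈ P b

/-- A family of basic sets which is prime with respect to the coverings which lie in `M`. -/
structure IsPrimeFamily {X : ZFSet.{u}} [Fact (X ∈ M)] {B : Type w} [Coded M B]
    (mem : MSet M (X × B)) (F : Set B) : Prop where
  nonempty : F.Nonempty
  cover : ∀ b ∈ F, ∀ G : MSet M B, (∀ x, (x, b) ∈ mem → ∃ b' ∈ G, (x, b') ∈ mem) → ∃ b' ∈ G, b' ∈ F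
  inter : ∀ b₁ ∈ F, ∀ b₂ ∈ F, ∃ b₃ ∈ F, ∀ x, (x, b₃) ∈ mem → (x, b₁) ∈ mem ∧ (x, b₂) ∈ mem
  mono : ∀ b ∈ F, ∀ b', (∀ x, (x, b) ∈ mem → (x, b') ∈ mem) → b' ∈ F

variable {X : ZFSet.{u}} [hX : Fact (X ∈ M)] {B : Type w} [Coded M B]
  {mem : MSet M (X × B)}

/-- An empty basic set would be covered by the empty family. -/
theorem IsPrimeFamily.exists_mem {F : Set B} (hF : IsPrimeFamily mem F) {b : B} (hb : b ∈ F) :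
    ∃ x, (x, b) ∈ mem := by
  by_contra! h
  obtain ⟨b', hb', -⟩ := hF.cover b hb (.ofFinite ∅ Set.finite_empty) fun x hx => (h x hx).elim
  exact hb'

/-- The interpretation of an open set: the union of those basic sets which it contains. -/
def openHull (mem : MSet M (X × B)) {E : Type v} (P : B → Set E) (O : ZFSet.{u}) : Set E :=
  {e | ∃ b, e ∈ P b ∧ ∀ y, (y, b) ∈ mem → y.1 ∈ O}

/-! ### Interpretations obtained from interpreted bases -/

namespace InterpretedBasis

variable {τ : ZFSet.{u}} {E : Type v} [TopologicalSpace E] {p : X → E} {P : B → Set E}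
  (h : InterpretedBasis mem τ p P)

include h

theorem isOpen (b : B) : IsOpen (P b) := h.basis.isOpen ⟨b, rfl⟩

theorem exists_mem {e : E} {b : B} (he : e ∈ P b) : ∃ x, (x, b) ∈ mem := by
  by_contra! hb
  obtain ⟨b', hb', -⟩ := h.cover e b (.ofFinite ∅ Set.finite_empty) he fun x hx => (hb x hx).elim
  exact hb'

theorem exists_subset {e : E} {W : Set E} (hW : IsOpen W) (he : e ∈ W) : ∃ b, e ∈ P b ∧ P b ⊆ W := by
  obtain ⟨_, ⟨b, rfl⟩, hb, hbW⟩ := h.basis.exists_subset_of_mem_open he hW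
  exact ⟨b, hb, hbW⟩

theorem exists_closure_subset [T3Space E] {e : E} {W : Set E} (hW : IsOpen W) (he : e ∈ W) :
    ∃ b, e ∈ P b ∧ closure (P b) ⊆ W := by
  obtain ⟨_, ⟨b, rfl⟩, hb, hbW⟩ := h.basis.exists_closure_subset (hW.mem_nhds he)
  exact ⟨b, hb, hbW⟩

theorem mem_openHull {O : ZFSet.{u}} (hO : O ∈ τ) (x : X) : x.1 ∈ O ↔ p x ∈ openHull mem P O := by
  constructor
  · intro hx
    obtain ⟨b, hb, hbO⟩ := ((h.mem_opens O).1 hO).2 x hx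
    exact ⟨b, (h.mem_iff x b).1 hb, hbO⟩
  · rintro ⟨b, hb, hbO⟩
    exact hbO x ((h.mem_iff x b).2 hb)

theorem isOpen_openHull (O : ZFSet.{u}) : IsOpen (openHull mem P O) := by
  have : openHull mem P O = ⋃ b ∈ {b | ∀ y, (y, b) ∈ mem → y.1 ∈ O}, P b := by
    ext e
    simp only [openHull, Set.mem_iUnion, Set.mem_ofPred_eq, exists_prop, and_comm]
  rw [this]
  exact isOpen_biUnion fun b _ => h.isOpen b

/-- A set of `M` which is a union of basic sets is open. -/
theorem toM_mem {s : MSet M X} (hs : ∀ x ∈ s, ∃ b, (x, b) ∈ mem ∧ ∀ y, (y, b) ∈ mem → y ∈ s) :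
    s.toM.1 ∈ τ := by
  refine (h.mem_opens _).2 ⟨⟨s.toM.2, fun z hz => ?_⟩, fun x hx => ?_⟩
  · obtain ⟨x, -, rfl⟩ := mem_toM_coe.1 hz
    exact x.2
  · obtain ⟨b, hb, hbs⟩ := hs x (coe_mem_toM.1 hx)
    exact ⟨b, hb, fun y hy => coe_mem_toM.2 (hbs y hy)⟩

/-- The open set given by a basic set. -/
def basicOpen (b : B) : τ :=
  ⟨(MSet.sep fun x : X => (x, b) ∈ mem : MSet M X).toM.1, h.toM_mem fun _ hx => ⟨b, hx, fun _ hy => hy⟩⟩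

theorem mem_basicOpen (b : B) (x : X) : x.1 ∈ (h.basicOpen b).1 ↔ (x, b) ∈ mem :=
  coe_mem_toM (s := (MSet.sep fun x : X => (x, b) ∈ mem : MSet M X))

/-- The hull of a basic set may exceed its interpretation, but not its closure: basic sets of `E`
contain points of `M`, so any neighbourhood of a point of the hull meets `P b`. Regularity of `E`
then makes the hulls a basis. -/
theorem closure_openHull (b : B) : openHull mem P (h.basicOpen b).1 ⊆ closure (P b) := by
  rintro e ⟨b', he, hb'⟩
  refine mem_closure_iff.2 fun W hW heW => ?_
  obtain ⟨c, hc, hcW⟩ := h.exists_subset (hW.inter (h.isOpen b')) ⟨heW, he⟩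
  obtain ⟨x, hx⟩ := h.exists_mem hc
  have hx' := hcW ((h.mem_iff x c).1 hx)
  exact ⟨p x, hx'.1, (h.mem_iff x b).1 ((h.mem_basicOpen b x).1 (hb' x ((h.mem_iff x b').2 hx'.2)))⟩

theorem isPreinterpretation [SetCoded M B] [T3Space E] :
    IsPreinterpretation M X τ p fun O => openHull mem P O.1 where
  t0 := inferInstance
  isOpen O := h.isOpen_openHull _
  mem_iff x O := h.mem_openHull O.2 x
  inter := by
    rintro O₁ O₂ O₃ e
    ext z
    constructor
    · rintro ⟨b, hb, hbO⟩
      rw [e] at hbO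
      exact ⟨⟨b, hb, fun y hy => (ZFSet.mem_inter.1 (hbO y hy)).1⟩,
        ⟨b, hb, fun y hy => (ZFSet.mem_inter.1 (hbO y hy)).2⟩⟩
    · rintro ⟨⟨b₁, hb₁, h₁⟩, ⟨b₂, hb₂, h₂⟩⟩
      obtain ⟨b, hb, hbs⟩ := h.exists_subset ((h.isOpen b₁).inter (h.isOpen b₂)) ⟨hb₁, hb₂⟩
      refine ⟨b, hb, fun y hy => ?_⟩
      have := hbs ((h.mem_iff y b).1 hy)
      rw [e]
      exact ZFSet.mem_inter.2 ⟨h₁ y ((h.mem_iff y b₁).2 this.1), h₂ y ((h.mem_iff y b₂).2 this.2)⟩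
  sUnion := by
    intro 𝒜 h𝒜 hτ O hO
    ext e
    constructor
    · rintro ⟨b₀, he, hb₀⟩
      -- The basic sets contained in some member of `𝒜` form a family in `M` which covers `b₀`.
      obtain ⟨b, ⟨U, hU, hbU⟩, heb⟩ := h.cover e b₀ (MSet.sep fun b => ∃ U : M,
        (code U : M).1 ∈ (code (⟨𝒜, h𝒜⟩ : M) : M).1 ∧
          ∀ y : X, (y, b) ∈ mem → (code y : M).1 ∈ (code U : M).1) he (by
        intro x hx
        have hx := hb₀ x hx
        rw [hO] at hx
        obtain ⟨U, hU, hxU⟩ := ZFSet.mem_sUnion.1 hx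
        obtain ⟨b, hb, hbU⟩ := ((h.mem_opens U).1 (hτ hU)).2 x hxU
        exact ⟨b, ⟨⟨U, mem_of_mem h𝒜 hU⟩, hU, hbU⟩, hb⟩)
      exact ⟨⟨U.1, hτ hU⟩, hU, b, heb, hbU⟩
    · rintro ⟨U, hU, b, hb, hbU⟩
      refine ⟨b, hb, fun y hy => ?_⟩
      rw [hO]
      exact ZFSet.mem_sUnion_of_mem (hbU y hy) hU
  empty := by
    intro O hO
    refine Set.eq_empty_of_forall_notMem ?_
    rintro e ⟨b, hb, hbO⟩
    obtain ⟨x, hx⟩ := h.exists_mem hb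
    have := hbO x hx
    rw [hO] at this
    exact ZFSet.notMem_empty _ this
  univ := by
    intro O hO
    refine Set.eq_univ_of_forall fun e => ?_
    obtain ⟨b, hb, -⟩ := h.exists_subset isOpen_univ (Set.mem_univ e)
    exact ⟨b, hb, fun y _ => hO ▸ y.2⟩
  basis := by
    refine isTopologicalBasis_of_isOpen_of_nhds ?_ fun e W he hW => ?_
    · rintro _ ⟨O, rfl⟩
      exact h.isOpen_openHull _
    · obtain ⟨b, hb, hbW⟩ := h.exists_closure_subset hW he
      exact ⟨_, ⟨h.basicOpen b, rfl⟩, ⟨b, hb, fun y hy => (h.mem_basicOpen b y).2 hy⟩,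
        (h.closure_openHull b).trans hbW⟩

/-- The basic sets whose interpretation contains a point of a preinterpretation form a prime
family. -/
theorem isPrimeFamily [SetCoded M B] {E' : Type w₁} [TopologicalSpace E'] {p' : X → E'}
    {P' : τ → Set E'} (h' : IsPreinterpretation M X τ p' P') (e : E') :
    (∀ (O : τ) (G : MSet M B), e ∈ P' O → (∀ x : X, x.1 ∈ O.1 → ∃ b ∈ G, (x, b) ∈ mem) →
      ∃ b ∈ G, e ∈ P' (h.basicOpen b)) ∧
    (∀ O O' : τ, e ∈ P' O → (∀ x : X, x.1 ∈ O.1 → x.1 ∈ O'.1) → e ∈ P' O') ∧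
    IsPrimeFamily mem {b | e ∈ P' (h.basicOpen b)} := by
  have hsub : ∀ O : τ, O.1 ⊆ X := fun O => ((h.mem_opens O.1).1 O.2).1.2
  have mono : ∀ O O' : τ, e ∈ P' O → (∀ x : X, x.1 ∈ O.1 → x.1 ∈ O'.1) → e ∈ P' O' := by
    intro O O' he hO
    rw [h'.inter O O' O (by
      ext z
      rw [ZFSet.mem_inter]
      exact ⟨fun hz => ⟨hz, hO ⟨z, hsub O hz⟩ hz⟩, fun hz => hz.1⟩)] at he
    exact he.2
  have cover : ∀ (O : τ) (G : MSet M B), e ∈ P' O →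
      (∀ x : X, x.1 ∈ O.1 → ∃ b ∈ G, (x, b) ∈ mem) → ∃ b ∈ G, e ∈ P' (h.basicOpen b) := by
    intro O G he hG
    obtain ⟨𝒜, h𝒜⟩ := exists_image (M := M) (A := B) (C := MSet M X)
      (fun b s => b ∈ G ∧ ∀ x, x ∈ s ↔ (x, b) ∈ mem) (fun b s s' hs hs' =>
        MSet.ext fun x => (hs.2 x).trans (hs'.2 x).symm)
    -- The family `G` has been replaced by the set `𝒜` of open sets it indexes, because
    -- preinterpretations speak of unions of sets of open sets.
    have h𝒜' : ∀ z : ZFSet.{u}, z ∈ 𝒜.1 ↔ ∃ b ∈ G, z = (h.basicOpen b).1 := by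
      intro z
      constructor
      · intro hz
        obtain ⟨s, ⟨b, hb, hs⟩, e⟩ := (h𝒜 ⟨z, mem_of_mem 𝒜.2 hz⟩).1 hz
        have : s = MSet.sep fun x : X => (x, b) ∈ mem := MSet.ext hs
        rw [this] at e
        exact ⟨b, hb, (congrArg (fun z : M => z.1) e).symm⟩
      · rintro ⟨b, hb, rfl⟩
        exact (h𝒜 (code (MSet.sep fun x : X => (x, b) ∈ mem : MSet M X))).2
          ⟨_, ⟨b, hb, fun x => Iff.rfl⟩, rfl⟩
    let V : τ := ⟨(MSet.sep fun x : X => ∃ b, b ∈ G ∧ (x, b) ∈ mem : MSet M X).toM.1,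
      h.toM_mem (by
        rintro x ⟨b, hb, hx⟩
        exact ⟨b, hx, fun y hy => ⟨b, hb, hy⟩⟩)⟩
    have hV : V.1 = ZFSet.sUnion 𝒜.1 := by
      ext z
      rw [ZFSet.mem_sUnion]
      refine mem_toM_coe.trans ?_
      constructor
      · rintro ⟨x, ⟨b, hb, hx⟩, rfl⟩
        exact ⟨_, (h𝒜' _).2 ⟨b, hb, rfl⟩, (h.mem_basicOpen b x).2 hx⟩
      · rintro ⟨_, hU, hz⟩
        obtain ⟨b, hb, rfl⟩ := (h𝒜' _).1 hU
        exact ⟨⟨z, hsub _ hz⟩, ⟨b, hb, (h.mem_basicOpen b _).1 hz⟩, rfl⟩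
    have heV : e ∈ P' V := mono O V he fun x hx => by
      obtain ⟨b, hb, hxb⟩ := hG x hx
      exact coe_mem_toM.2 ⟨b, hb, hxb⟩
    rw [h'.sUnion 𝒜.1 𝒜.2 (fun z hz => by
      obtain ⟨b, -, rfl⟩ := (h𝒜' z).1 hz
      exact (h.basicOpen b).2) V hV] at heV
    obtain ⟨U, hU, heU⟩ := heV
    obtain ⟨b, hb, hUb⟩ := (h𝒜' _).1 hU
    refine ⟨b, hb, ?_⟩
    rwa [← show U = h.basicOpen b from Subtype.ext hUb]
  refine ⟨cover, mono, ?_, ?_, ?_, ?_⟩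
  · let V : τ := ⟨(MSet.sep fun x : X => True : MSet M X).toM.1, h.toM_mem fun x _ => by
      obtain ⟨b, hb, -⟩ := h.exists_subset isOpen_univ (Set.mem_univ (p x))
      exact ⟨b, (h.mem_iff x b).2 hb, fun _ _ => trivial⟩⟩
    have hV : V.1 = X := by
      ext z
      refine mem_toM_coe.trans ?_
      constructor
      · rintro ⟨x, -, rfl⟩
        exact x.2
      · intro hz
        exact ⟨⟨z, hz⟩, trivial, rfl⟩
    obtain ⟨b, -, hb⟩ := cover V (MSet.sep fun b => True) (h'.univ V hV ▸ Set.mem_univ e) fun x _ => by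
      obtain ⟨b, hb, -⟩ := h.exists_subset isOpen_univ (Set.mem_univ (p x))
      exact ⟨b, trivial, (h.mem_iff x b).2 hb⟩
    exact ⟨b, hb⟩
  · intro b hb G hG
    exact cover _ G hb fun x hx => hG x ((h.mem_basicOpen b x).1 hx)
  · intro b₁ hb₁ b₂ hb₂
    have hopen : ∀ x, (x, b₁) ∈ mem ∧ (x, b₂) ∈ mem →
        ∃ b, (x, b) ∈ mem ∧ ∀ y, (y, b) ∈ mem → (y, b₁) ∈ mem ∧ (y, b₂) ∈ mem := by
      rintro x ⟨h₁, h₂⟩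
      obtain ⟨b, hb, hbs⟩ := h.exists_subset ((h.isOpen b₁).inter (h.isOpen b₂))
        ⟨(h.mem_iff x b₁).1 h₁, (h.mem_iff x b₂).1 h₂⟩
      refine ⟨b, (h.mem_iff x b).2 hb, fun y hy => ?_⟩
      have := hbs ((h.mem_iff y b).1 hy)
      exact ⟨(h.mem_iff y b₁).2 this.1, (h.mem_iff y b₂).2 this.2⟩
    let V : τ := ⟨(MSet.sep fun x : X => (x, b₁) ∈ mem ∧ (x, b₂) ∈ mem : MSet M X).toM.1,
      h.toM_mem hopen⟩
    have heV : e ∈ P' V := by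
      rw [h'.inter (h.basicOpen b₁) (h.basicOpen b₂) V (by
        ext z
        rw [ZFSet.mem_inter]
        constructor
        · intro hz
          obtain ⟨x, ⟨h₁, h₂⟩, rfl⟩ := mem_toM_coe.1 hz
          exact ⟨(h.mem_basicOpen b₁ x).2 h₁, (h.mem_basicOpen b₂ x).2 h₂⟩
        · rintro ⟨h₁, h₂⟩
          have hz := hsub _ h₁
          exact coe_mem_toM (x := ⟨z, hz⟩).2
            ⟨(h.mem_basicOpen b₁ ⟨z, hz⟩).1 h₁, (h.mem_basicOpen b₂ ⟨z, hz⟩).1 h₂⟩)]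
      exact ⟨hb₁, hb₂⟩
    obtain ⟨b, hb, heb⟩ := cover V (MSet.sep fun b => ∀ y, (y, b) ∈ mem →
      (y, b₁) ∈ mem ∧ (y, b₂) ∈ mem) heV fun x hx => by
        obtain ⟨b, hb, hb'⟩ := hopen x (coe_mem_toM.1 hx)
        exact ⟨b, hb', hb⟩
    exact ⟨b, heb, hb⟩
  · intro b hb b' hbb'
    exact mono _ _ hb fun x hx => (h.mem_basicOpen b' x).2 (hbb' x ((h.mem_basicOpen b x).1 hx))

/-- A point `e` is sent to a point of `E` whose basic neighbourhoods all belong to the prime family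
of `e`. This yields one inclusion between the preimage of the hull of `O` and `P' O`; the other one
needs regularity, expressed inside `M`. -/
theorem exists_reduction [SetCoded M B] [T3Space E]
    (conv : ∀ F : Set B, IsPrimeFamily mem F → ∃ e, ∀ b, e ∈ P b → b ∈ F)
    {E' : Type w₁} [TopologicalSpace E'] {p' : X → E'}
    {P' : τ → Set E'} (h' : IsPreinterpretation M X τ p' P') :
    ∃ g : E' → E, IsReduction p' P' p (fun O => openHull mem P O.1) g := by
  choose g hg using fun e => conv _ (h.isPrimeFamily h' e).2.2
  have hgO : ∀ e (O : τ), g e ∈ openHull mem P O.1 ↔ e ∈ P' O := by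
    intro e O
    obtain ⟨cover, mono, hF⟩ := h.isPrimeFamily h' e
    constructor
    · rintro ⟨b, hb, hbO⟩
      exact mono _ O (hg e b hb) fun x hx => hbO x ((h.mem_basicOpen b x).1 hx)
    · intro he
      have hOM : O.1 ∈ M := ((h.mem_opens O.1).1 O.2).1.1
      let s : MSet M X := MSet.sep fun x : X => (code x : M).1 ∈ (code (⟨O.1, hOM⟩ : M) : M).1
      -- Basic sets `b` well inside `O`: each point of `M` outside `O` has a basic neighbourhood
      -- disjoint from `b`. By regularity of `E` they cover `O` in `M`.
      obtain ⟨b, ⟨-, hb⟩, heb⟩ := cover O (MSet.sep fun b => (∀ y, (y, b) ∈ mem → y ∈ s) ∧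
          ∀ x, ¬ x ∈ s → ∃ c, (x, c) ∈ mem ∧ ∀ y, ¬ ((y, b) ∈ mem ∧ (y, c) ∈ mem)) he (by
        intro x hx
        obtain ⟨b, hb, hbO⟩ := h.exists_closure_subset (h.isOpen_openHull O.1)
          ((h.mem_openHull O.2 x).1 hx)
        refine ⟨b, ⟨fun y hy => (h.mem_openHull O.2 y).2
          (hbO (subset_closure ((h.mem_iff y b).1 hy))), fun x' hx' => ?_⟩, (h.mem_iff x b).2 hb⟩
        obtain ⟨c, hc, hcb⟩ := h.exists_subset isClosed_closure.isOpen_compl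
          (show p x' ∈ (closure (P b))ᶜ from fun hx'' => hx' ((h.mem_openHull O.2 x').2 (hbO hx'')))
        exact ⟨c, (h.mem_iff x' c).2 hc, fun y hy =>
          hcb ((h.mem_iff y c).1 hy.2) (subset_closure ((h.mem_iff y b).1 hy.1))⟩)
      obtain ⟨b₀, hb₀, -⟩ := h.exists_subset isOpen_univ (Set.mem_univ (g e))
      -- The basic sets which lie in `O` or are disjoint from `b` cover the whole space, so one of
      -- them contains `g e`. It belongs to the prime family together with `b` and so cannot be
      -- disjoint from it.
      obtain ⟨c, hc | hc, hec⟩ := h.cover (g e) b₀ (MSet.sep fun c => (∀ y, (y, c) ∈ mem → y ∈ s) ∨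
          ∀ y, ¬ ((y, b) ∈ mem ∧ (y, c) ∈ mem)) hb₀ (by
        intro x _
        by_cases hx : x ∈ s
        · obtain ⟨c, hc, hcO⟩ := ((h.mem_opens O.1).1 O.2).2 x hx
          exact ⟨c, Or.inl hcO, hc⟩
        · obtain ⟨c, hc, hcb⟩ := hb x hx
          exact ⟨c, Or.inr hcb, hc⟩)
      · exact ⟨c, hec, hc⟩
      · obtain ⟨b₃, hb₃, hsub⟩ := hF.inter b heb c (hg e c hec)
        obtain ⟨x, hx⟩ := hF.exists_mem hb₃
        exact (hc x (hsub x hx)).elim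
  refine ⟨g, fun x => ?_, fun O => Set.ext fun e => hgO e O⟩
  refine Inseparable.eq ((h.isPreinterpretation.basis.inseparable_iff).2 ?_)
  rintro _ ⟨O, rfl⟩
  exact ((h.mem_openHull O.2 x).symm.trans (h'.mem_iff x O)).trans (hgO (p' x) O).symm

theorem isInterpretation [SetCoded M B] [T3Space E]
    (conv : ∀ F : Set B, IsPrimeFamily mem F → ∃ e, ∀ b, e ∈ P b → b ∈ F) :
    IsInterpretation M X τ p fun O => openHull mem P O.1 :=
  ⟨h.isPreinterpretation, fun _ _ _ _ h' => h.exists_reduction conv h'⟩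

end InterpretedBasis

omit hM hX in
/-- The points of the space of `M` are dense in a preinterpretation. -/
theorem IsPreinterpretation.denseRange {τ : ZFSet.{u}} {E : Type v} [TopologicalSpace E] {p : X → E}
    {P : τ → Set E} (h : IsPreinterpretation M X τ p P) (hτ : ∀ O ∈ τ, O ⊆ X) : DenseRange p := by
  refine h.basis.dense_iff.2 ?_
  rintro _ ⟨O, rfl⟩ hne
  rcases ZFSet.eq_empty_or_nonempty O.1 with hO | ⟨z, hz⟩
  · rw [h.empty O hO] at hne
    exact (Set.not_nonempty_empty hne).elim
  · exact ⟨p ⟨z, hτ _ O.2 hz⟩, (h.mem_iff ⟨z, hτ _ O.2 hz⟩ O).1 hz, ⟨_, rfl⟩⟩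

end

section

open TopologicalSpace Filter Topology

variable {M : Set ZFSet.{u}} [hM : Fact (IsTransitiveModel M)]

/-! ### Complete metric spaces of the model -/

/-- The map `p` is a dense embedding of `X` in a metric space, the induced distance belongs to `M`
(through its set `D` of lower bounds), and Cauchy sequences of `M` converge. -/
structure InterpretedMetric {X : ZFSet.{u}} [Fact (X ∈ M)] (D : MSet M (ℚ × (X × X))) {E : Type v}
    [MetricSpace E] (p : X → E) : Prop where
  mem_iff : ∀ q x y, (q, (x, y)) ∈ D ↔ (q : ℝ) < dist (p x) (p y)
  dense : DenseRange p
  complete : ∀ s : ℕ → X, DefFun M s → CauchySeq (p ∘ s) → ∃ x, Tendsto (p ∘ s) atTop (𝓝 (p x))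

variable {X : ZFSet.{u}} [hX : Fact (X ∈ M)] {D : MSet M (ℚ × (X × X))} {E : Type v} [MetricSpace E]
  {p : X → E}

/-- The membership relation between points and balls. -/
def ballMem (D : MSet M (ℚ × (X × X))) : MSet M (X × (X × ℚ)) :=
  MSet.sep fun t => ∃ q : ℚ, q < t.2.2 ∧ ¬ (q, (t.1, t.2.1)) ∈ D

/-- The interpretation of a ball. -/
def ballSet (p : X → E) (b : X × ℚ) : Set E := Metric.ball (p b.1) b.2

theorem mem_ballSet {b : X × ℚ} {e : E} : e ∈ ballSet p b ↔ dist e (p b.1) < b.2 := Iff.rfl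

namespace InterpretedMetric

variable (h : InterpretedMetric D p)
include h

theorem mem_ballMem (x : X) (b : X × ℚ) : (x, b) ∈ ballMem D ↔ dist (p x) (p b.1) < b.2 := by
  change (∃ q : ℚ, q < b.2 ∧ ¬ (q, (x, b.1)) ∈ D) ↔ _
  simp only [h.mem_iff, not_lt]
  constructor
  · rintro ⟨q, hq, hd⟩
    exact lt_of_le_of_lt hd (Rat.cast_lt.2 hq)
  · intro hlt
    obtain ⟨q, hq, hqb⟩ := exists_rat_btwn hlt
    exact ⟨q, Rat.cast_lt.1 hqb, hq.le⟩

theorem exists_near (e : E) {ε : ℝ} (hε : 0 < ε) : ∃ x, dist e (p x) < ε :=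
  h.dense.exists_dist_lt e hε

theorem isTopologicalBasis : IsTopologicalBasis (Set.range (ballSet p)) := by
  refine isTopologicalBasis_of_isOpen_of_nhds ?_ fun e W he hW => ?_
  · rintro _ ⟨b, rfl⟩
    exact Metric.isOpen_ball
  · obtain ⟨ε, hε, hW⟩ := Metric.isOpen_iff.1 hW e he
    obtain ⟨q, hq, hqε⟩ := exists_rat_btwn (half_pos hε)
    obtain ⟨x, hx⟩ := h.exists_near e hq
    refine ⟨_, ⟨(x, q), rfl⟩, hx, fun y hy => hW ?_⟩
    rw [mem_ballSet] at hy
    rw [Metric.mem_ball]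
    have := dist_triangle y (p x) e
    rw [dist_comm (p x) e] at this
    simp only at hy
    linarith

/-- A family of balls of the model which covers a ball still covers its interpretation. -/
theorem cover (e : E) (b₀ : X × ℚ) (G : MSet M (X × ℚ)) (he : e ∈ ballSet p b₀)
    (hG : ∀ x, (x, b₀) ∈ ballMem D → ∃ b ∈ G, (x, b) ∈ ballMem D) : ∃ b ∈ G, e ∈ ballSet p b := by
  by_contra! hcon
  simp only [mem_ballSet, not_lt] at hcon
  obtain ⟨ρ, hρ, hρ'⟩ := exists_rat_btwn (mem_ballSet.1 he)
  -- A pair `(x, ε)` is bad if `x` is in the closed `ρ`-ball and no ball of `G` contains the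
  -- `ε`-ball around `x` by the triangle inequality. A step of `R` moves the centre by at most the
  -- old radius and at least halves the radius.
  let bad : MSet M (X × ℚ) := MSet.sep fun t => 0 < t.2 ∧ ¬ (ρ, (t.1, b₀.1)) ∈ D ∧
    ∀ b, b ∈ G → (b.2 - t.2, (t.1, b.1)) ∈ D
  let R : MSet M ((X × ℚ) × (X × ℚ)) := MSet.sep fun t => (t.1 ∈ bad ∧ t.2 ∈ bad) ∧
    t.1.2 + t.1.2 ≤ t.2.2 ∧ ¬ (t.2.2, (t.1.1, t.2.1)) ∈ D
  have hq : ∀ k : ℕ, (0 : ℝ) < (((1 / 2) ^ k : ℚ) : ℝ) := fun k => by positivity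
  have hnear : ∀ k : ℕ, ∃ x, dist e (p x) < min ((((1 / 2) ^ k : ℚ) : ℝ) / 4) (ρ - dist e (p b₀.1)) :=
    fun k => h.exists_near e (lt_min (by linarith [hq k]) (by linarith))
  choose x hx using hnear
  have hbad : ∀ k, (x k, (1 / 2 : ℚ) ^ k) ∈ bad := by
    intro k
    have h1 := lt_of_lt_of_le (hx k) (min_le_left _ _)
    have h2 := lt_of_lt_of_le (hx k) (min_le_right _ _)
    refine ⟨by positivity, ?_, fun b hb => ?_⟩
    · rw [h.mem_iff, not_lt]
      have := dist_triangle_left (p (x k)) (p b₀.1) e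
      linarith
    · rw [h.mem_iff]
      have := hcon b hb
      have := dist_triangle e (p (x k)) (p b.1)
      push_cast at *
      linarith [hq k]
  obtain ⟨s, hs, hsR⟩ := exists_descending R (t := fun k => (x k, (1 / 2 : ℚ) ^ k)) fun k => by
    refine ⟨⟨hbad (k + 1), hbad k⟩, ?_, ?_⟩
    · simp only [pow_succ]
      linarith
    · rw [h.mem_iff, not_lt]
      have h1 := lt_of_lt_of_le (hx k) (min_le_left _ _)
      have h2 := lt_of_lt_of_le (hx (k + 1)) (min_le_left _ _)
      have := dist_triangle_left (p (x (k + 1))) (p (x k)) e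
      have := hq k
      push_cast [pow_succ] at *
      linarith
  have hsbad : ∀ k, s k ∈ bad := fun k => (hsR k).1.2
  -- The redundant factor `2 * _ / 2` is the shape required by `cauchySeq_of_le_geometric_two`.
  have hle : ∀ k, ((s k).2 : ℝ) ≤ 2 * (s 0).2 / 2 / 2 ^ k := by
    intro k
    induction k with
    | zero => simp
    | succ k ih =>
      have : (s (k + 1)).2 + (s (k + 1)).2 ≤ (s k).2 := (hsR k).2.1
      have : ((s (k + 1)).2 : ℝ) + (s (k + 1)).2 ≤ (s k).2 := by exact_mod_cast this
      rw [pow_succ, ← div_div]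
      linarith
  have hdist : ∀ k, dist (p (s k).1) (p (s (k + 1)).1) ≤ (s k).2 := fun k => by
    have := (hsR k).2.2
    rw [h.mem_iff, not_lt] at this
    rwa [dist_comm]
  obtain ⟨y, hy⟩ := h.complete (fun k => (s k).1) inferInstance
    (cauchySeq_of_le_geometric_two fun k => (hdist k).trans (hle k))
  have hq0 : Tendsto (fun k => ((s k).2 : ℝ)) atTop (𝓝 0) := by
    refine squeeze_zero (fun k => ?_) hle ?_
    · exact_mod_cast (hsbad k).1.le
    · have := (tendsto_pow_atTop_nhds_zero_of_lt_one (r := (1 / 2 : ℝ)) (by norm_num)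
        (by norm_num)).const_mul (2 * ((s 0).2 : ℝ) / 2)
      simpa [div_eq_mul_inv] using this
  have hyb : dist (p y) (p b₀.1) ≤ ρ := by
    refine le_of_tendsto (hy.dist tendsto_const_nhds) (Eventually.of_forall fun k => ?_)
    have := (hsbad k).2.1
    rwa [h.mem_iff, not_lt] at this
  -- The limit `y` lies in a ball `b` of `G`, so for large `k` the ball of `s k` fits inside `b`,
  -- which contradicts badness.
  obtain ⟨b, hb, hyb⟩ := hG y ((h.mem_ballMem y b₀).2 (lt_of_le_of_lt hyb hρ'))
  rw [h.mem_ballMem] at hyb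
  have hlim := (hy.dist (tendsto_const_nhds (x := p b.1))).add hq0
  rw [add_zero] at hlim
  obtain ⟨k, hk⟩ := (hlim.eventually_lt_const hyb).exists
  have := (hsbad k).2.2 b hb
  rw [h.mem_iff] at this
  push_cast at this
  simp only [Function.comp_apply] at hk
  linarith

theorem interpretedBasis {τ : ZFSet.{u}} (hτ : ∀ O, O ∈ τ ↔ (O ∈ M ∧ O ⊆ X) ∧ ∀ x : X, x.1 ∈ O →
    ∃ ε : ℚ, 0 < ε ∧ ∀ y : X, dist (p y) (p x) < ε → y.1 ∈ O) :
    InterpretedBasis (ballMem D) τ p (ballSet p) where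
  mem_opens O := by
    rw [hτ]
    refine and_congr_right fun _ => forall_congr' fun x => imp_congr_right fun _ => ?_
    simp only [h.mem_ballMem]
    constructor
    · rintro ⟨ε, hε, hO⟩
      exact ⟨(x, ε), by simpa using hε, hO⟩
    · rintro ⟨⟨a, r⟩, hx, hO⟩
      obtain ⟨ε, hε, hε'⟩ := exists_rat_btwn (sub_pos.2 hx)
      refine ⟨ε, by exact_mod_cast hε, fun y hy => hO y ?_⟩
      have := dist_triangle (p y) (p x) (p a)
      simp only at *
      linarith
  basis := h.isTopologicalBasis
  mem_iff := h.mem_ballMem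
  cover := h.cover

/-- Balls of small radius cover everything in `M`, so a prime family contains arbitrarily small
ones. Any two of its balls meet, hence the centres form a Cauchy sequence; a ball around the limit
contains one of the small balls. -/
theorem exists_point [CompleteSpace E] (F : Set (X × ℚ)) (hF : IsPrimeFamily (ballMem D) F) :
    ∃ e, ∀ b, e ∈ ballSet p b → b ∈ F := by
  have hsmall : ∀ n : ℕ, ∃ b ∈ F, (b.2 : ℝ) ≤ 1 / ((n : ℝ) + 1) := by
    intro n
    obtain ⟨b₀, hb₀⟩ := hF.nonempty
    obtain ⟨b, hb, hbF⟩ := hF.cover b₀ hb₀ (MSet.sep fun b => b.2 ≤ 1 / ((n : ℚ) + 1)) fun x _ =>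
      ⟨(x, 1 / ((n : ℚ) + 1)), le_refl (1 / ((n : ℚ) + 1)), by
        rw [h.mem_ballMem]
        simp only [dist_self]
        positivity⟩
    have hb' : b.2 ≤ 1 / ((n : ℚ) + 1) := hb
    refine ⟨b, hbF, ?_⟩
    have : ((b.2 : ℚ) : ℝ) ≤ ((1 / ((n : ℚ) + 1) : ℚ) : ℝ) := by exact_mod_cast hb'
    simpa using this
  choose b hbF hb using hsmall
  have hd : ∀ b₁ ∈ F, ∀ b₂ ∈ F, dist (p b₁.1) (p b₂.1) < b₁.2 + b₂.2 := by
    intro b₁ h₁ b₂ h₂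
    obtain ⟨b₃, h₃, hsub⟩ := hF.inter b₁ h₁ b₂ h₂
    obtain ⟨x, hx⟩ := hF.exists_mem h₃
    have := hsub x hx
    rw [h.mem_ballMem, h.mem_ballMem] at this
    have h' := dist_triangle_left (p b₁.1) (p b₂.1) (p x)
    linarith [this.1, this.2]
  have htend : Tendsto (fun n : ℕ => 2 * (1 / ((n : ℝ) + 1))) atTop (𝓝 0) := by
    simpa using tendsto_one_div_add_atTop_nhds_zero_nat.const_mul (2 : ℝ)
  obtain ⟨e, he⟩ := cauchySeq_tendsto_of_complete (u := fun n => p (b n).1)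
    (cauchySeq_of_le_tendsto_0 _ (fun n m N hn hm => by
      have h1 := hd _ (hbF n) _ (hbF m)
      have h2 := (hb n).trans (one_div_le_one_div_of_le (by positivity)
        (add_le_add_left (Nat.cast_le.2 hn) (1 : ℝ)))
      have h3 := (hb m).trans (one_div_le_one_div_of_le (by positivity)
        (add_le_add_left (Nat.cast_le.2 hm) (1 : ℝ)))
      linarith) htend)
  refine ⟨e, fun c hc => ?_⟩
  rw [mem_ballSet] at hc
  have hlim := (he.dist (tendsto_const_nhds (x := p c.1))).add htend
  rw [add_zero] at hlim
  obtain ⟨n, hn⟩ := (hlim.eventually_lt_const hc).exists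
  refine hF.mono _ (hbF n) c fun x hx => ?_
  rw [h.mem_ballMem] at hx ⊢
  have := dist_triangle (p x) (p (b n).1) (p c.1)
  have hpos : (0 : ℝ) ≤ 1 / ((n : ℝ) + 1) := by positivity
  linarith [hb n]

end InterpretedMetric

end

section

open TopologicalSpace Filter Topology

variable {M : Set ZFSet.{u}} [hM : Fact (IsTransitiveModel M)]

/-! ### The real line -/

variable (M) in
/-- The strict lower bounds of the distance of two reals of the model. -/
def realDist : MSet M (ℚ × (realSet M × realSet M)) :=
  MSet.sep fun t => ∃ r s : ℚ,
    (((r : ℝ) < realVal t.2.1 ∧ ¬ (s : ℝ) < realVal t.2.2) ∨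
      ((r : ℝ) < realVal t.2.2 ∧ ¬ (s : ℝ) < realVal t.2.1)) ∧ t.1 < r - s

theorem lt_sub_iff_exists_rat {q : ℚ} {a b : ℝ} :
    (q : ℝ) < a - b ↔ ∃ r s : ℚ, ((r : ℝ) < a ∧ ¬ (s : ℝ) < b) ∧ q < r - s := by
  constructor
  · intro h
    obtain ⟨s, hs, hs'⟩ := exists_rat_btwn (show b < a - q by linarith)
    obtain ⟨r, hr, hr'⟩ := exists_rat_btwn (show (s : ℝ) + q < a by linarith)
    refine ⟨r, s, ⟨hr', not_lt.2 hs.le⟩, ?_⟩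
    have : (s : ℝ) + q < r := hr
    have : s + q < r := by exact_mod_cast this
    linarith
  · rintro ⟨r, s, ⟨hr, hs⟩, h⟩
    have : (q : ℝ) < r - s := by exact_mod_cast h
    linarith [not_lt.1 hs]

theorem interpretedMetric_real : InterpretedMetric (realDist M) (realVal (M := M)) where
  mem_iff q x y := by
    rw [Real.dist_eq, lt_abs, neg_sub, lt_sub_iff_exists_rat, lt_sub_iff_exists_rat]
    change (∃ r s : ℚ, _) ↔ _
    simp only [or_and_right, exists_or]
  dense := by
    refine Metric.dense_iff.2 fun r ε hε => ?_
    obtain ⟨q, hq, hq'⟩ := exists_rat_btwn (show r < r + ε by linarith)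
    refine ⟨q, ?_, toRealSet q (ratCast_mem_realsIn M q), realVal_toRealSet _ _⟩
    rw [Metric.mem_ball, Real.dist_eq, abs_lt]
    constructor <;> linarith
  complete := by
    intro s hs hC
    obtain ⟨r, hr⟩ := cauchySeq_tendsto_of_complete hC
    -- The limit exists in `ℝ` by completeness; it belongs to `M` because its cut is definable from
    -- the sequence.
    have : DefPred M fun q : ℚ => (q : ℝ) < r := by
      refine DefPred.congr (φ := fun q : ℚ => ∃ (q' : ℚ) (N : ℕ), q < q' ∧ ∀ n : ℕ, ¬ n < N →
        (q' : ℝ) < realVal (s n)) inferInstance fun q => ?_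
      constructor
      · intro hq
        obtain ⟨q', hq', hr'⟩ := exists_rat_btwn hq
        obtain ⟨N, hN⟩ := eventually_atTop.1 (hr.eventually_const_lt hr')
        exact ⟨q', N, by exact_mod_cast hq', fun n hn => hN n (not_lt.1 hn)⟩
      · rintro ⟨q', N, hq, hN⟩
        refine lt_of_lt_of_le (Rat.cast_lt.2 hq) (ge_of_tendsto hr ?_)
        exact eventually_atTop.2 ⟨N, fun n hn => (hN n (not_lt.2 hn)).le⟩
    exact ⟨toRealSet r (realCode_mem r), by rwa [realVal_toRealSet]⟩

theorem extendsToInterpretation_real :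
    ExtendsToInterpretation M (realSet M) (realOpens M) (realVal (M := M)) :=
  ⟨_, (interpretedMetric_real.interpretedBasis (τ := realOpens M) fun O => by
    rw [realOpens, ZFSet.mem_sep, ZFSet.mem_powerset]
    simp only [Real.dist_eq]
    tauto).isInterpretation interpretedMetric_real.exists_point⟩

/-! ### Banach spaces of the model -/

/-- Scalar multiplication of `X` is defined only for reals of `M`, so comparing a scalar with a
rational approximation requires their difference to be in `M`. -/
theorem sub_mem_realsIn {r : ℝ} (hr : r ∈ realsIn M) (q : ℚ) : r - q ∈ realsIn M := by
  have hr : realCode r ∈ M := hr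
  have : DefPred M fun p : ℚ => (p : ℝ) < r - q :=
    DefPred.congr (φ := fun p : ℚ => ((p + q : ℚ) : ℝ) < realVal (toRealSet (M := M) r hr)) inferInstance
      fun p => by
        rw [realVal_toRealSet]
        push_cast
        constructor <;> intro h <;> linarith
  exact realCode_mem (M := M) (r - q)

namespace BanachIn

variable (X : BanachIn M)

instance : Fact (X.carrier ∈ M) := ⟨X.carrier_mem⟩

/-- A rational number as a scalar of the model. -/
def ratScalar (q : ℚ) : realsIn M := ⟨q, ratCast_mem_realsIn M q⟩

omit hM in
theorem smul_of_zero (r : realsIn M) (hr : (r : ℝ) = 0) (x : X.carrier) : X.smul r x = 0 := by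
  rw [← X.norm_eq_zero, X.norm_smul, hr]
  simp

instance ratModule : Module ℚ X.carrier where
  smul q x := X.smul (ratScalar q) x
  one_smul x := X.one_smul _ x (by simp [ratScalar])
  mul_smul p q x := X.mul_smul _ _ _ x (by simp [ratScalar])
  smul_zero q := by
    have := X.smul_add (ratScalar q) 0 0
    rw [add_zero] at this
    exact left_eq_add.1 this
  smul_add q x y := X.smul_add _ x y
  add_smul p q x := X.add_smul _ _ _ x (by simp [ratScalar])
  zero_smul x := X.smul_of_zero _ (by simp [ratScalar]) x

theorem norm_rat_smul (q : ℚ) (x : X.carrier) : X.norm (q • x) = |(q : ℝ)| * X.norm x :=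
  X.norm_smul _ x

theorem norm_neg (x : X.carrier) : X.norm (-x) = X.norm x := by
  rw [← neg_one_smul ℚ x, norm_rat_smul]
  simp

theorem norm_nonneg (x : X.carrier) : 0 ≤ X.norm x := by
  have h := X.norm_add_le x (-x)
  rw [add_neg_cancel, (X.norm_eq_zero 0).2 rfl, norm_neg] at h
  linarith

theorem norm_smul_sub (r : realsIn M) (q : ℚ) (x : X.carrier) :
    X.norm (X.smul r x - q • x) = |(r : ℝ) - q| * X.norm x := by
  let t : realsIn M := ⟨r - q, sub_mem_realsIn r.2 q⟩
  have : X.smul r x = X.smul t x + q • x := X.add_smul t (ratScalar q) r x (by simp [t, ratScalar])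
  rw [this, add_sub_cancel_right, X.norm_smul]

/-- An additive contraction into a real normed space commutes with the scalars of the model. -/
theorem map_smul_of_additive {F : Type v} [SeminormedAddCommGroup F] [NormedSpace ℝ F]
    (f : X.carrier →+ F) (hf : ∀ x, ‖f x‖ ≤ X.norm x) (r : realsIn M) (x : X.carrier) :
    ‖f (X.smul r x) - (r : ℝ) • f x‖ = 0 := by
  refine le_antisymm (le_of_forall_pos_le_add fun ε hε => ?_) (_root_.norm_nonneg _)
  have hpos : 0 < 2 * X.norm x + 1 := by linarith [X.norm_nonneg x]
  obtain ⟨q, hq, hq'⟩ := exists_rat_btwn (show (r : ℝ) < r + ε / (2 * X.norm x + 1) by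
    linarith [div_pos hε hpos])
  have habs : |(r : ℝ) - q| ≤ ε / (2 * X.norm x + 1) := by
    rw [abs_le]
    constructor <;> linarith
  -- Rational scalars pass through `f` by additivity. The two error terms that remain are each at
  -- most `|r - q|` times the norm of `x`.
  have e : f (X.smul r x) - (r : ℝ) • f x =
      f (X.smul r x - q • x) + ((q : ℝ) - r) • f x := by
    have : f (q • x) = (q : ℝ) • f x := by simpa using map_ratCast_smul f ℚ ℝ q x
    rw [map_sub, this, sub_smul]
    abel
  rw [e, zero_add]
  calc _ ≤ ‖f (X.smul r x - q • x)‖ + ‖((q : ℝ) - r) • f x‖ := _root_.norm_add_le _ _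
    _ ≤ |(r : ℝ) - q| * X.norm x + |(r : ℝ) - q| * X.norm x := by
        refine add_le_add ((hf _).trans (X.norm_smul_sub r q x).le) ?_
        rw [_root_.norm_smul, Real.norm_eq_abs, abs_sub_comm]
        exact mul_le_mul_of_nonneg_left (hf x) (abs_nonneg _)
    _ = |(r : ℝ) - q| * (2 * X.norm x) := by ring
    _ ≤ ε / (2 * X.norm x + 1) * (2 * X.norm x + 1) := by
        refine mul_le_mul habs (by linarith) (by linarith [X.norm_nonneg x]) (by positivity)
    _ = ε := div_mul_cancel₀ _ hpos.ne'

variable {A : Type w} [Coded M A] {X}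

instance defFun_add {f g : A → X.carrier} [DefFun M f] [DefFun M g] :
    DefFun M fun a => f a + g a := by
  refine .of_pred (DefPred.congr (φ := fun t : A × X.carrier =>
    (code ((f t.1, g t.1), t.2) : M).1 ∈ (code (⟨_, X.add_mem⟩ : M) : M).1) inferInstance fun t => ?_)
  change _ ↔ ZFSet.pair (ZFSet.pair (f t.1).1 (g t.1).1) t.2.1 ∈ ZFSet.range _
  simp only [ZFSet.mem_range, ZFSet.pair_inj]
  constructor
  · intro h
    exact ⟨(f t.1, g t.1), ⟨rfl, rfl⟩, congrArg Subtype.val h⟩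
  · rintro ⟨⟨x, y⟩, ⟨h1, h2⟩, h3⟩
    rw [← Subtype.ext h1, ← Subtype.ext h2]
    exact Subtype.ext h3

instance defFun_neg {f : A → X.carrier} [DefFun M f] : DefFun M fun a => - f a := by
  refine .of_pred (DefPred.congr (φ := fun t : A × X.carrier => f t.1 + t.2 = 0) inferInstance
    fun t => ?_)
  rw [add_eq_zero_iff_neg_eq]

instance defFun_sub {f g : A → X.carrier} [DefFun M f] [DefFun M g] :
    DefFun M fun a => f a - g a := by
  simp only [sub_eq_add_neg]
  infer_instance

instance defPred_lt_norm {f : A → ℚ} {g : A → X.carrier} [DefFun M f] [DefFun M g] :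
    DefPred M fun a => (f a : ℝ) < X.norm (g a) := by
  refine DefPred.congr (φ := fun a => ∃ c : M,
    (code (g a, c) : M).1 ∈ (code (⟨_, X.norm_mem⟩ : M) : M).1 ∧ (code (f a) : M).1 ∈ (code c : M).1)
    inferInstance fun a => ?_
  have key : ∀ c : M, ZFSet.pair (g a).1 c.1 ∈ (ZFSet.range fun x : X.carrier =>
      ZFSet.pair x.1 (realCode (X.norm x))) ↔ c.1 = realCode (X.norm (g a)) := by
    intro c
    simp only [ZFSet.mem_range, ZFSet.pair_inj]
    constructor
    · rintro ⟨x, h1, h2⟩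
      rw [← h2, Subtype.ext h1]
    · intro h
      exact ⟨g a, rfl, h.symm⟩
  change _ ↔ ∃ c : M, ZFSet.pair (g a).1 c.1 ∈ _ ∧ ratCode (f a) ∈ c.1
  refine Iff.trans ?_ (exists_congr fun c => and_congr_left fun _ => key c).symm
  rw [← ratCode_mem_realCode]
  constructor
  · intro h
    have hp : ZFSet.pair (g a).1 (realCode (X.norm (g a))) ∈ M :=
      mem_of_mem X.norm_mem (ZFSet.mem_range.2 ⟨g a, rfl⟩)
    exact ⟨⟨_, right_mem_of_pair_mem hp⟩, rfl, h⟩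
  · rintro ⟨c, hc, h⟩
    rwa [hc] at h

variable (X) in
/-- The strict lower bounds of the distance of two vectors. -/
def dist : MSet M (ℚ × (X.carrier × X.carrier)) :=
  MSet.sep fun t => (t.1 : ℝ) < X.norm (t.2.1 - t.2.2)

theorem seq_mem (s : ℕ → X.carrier) [DefFun M s] :
    (ZFSet.range fun n : ℕ => ZFSet.pair (natCode n) (s n).1) ∈ M := by
  convert! (MSet.sep (fun t : ℕ × X.carrier => s t.1 = t.2) : MSet M (ℕ × X.carrier)).toM.2
  ext z
  rw [ZFSet.mem_range]
  constructor
  · rintro ⟨n, rfl⟩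
    exact MSet.code_mem_toM (a := (n, s n)).2 rfl
  · intro hz
    obtain ⟨⟨n, x⟩, hx, e⟩ := MSet.mem_toM (x := ⟨z, mem_of_mem (MSet.toM _).2 hz⟩).1 hz
    obtain rfl : s n = x := hx
    exact ⟨n, congrArg (fun z : M => z.1) e⟩

omit hM in
theorem mem_opens {O : ZFSet.{u}} : O ∈ X.opens ↔ (O ∈ M ∧ O ⊆ X.carrier) ∧ ∀ x : X.carrier, x.1 ∈ O →
    ∃ ε : ℚ, 0 < ε ∧ ∀ y : X.carrier, X.norm (y - x) < ε → y.1 ∈ O := by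
  rw [opens, ZFSet.mem_sep, ZFSet.mem_powerset]
  tauto

/-- An additive isometry with dense range in a normed group interprets the metric space `X`. -/
theorem interpretedMetric {E : Type v} [NormedAddCommGroup E] {p : X.carrier → E}
    (hadd : ∀ x y, p (x + y) = p x + p y) (hnorm : ∀ x, ‖p x‖ = X.norm x) (hp : DenseRange p) :
    (∀ x y, Dist.dist (p x) (p y) = X.norm (x - y)) ∧ InterpretedMetric X.dist p := by
  have hd : ∀ x y, Dist.dist (p x) (p y) = X.norm (x - y) := fun x y => by
    rw [dist_eq_norm, ← hnorm]
    exact congrArg _ (map_sub (⟨⟨p, by simpa using hadd 0 0⟩, hadd⟩ : X.carrier →+ E) x y).symm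
  refine ⟨hd, fun q x y => ?_, hp, fun s hs hC => ?_⟩
  · rw [hd]
    rfl
  · obtain ⟨x, hx⟩ := X.complete s (seq_mem s) fun ε hε => by
      obtain ⟨N, hN⟩ := Metric.cauchySeq_iff.1 hC ε (by exact_mod_cast hε)
      exact ⟨N, fun m hm n hn => by simpa only [← hd, Function.comp_apply] using hN m hm n hn⟩
    refine ⟨x, Metric.tendsto_atTop.2 fun ε hε => ?_⟩
    obtain ⟨q, hq, hqε⟩ := exists_rat_btwn hε
    obtain ⟨N, hN⟩ := hx q (by exact_mod_cast hq)
    refine ⟨N, fun n hn => ?_⟩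
    rw [Function.comp_apply, hd]
    exact (hN n hn).trans hqε

theorem interpretedBasis {E : Type v} [NormedAddCommGroup E] {p : X.carrier → E}
    (hadd : ∀ x y, p (x + y) = p x + p y) (hnorm : ∀ x, ‖p x‖ = X.norm x) (hp : DenseRange p) :
    InterpretedBasis (ballMem X.dist) X.opens p (ballSet p) := by
  obtain ⟨hd, h⟩ := interpretedMetric hadd hnorm hp
  refine h.interpretedBasis fun O => ?_
  simp only [hd]
  exact mem_opens

end BanachIn

end

section

open TopologicalSpace Filter Topology

/-! ### Real scalars on a completion -/

section RatCompletion

variable (C : Type v) [NormedAddCommGroup C] [NormedSpace ℚ C] [CompleteSpace C]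

variable {C} in
/-- The multiples of a vector by real scalars, obtained as limits of its rational multiples. -/
def realMultiple (c : C) : ℝ →L[ℚ] C :=
  (LinearMap.toSpanSingleton ℚ C c).extendOfNorm (Algebra.linearMap ℚ ℝ)

theorem denseRange_linearMap_rat : DenseRange (Algebra.linearMap ℚ ℝ) :=
  Rat.isDenseEmbedding_coe_real.dense

omit [CompleteSpace C] in
theorem norm_toSpanSingleton_le (c : C) (q : ℚ) :
    ‖LinearMap.toSpanSingleton ℚ C c q‖ ≤ ‖c‖ * ‖Algebra.linearMap ℚ ℝ q‖ := by
  rw [LinearMap.toSpanSingleton_apply, norm_smul, mul_comm]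
  simp

variable {C} in
theorem realMultiple_ratCast (c : C) (q : ℚ) : realMultiple c q = q • c :=
  LinearMap.extendOfNorm_eq denseRange_linearMap_rat ⟨_, norm_toSpanSingleton_le C c⟩ q

/-- Two continuous functions of a real variable agree if they agree at the rational numbers. -/
theorem eq_of_eq_ratCast {Y : Type w} [TopologicalSpace Y] [T2Space Y] {f g : ℝ → Y}
    (hf : Continuous f) (hg : Continuous g) (h : ∀ q : ℚ, f q = g q) (r : ℝ) : f r = g r :=
  congrFun (Rat.isDenseEmbedding_coe_real.dense.equalizer hf hg (funext h)) r

/-- A complete normed space over the rational numbers is a normed space over the real numbers. -/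
@[reducible]
def normedSpaceOfRat : NormedSpace ℝ C where
  smul r c := realMultiple c r
  one_smul c := by
    have := realMultiple_ratCast c 1
    rwa [Rat.cast_one, one_smul] at this
  mul_smul r s c := by
    change realMultiple c (r * s) = realMultiple (realMultiple c s) r
    refine eq_of_eq_ratCast ((realMultiple c).continuous.comp (continuous_mul_const s))
      (realMultiple _).continuous (fun q => ?_) r
    rw [realMultiple_ratCast, ← map_smul, Rat.smul_def]
    rfl
  smul_zero r := by
    change realMultiple (0 : C) r = 0
    refine eq_of_eq_ratCast (realMultiple _).continuous continuous_const (fun q => ?_) r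
    rw [realMultiple_ratCast, smul_zero]
  smul_add r c d := by
    change realMultiple (c + d) r = realMultiple c r + realMultiple d r
    refine eq_of_eq_ratCast (realMultiple _).continuous
      ((realMultiple c).continuous.add (realMultiple d).continuous) (fun q => ?_) r
    rw [realMultiple_ratCast, smul_add, ← realMultiple_ratCast, ← realMultiple_ratCast]
    rfl
  add_smul r s c := map_add (realMultiple c) r s
  zero_smul c := map_zero (realMultiple c)
  norm_smul_le r c := by
    rw [mul_comm]
    exact LinearMap.norm_extendOfNorm_apply_le denseRange_linearMap_rat _
      (norm_toSpanSingleton_le C c) r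

end RatCompletion

variable {M : Set ZFSet.{u}} [hM : Fact (IsTransitiveModel M)]

/-! ### The completion of a Banach space of the model -/

namespace BanachIn

variable (X : BanachIn M)

/-- The norm of `X`, as a group norm. -/
def groupNorm : AddGroupNorm X.carrier where
  toFun := X.norm
  map_zero' := (X.norm_eq_zero 0).2 rfl
  add_le' := X.norm_add_le
  neg' := X.norm_neg
  eq_zero_of_map_eq_zero' := fun x => (X.norm_eq_zero x).1

instance (priority := low) : NormedAddCommGroup X.carrier :=
  { X.groupNorm.toNormedAddCommGroup with
    toAddCommGroup := X.group
    toNorm := ⟨X.norm⟩ }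

theorem norm_def (x : X.carrier) : ‖x‖ = X.norm x := rfl

instance : NormedSpace ℚ X.carrier where
  norm_smul_le q x := by
    rw [norm_def, norm_rat_smul]
    exact le_rfl

/-- The completion of `X`. -/
abbrev completion : Type (u + 1) := UniformSpace.Completion X.carrier

instance : NormedSpace ℝ X.completion := normedSpaceOfRat X.completion

theorem preservesStructure_coe : X.PreservesStructure ((↑) : X.carrier → X.completion) where
  map_add x y := UniformSpace.Completion.coe_add x y
  map_smul r x := by
    refine sub_eq_zero.1 (_root_.norm_eq_zero.1 (X.map_smul_of_additive
      UniformSpace.Completion.toCompl (fun x => ?_) r x))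
    exact (UniformSpace.Completion.norm_coe x).le
  norm_map x := UniformSpace.Completion.norm_coe x

variable {X}

/-- An additive contraction on `X` extends to every normed space in which `X` is dense. -/
theorem PreservesStructure.exists_extension {E : Type v} [NormedAddCommGroup E] [NormedSpace ℝ E]
    {p : X.carrier → E} (hp : X.PreservesStructure p) (hd : DenseRange p) {f : X.carrier → ℝ}
    (hadd : ∀ x y, f (x + y) = f x + f y) (hf : ∀ x, |f x| ≤ X.norm x) :
    ∃ g : weakStarBall E, ∀ x, g.1 (p x) = f x := by
  let := NormedSpace.restrictScalars ℚ ℝ E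
  let p' : X.carrier →ₗ[ℚ] E := (AddMonoidHom.mk' p hp.map_add).toRatLinearMap
  let f' : X.carrier →ₗ[ℚ] ℝ := (AddMonoidHom.mk' f hadd).toRatLinearMap
  have hb : ∀ x, ‖f' x‖ ≤ 1 * ‖p' x‖ := fun x => by
    rw [one_mul, Real.norm_eq_abs]
    exact (hf x).trans (hp.norm_map x).ge
  have hd' : DenseRange p' := hd
  let g := f'.extendOfNorm p'
  -- The extension by density is linear over `ℚ` only; continuity makes it real-linear.
  let g' : StrongDual ℝ E := (g : E →+ ℝ).toRealLinearMap g.continuous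
  refine ⟨⟨StrongDual.toWeakDual g', ?_⟩, fun x => LinearMap.extendOfNorm_eq hd' ⟨1, hb⟩ x⟩
  change WeakDual.toStrongDual _ ∈ Metric.closedBall 0 1
  rw [mem_closedBall_zero_iff]
  exact ContinuousLinearMap.opNorm_le_bound g' zero_le_one
    (LinearMap.norm_extendOfNorm_apply_le hd' 1 hb)

end BanachIn

end

section

open TopologicalSpace Filter Topology

variable {M : Set ZFSet.{u}} [hM : Fact (IsTransitiveModel M)]

/-! ### The dual ball of the model -/

theorem lt_add_iff_exists_rat {q : ℚ} {a b : ℝ} :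
    (q : ℝ) < a + b ↔ ∃ s t : ℚ, ((s : ℝ) < a ∧ (t : ℝ) < b) ∧ q < s + t := by
  constructor
  · intro h
    obtain ⟨s, hs, hs'⟩ := exists_rat_btwn (show (q : ℝ) - b < a by linarith)
    obtain ⟨t, ht, ht'⟩ := exists_rat_btwn (show (q : ℝ) - s < b by linarith)
    refine ⟨s, t, ⟨hs', ht'⟩, ?_⟩
    have : (q : ℝ) < s + t := by linarith
    exact_mod_cast this
  · rintro ⟨s, t, ⟨hs, ht⟩, h⟩
    have : (q : ℝ) < s + t := by exact_mod_cast h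
    linarith

theorem real_ext {a b : ℝ} (h : ∀ q : ℚ, (q : ℝ) < a ↔ (q : ℝ) < b) : a = b := by
  refine le_antisymm (le_of_forall_rat_lt_imp_le fun q hq => ((h q).1 hq).le)
    (le_of_forall_rat_lt_imp_le fun q hq => ((h q).2 hq).le)

variable (M) in
/-- Addition of the reals of the model. -/
def realAdd : MSet M ((realSet M × realSet M) × realSet M) :=
  MSet.sep fun t => ∀ q : ℚ, (q : ℝ) < realVal t.2 ↔
    ∃ r s : ℚ, ((r : ℝ) < realVal t.1.1 ∧ (s : ℝ) < realVal t.1.2) ∧ q < r + s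

theorem mem_realAdd {c c' d : realSet M} :
    ((c, c'), d) ∈ realAdd M ↔ realVal d = realVal c + realVal c' := by
  change (∀ q : ℚ, _) ↔ _
  simp only [← lt_add_iff_exists_rat]
  exact ⟨real_ext, fun h q => by rw [h]⟩

namespace BanachIn

variable {X : BanachIn M}

/-- Homogeneity follows from additivity and boundedness by rational approximation, and the lower
bound from oddness. The remaining two conditions are those which finite clauses on strict lower
bounds can express. -/
theorem isUnitFunctional_iff {f : X.carrier → ℝ} :
    X.IsUnitFunctional f ↔ (∀ x y, f (x + y) = f x + f y) ∧ ∀ x, f x ≤ X.norm x := by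
  constructor
  · intro h
    exact ⟨h.map_add, fun x => (le_abs_self _).trans (h.bound x)⟩
  · rintro ⟨h₁, h₂⟩
    have hb : ∀ x, |f x| ≤ X.norm x := fun x => by
      refine abs_le'.2 ⟨h₂ x, ?_⟩
      have : f (-x) = -f x := map_neg (AddMonoidHom.mk' f h₁) x
      rw [← this, ← norm_neg]
      exact h₂ _
    exact ⟨h₁, fun r x => sub_eq_zero.1 (_root_.norm_eq_zero.1
      (X.map_smul_of_additive (AddMonoidHom.mk' f h₁) hb r x)), hb⟩

omit hM in
theorem mem_graph {f : X.carrier → ℝ} {x : X.carrier} {z : ZFSet.{u}} :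
    ZFSet.pair x.1 z ∈ X.graph f ↔ z = realCode (f x) := by
  rw [graph, ZFSet.mem_range]
  simp only [ZFSet.pair_inj]
  constructor
  · rintro ⟨x', h1, h2⟩
    rw [← h2, Subtype.ext h1]
  · intro h
    exact ⟨x, rfl, h.symm⟩

omit hM in
theorem graph_injective : Function.Injective X.graph := by
  intro f g h
  funext x
  have : ZFSet.pair x.1 (realCode (f x)) ∈ X.graph g := h ▸ mem_graph.2 rfl
  exact realCode_injective (mem_graph.1 this)

theorem realCode_mem_of_graph_mem {f : X.carrier → ℝ} (hf : X.graph f ∈ M) (x : X.carrier) :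
    realCode (f x) ∈ M :=
  right_mem_of_pair_mem (mem_of_mem hf ((mem_graph (x := x)).2 rfl))

theorem toM_eq_graph {G : MSet M (X.carrier × realSet M)} {f : X.carrier → ℝ}
    (hf : ∀ x, realCode (f x) ∈ M) (hG : ∀ x c, (x, c) ∈ G ↔ realVal c = f x) :
    G.toM.1 = X.graph f := by
  ext z
  constructor
  · intro hz
    obtain ⟨⟨x, c⟩, h, e⟩ := MSet.mem_toM (x := ⟨z, mem_of_mem G.toM.2 hz⟩).1 hz
    have e' : ZFSet.pair x.1 c.1 = z := congrArg (fun z : M => z.1) e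
    rw [← e', mem_graph, ← (hG x c).1 h, realCode_realVal]
  · intro hz
    obtain ⟨x, rfl⟩ := ZFSet.mem_range.1 hz
    exact MSet.code_mem_toM.2 ((hG x (toRealSet _ (hf x))).2 (realVal_toRealSet _ _))

theorem exists_graph {f : X.carrier → ℝ} (hf : X.graph f ∈ M) :
    ∃ G : MSet M (X.carrier × realSet M), ∀ x c, (x, c) ∈ G ↔ realVal c = f x := by
  refine ⟨MSet.sep fun t => (code t : M).1 ∈ (code (⟨_, hf⟩ : M) : M).1, fun x c => ?_⟩
  change ZFSet.pair x.1 c.1 ∈ X.graph f ↔ _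
  rw [mem_graph, ← realCode_realVal, realCode_injective.eq_iff]

/-- The cuts of the values are definable uniformly in `x`, so separation in `X × ℝ` gives the graph.
-/
theorem graph_mem (f : X.carrier → ℝ) [h : DefPred M fun t : X.carrier × ℚ => (t.2 : ℝ) < f t.1] :
    X.graph f ∈ M := by
  have hf : ∀ x, realCode (f x) ∈ M := fun x => by
    have : DefPred M fun q : ℚ => (q : ℝ) < f x :=
      DefPred.app (φ := fun t : X.carrier × ℚ => (t.2 : ℝ) < f t.1) (f := fun q => (x, q))
    exact realCode_mem (f x)
  have : DefPred M fun a : (X.carrier × realSet M) × ℚ => (a.2 : ℝ) < f a.1.1 :=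
    DefPred.app (φ := fun t : X.carrier × ℚ => (t.2 : ℝ) < f t.1)
      (f := fun a : (X.carrier × realSet M) × ℚ => (a.1.1, a.2))
  rw [← toM_eq_graph (G := MSet.sep fun t : X.carrier × realSet M =>
    ∀ q : ℚ, (q : ℝ) < realVal t.2 ↔ (q : ℝ) < f t.1) hf fun x c =>
      ⟨real_ext, fun h q => by simp only [h]⟩]
  exact MSet.toM _ |>.2

variable (X) in
/-- The elements of the dual ball, as sets of pairs. -/
def dualBallGraphs : MSet M (MSet M (X.carrier × realSet M)) :=
  MSet.sep fun G => (∀ x, ∃ c, (x, c) ∈ G) ∧ (∀ x c c', (x, c) ∈ G → (x, c') ∈ G → c = c') ∧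
    (∀ x x' c c' d, (x, c) ∈ G → (x', c') ∈ G → (x + x', d) ∈ G →
      ((c, c'), d) ∈ realAdd M) ∧
    ∀ (x : X.carrier) c (q : ℚ), (x, c) ∈ G → (q : ℝ) < realVal c → (q : ℝ) < X.norm x

theorem mem_dualBallGraphs {G : MSet M (X.carrier × realSet M)} {f : X.carrier → ℝ}
    (hf : ∀ x, realCode (f x) ∈ M) (hG : ∀ x c, (x, c) ∈ G ↔ realVal c = f x) :
    G ∈ X.dualBallGraphs ↔ X.IsUnitFunctional f := by
  have hr : ∀ x, ∃ c : realSet M, realVal c = f x := fun x =>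
    ⟨toRealSet _ (hf x), realVal_toRealSet _ _⟩
  rw [isUnitFunctional_iff]
  change (_ ∧ _ ∧ _ ∧ _) ↔ _
  simp only [hG]
  constructor
  · rintro ⟨-, -, h₁, h₂⟩
    constructor
    · intro x y
      obtain ⟨c, hc⟩ := hr x
      obtain ⟨d, hd⟩ := hr y
      obtain ⟨e, he⟩ := hr (x + y)
      rw [← hc, ← hd, ← he]
      exact mem_realAdd.1 (h₁ x y c d e hc hd he)
    · intro x
      obtain ⟨c, hc⟩ := hr x
      refine le_of_forall_rat_lt_imp_le fun q hq => (h₂ x c q hc ?_).le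
      rwa [hc]
  · rintro ⟨h₁, h₂⟩
    refine ⟨hr, fun x c c' hc hc' => realVal_injective (hc.trans hc'.symm), ?_, ?_⟩
    · rintro x x' c c' d hc hc' hd
      rw [mem_realAdd, hc, hc', hd, h₁]
    · rintro x c q hc hq
      rw [hc] at hq
      exact lt_of_lt_of_le hq (h₂ x)

theorem dualBall_mem : X.dualBall ∈ M := by
  convert! X.dualBallGraphs.toM.2
  ext z
  rw [dualBall, ZFSet.mem_range]
  constructor
  · rintro ⟨⟨f, hf, hfM⟩, rfl⟩
    have hr := realCode_mem_of_graph_mem hfM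
    obtain ⟨G, hG⟩ := exists_graph hfM
    have := MSet.code_mem_toM.2 ((mem_dualBallGraphs hr hG).2 hf)
    change G.toM.1 ∈ _ at this
    rwa [toM_eq_graph hr hG] at this
  · intro hz
    obtain ⟨G, hG, e⟩ := MSet.mem_toM (x := ⟨z, mem_of_mem (MSet.toM _).2 hz⟩).1 hz
    have e' : G.toM.1 = z := congrArg (fun z : M => z.1) e
    choose c hc using hG.1
    have hG' : ∀ x d, (x, d) ∈ G ↔ realVal d = realVal (c x) := fun x d => by
      rw [realVal_injective.eq_iff]
      exact ⟨fun hd => hG.2.1 x d (c x) hd (hc x), fun hd => hd ▸ hc x⟩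
    have hr : ∀ x, realCode (realVal (c x)) ∈ M := fun x => by
      rw [realCode_realVal]
      exact mem_of_mem (realSet_mem M) (c x).2
    have e'' := toM_eq_graph hr hG'
    refine ⟨⟨fun x => realVal (c x), (mem_dualBallGraphs hr hG').1 hG, ?_⟩, e''.symm.trans e'⟩
    rw [← e'']
    exact G.toM.2

instance : Fact (X.dualBall ∈ M) := ⟨dualBall_mem⟩

omit hM in
theorem isUnitFunctional_eval (y : X.dualBall) : X.IsUnitFunctional (X.eval y) :=
  (Classical.choose_spec (X.exists_of_dualBall y)).1.1

theorem eval_mem_realsIn (y : X.dualBall) (x : X.carrier) : realCode (X.eval y x) ∈ M := by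
  refine realCode_mem_of_graph_mem ?_ x
  rw [X.graph_eval]
  exact mem_of_mem dualBall_mem y.2

theorem exists_eval (f : X.carrier → ℝ) (hadd : ∀ x y, f (x + y) = f x + f y)
    (hb : ∀ x, f x ≤ X.norm x) [DefPred M fun t : X.carrier × ℚ => (t.2 : ℝ) < f t.1] :
    ∃ y, X.eval y = f := by
  let y : X.dualBall := ⟨X.graph f, ZFSet.mem_range.2
    ⟨⟨f, isUnitFunctional_iff.2 ⟨hadd, hb⟩, graph_mem f⟩, rfl⟩⟩
  exact ⟨y, graph_injective (X.graph_eval y)⟩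

instance defPred_lt_eval {A : Type w} [Coded M A] {f : A → ℚ} {g : A → X.dualBall}
    {h : A → X.carrier} [DefFun M f] [DefFun M g] [DefFun M h] :
    DefPred M fun a => (f a : ℝ) < X.eval (g a) (h a) := by
  refine DefPred.congr (φ := fun a => ∃ c : M, (code (h a, c) : M).1 ∈ (code (g a) : M).1 ∧
    (code (f a) : M).1 ∈ (code c : M).1) inferInstance fun a => ?_
  change _ ↔ ∃ c : M, ZFSet.pair (h a).1 c.1 ∈ (g a).1 ∧ ratCode (f a) ∈ c.1
  simp only [← X.graph_eval (g a), mem_graph]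
  rw [← ratCode_mem_realCode]
  constructor
  · intro hq
    exact ⟨⟨_, eval_mem_realsIn _ _⟩, rfl, hq⟩
  · rintro ⟨c, hc, hq⟩
    rwa [hc] at hq

end BanachIn

/-! ### Products -/

section

variable {X Y : ZFSet.{u}}

theorem pair_mem_prod_iff {x : X} {y : Y} : ZFSet.pair x.1 y.1 ∈ X.prod Y := by
  rw [ZFSet.pair_mem_prod]
  exact ⟨x.2, y.2⟩

/-- A point of the product, given by its coordinates. -/
def prodMk (x : X) (y : Y) : X.prod Y := ⟨ZFSet.pair x.1 y.1, pair_mem_prod_iff⟩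

theorem coords_prodMk (x : X) (y : Y) : coords (prodMk x y) = (x, y) := by
  have := pair_coords (prodMk x y)
  change ZFSet.pair x.1 y.1 = _ at this
  rw [ZFSet.pair_inj] at this
  exact Prod.ext (Subtype.ext this.1.symm) (Subtype.ext this.2.symm)

variable [Fact (X ∈ M)] [Fact (Y ∈ M)]

instance fact_prod_mem : Fact (X.prod Y ∈ M) := by
  refine ⟨?_⟩
  convert! (MSet.sep fun _ : X × Y => True : MSet M (X × Y)).toM.2
  ext z
  rw [ZFSet.mem_prod]
  constructor
  · rintro ⟨a, ha, b, hb, rfl⟩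
    exact MSet.code_mem_toM (a := ((⟨a, ha⟩, ⟨b, hb⟩) : X × Y)).2 trivial
  · intro hz
    obtain ⟨⟨x, y⟩, -, e⟩ := MSet.mem_toM (x := ⟨z, mem_of_mem (MSet.toM _).2 hz⟩).1 hz
    exact ⟨x.1, x.2, y.1, y.2, (congrArg (fun z : M => z.1) e).symm⟩

instance defFun_coords {A : Type w} [Coded M A] {f : A → X.prod Y} [DefFun M f] :
    DefFun M fun a => coords (f a) := by
  have : DefFun M (coords : X.prod Y → X × Y) := .of_code fun z => Subtype.ext (pair_coords z).symm
  exact DefFun.app (g := coords)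

end

end

section

open TopologicalSpace Filter Topology

variable {M : Set ZFSet.{u}} [hM : Fact (IsTransitiveModel M)]

/-! ### The weak-star topology of the dual ball -/

theorem exists_rat_pos_forall_lt {ι : Type w} (t : Finset ι) (f : ι → ℝ) (hf : ∀ i ∈ t, 0 < f i) :
    ∃ ε : ℚ, 0 < ε ∧ ∀ i ∈ t, (ε : ℝ) < f i := by
  classical
  induction t using Finset.induction_on with
  | empty => exact ⟨1, one_pos, by simp⟩
  | insert i t _ ih =>
    obtain ⟨ε, hε, h⟩ := ih fun j hj => hf j (Finset.mem_insert_of_mem hj)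
    obtain ⟨δ, hδ, hδ'⟩ := exists_rat_btwn (hf i (Finset.mem_insert_self i t))
    refine ⟨min ε δ, lt_min hε (by exact_mod_cast hδ), fun j hj => ?_⟩
    rw [Rat.cast_min]
    rcases Finset.mem_insert.1 hj with rfl | hj
    · exact lt_of_le_of_lt (min_le_right _ _) hδ'
    · exact lt_of_le_of_lt (min_le_left _ _) (h j hj)

namespace BanachIn

variable {X : BanachIn M}

/-- A function whose rational lower bounds are given by a prime additive relation is additive. -/
theorem exists_additive (S : Set (X.carrier × ℚ))
    (hb : ∀ x (q : ℚ), (x, q) ∈ S → (q : ℝ) ≤ X.norm x)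
    (hadd : ∀ x y (p q : ℚ), (x, p) ∈ S → (y, q) ∈ S → (x + y, p + q) ∈ S)
    (hneg : ∀ x (p q : ℚ), p < q → (x, p) ∈ S ∨ (-x, -q) ∈ S) :
    ∃ f : X.carrier → ℝ, (∀ x y, f (x + y) = f x + f y) ∧ (∀ x, f x ≤ X.norm x) ∧
      -- The value at `x` is the supremum of the `q` with `(x, q) ∈ S`; passing to a strictly larger
      -- `q'` makes the cut open without any assumption of monotonicity on `S`.
      ∀ x (q : ℚ), (q : ℝ) < f x ↔ ∃ q', q < q' ∧ (x, q') ∈ S := by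
  have hcut : ∀ x, ∃ r : ℝ, ∀ q : ℚ, q ∈ {q | ∃ q', q < q' ∧ (x, q') ∈ S} ↔ (q : ℝ) < r := by
    intro x
    refine exists_real_cut _ ?_ ?_ ?_ ?_
    · obtain ⟨q, hq⟩ := exists_rat_lt (-X.norm x)
      refine ⟨q - 1 - 1, q - 1, by linarith, ?_⟩
      rcases hneg x (q - 1) q (by linarith) with h | h
      · exact h
      · have := hb _ _ h
        rw [norm_neg] at this
        push_cast at this
        linarith
    · obtain ⟨q, hq⟩ := exists_rat_gt (X.norm x)
      refine ⟨q, ?_⟩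
      rintro ⟨q', hq', h⟩
      have h1 := hb _ _ h
      have h2 : (q : ℝ) < q' := by exact_mod_cast hq'
      linarith
    · rintro q ⟨q', hq', h⟩ p hp
      exact ⟨q', hp.trans hq', h⟩
    · rintro q ⟨q', hq', h⟩
      obtain ⟨p, hp, hp'⟩ := exists_between hq'
      exact ⟨p, ⟨q', hp', h⟩, hp⟩
  choose f hf using hcut
  have hf' : ∀ x (q : ℚ), (q : ℝ) < f x ↔ ∃ q', q < q' ∧ (x, q') ∈ S := fun x q => (hf x q).symm
  have hle : ∀ x, f x ≤ X.norm x := fun x => le_of_forall_rat_lt_imp_le fun q hq => by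
    obtain ⟨q', hq', h⟩ := (hf' x q).1 hq
    exact (Rat.cast_le.2 hq'.le).trans (hb _ _ h)
  -- `hadd` gives superadditivity and `hneg` gives `0 ≤ f x + f (-x)`. Superadditivity at `x + y`
  -- and `-y` then yields the reverse inequality.
  have hsuper : ∀ x y, f x + f y ≤ f (x + y) := fun x y => le_of_forall_rat_lt_imp_le fun q hq => by
    obtain ⟨s, t, ⟨hs, ht⟩, hq⟩ := lt_add_iff_exists_rat.1 hq
    obtain ⟨s', hs', h1⟩ := (hf' x s).1 hs
    obtain ⟨t', ht', h2⟩ := (hf' y t).1 ht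
    exact ((hf' _ q).2 ⟨s' + t', by linarith, hadd _ _ _ _ h1 h2⟩).le
  have hpos : ∀ x, 0 ≤ f x + f (-x) := by
    intro x
    refine le_of_not_gt fun hneg' => ?_
    obtain ⟨p, hp, hp'⟩ := exists_rat_btwn (show f x < -f (-x) by linarith)
    obtain ⟨q, hq, hq'⟩ := exists_rat_btwn hp'
    obtain ⟨p₀, hp₀, hp₀'⟩ := exists_rat_btwn hp
    obtain ⟨q₀, hq₀, hq₀'⟩ := exists_rat_btwn hq
    rcases hneg x p q₀ (by exact_mod_cast hq₀) with h | h
    · have := (hf' x p₀).2 ⟨p, by exact_mod_cast hp₀', h⟩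
      linarith
    · have := (hf' (-x) (-q)).2 ⟨-q₀, by
        have : q₀ < q := by exact_mod_cast hq₀'
        linarith, h⟩
      push_cast at this
      linarith
  refine ⟨f, fun x y => le_antisymm ?_ (hsuper x y), hle, hf'⟩
  have h1 := hsuper (x + y) (-y)
  rw [add_neg_cancel_right] at h1
  have h2 := hpos y
  linarith

variable (X) in
/-- The membership relation between the dual ball and its basic weak-star open sets. -/
def boxMem : MSet M (X.dualBall × Finset (X.carrier × ℚ)) :=
  MSet.sep fun t => ∀ a, a ∈ t.2 → (a.2 : ℝ) < X.eval t.1 a.1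

theorem mem_boxMem {y : X.dualBall} {t : Finset (X.carrier × ℚ)} :
    (y, t) ∈ X.boxMem ↔ ∀ a ∈ t, (a.2 : ℝ) < X.eval y a.1 := Iff.rfl

omit hM in
/-- Odd functions which satisfy suitable strict lower bounds are close to a given one. -/
theorem exists_box_near {f : X.carrier → ℝ} (hf : ∀ x, f (-x) = -f x) (s : Finset X.carrier)
    {ε : X.carrier → ℝ} (hε : ∀ x ∈ s, 0 < ε x) :
    ∃ t : Finset (X.carrier × ℚ), (∀ a ∈ t, (a.2 : ℝ) < f a.1) ∧
      ∀ g : X.carrier → ℝ, (∀ x, g (-x) = -g x) → (∀ a ∈ t, (a.2 : ℝ) < g a.1) →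
        ∀ x ∈ s, |g x - f x| < ε x := by
  classical
  have h : ∀ x : s, ∃ q : ℚ, f x - ε x < q ∧ (q : ℝ) < f x := fun x =>
    exists_rat_btwn (by linarith [hε x x.2])
  have h' : ∀ x : s, ∃ q : ℚ, -f x - ε x < q ∧ (q : ℝ) < -f x := fun x =>
    exists_rat_btwn (by linarith [hε x x.2])
  choose q hq hq' using h
  choose r hr hr' using h'
  -- An upper bound at `x` is a lower bound at `-x`, so strict lower bounds alone suffice to
  -- describe the weak-star topology.
  refine ⟨s.attach.image (fun x => (x.1, q x)) ∪ s.attach.image (fun x => (-x.1, r x)), ?_, ?_⟩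
  · intro a ha
    rw [Finset.mem_union, Finset.mem_image, Finset.mem_image] at ha
    rcases ha with ⟨x, -, rfl⟩ | ⟨x, -, rfl⟩
    · exact hq' x
    · rw [hf]
      exact hr' x
  · intro g hg ht x hx
    have h1 := ht (x, q ⟨x, hx⟩) (Finset.mem_union_left _
      (Finset.mem_image.2 ⟨⟨x, hx⟩, Finset.mem_attach _ _, rfl⟩))
    have h2 := ht (-x, r ⟨x, hx⟩) (Finset.mem_union_right _
      (Finset.mem_image.2 ⟨⟨x, hx⟩, Finset.mem_attach _ _, rfl⟩))
    simp only [hg] at h1 h2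
    have h3 := hq ⟨x, hx⟩
    have h4 := hr ⟨x, hx⟩
    simp only at h3 h4
    rw [abs_lt]
    constructor <;> linarith

omit hM in
theorem eval_neg (y : X.dualBall) (x : X.carrier) : X.eval y (-x) = -X.eval y x :=
  map_neg (AddMonoidHom.mk' _ (isUnitFunctional_eval y).map_add) x

theorem mem_weakStarOpens {O : ZFSet.{u}} : O ∈ X.weakStarOpens ↔ (O ∈ M ∧ O ⊆ X.dualBall) ∧
    ∀ y : X.dualBall, y.1 ∈ O → ∃ t, (y, t) ∈ X.boxMem ∧ ∀ z, (z, t) ∈ X.boxMem → z.1 ∈ O := by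
  classical
  rw [weakStarOpens, ZFSet.mem_sep, ZFSet.mem_powerset, ← and_assoc, and_comm (a := O ⊆ _)]
  refine and_congr_right fun _ => forall₂_congr fun y _ => ?_
  constructor
  · rintro ⟨s, ε, hε, h⟩
    obtain ⟨t, ht, ht'⟩ := exists_box_near (eval_neg y) s (ε := fun _ => ε)
      fun _ _ => by exact_mod_cast hε
    exact ⟨t, ht, fun z hz => h z (ht' _ (eval_neg z) hz)⟩
  · rintro ⟨t, ht, h⟩
    obtain ⟨ε, hε, hε'⟩ := exists_rat_pos_forall_lt t (fun a => X.eval y a.1 - a.2)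
      fun a ha => sub_pos.2 (ht a ha)
    refine ⟨t.image Prod.fst, ε, hε, fun z hz => h z fun a ha => ?_⟩
    have h1 := abs_lt.1 (hz a.1 (Finset.mem_image_of_mem _ ha))
    have h2 := hε' a ha
    linarith [h1.1]

end BanachIn

/-- The basic weak-star open set given by strict lower bounds at finitely many points. -/
def boxSet {X : ZFSet.{u}} {E : Type v} [NormedAddCommGroup E] [NormedSpace ℝ E] (p : X → E)
    (t : Finset (X × ℚ)) : Set (weakStarBall E) :=
  {g | ∀ a ∈ t, (a.2 : ℝ) < g.1 (p a.1)}

section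

variable {E : Type v} [NormedAddCommGroup E] [NormedSpace ℝ E]

/-- Regularity comes from the Banach–Alaoglu theorem, as compact Hausdorff spaces are regular. -/
instance : T3Space (weakStarBall E) := by
  have : CompactSpace (weakStarBall E) :=
    isCompact_iff_compactSpace.1 (WeakDual.isCompact_closedBall 0 1)
  infer_instance

theorem norm_apply_le (g : weakStarBall E) (e : E) : ‖g.1 e‖ ≤ ‖e‖ := by
  have h : ‖WeakDual.toStrongDual g.1‖ ≤ 1 := mem_closedBall_zero_iff.1 g.2
  simpa using (WeakDual.toStrongDual g.1).le_of_opNorm_le h e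

theorem continuous_weakStarBall_apply (e : E) : Continuous fun g : weakStarBall E => g.1 e :=
  (WeakDual.eval_continuous e).comp continuous_subtype_val

/-- The weak-star topology of the dual ball is that of pointwise convergence on a dense set. -/
theorem isInducing_apply {A : Type w} {p : A → E} (hd : DenseRange p) :
    IsInducing fun (g : weakStarBall E) (a : A) => g.1 (p a) := by
  let Φ := fun (g : weakStarBall E) (a : A) => g.1 (p a)
  have hΦ : Continuous Φ := continuous_pi fun a => continuous_weakStarBall_apply _
  refine ⟨le_antisymm hΦ.le_induced ?_⟩
  have h : @Continuous _ _ (TopologicalSpace.induced Φ inferInstance) _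
      fun g : weakStarBall E => g.1 := by
    let _ : TopologicalSpace (weakStarBall E) := TopologicalSpace.induced Φ inferInstance
    have hp : ∀ a, Continuous fun g : weakStarBall E => g.1 (p a) := fun a =>
      (continuous_apply (A := fun _ : A => ℝ) a).comp (continuous_induced_dom (f := Φ))
    refine WeakDual.continuous_of_continuous_eval fun e => ?_
    -- Functionals in the unit ball are equicontinuous, so evaluation at `e` is a uniform limit of
    -- evaluations at points of the dense set.
    refine continuous_of_uniform_approx_of_continuous fun u hu => ?_
    obtain ⟨ε, hε, hu⟩ := Metric.mem_uniformity_dist.1 hu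
    obtain ⟨a, ha⟩ := hd.exists_dist_lt e hε
    refine ⟨_, hp a, fun g => hu ?_⟩
    rw [dist_eq_norm] at ha ⊢
    rw [← map_sub]
    exact lt_of_le_of_lt (norm_apply_le g _) ha
  exact continuous_iff_le_induced.1 h

end

namespace BanachIn

variable {X : BanachIn M} {E : Type v} [NormedAddCommGroup E] [NormedSpace ℝ E] {p : X.carrier → E}

omit hM in
theorem PreservesStructure.apply_neg (hp : X.PreservesStructure p) (g : weakStarBall E)
    (x : X.carrier) : g.1 (p (-x)) = -g.1 (p x) := by
  rw [← map_neg]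
  exact congrArg _ (map_neg (AddMonoidHom.mk' p hp.map_add) x)

omit hM in
theorem PreservesStructure.isTopologicalBasis_boxSet (hp : X.PreservesStructure p)
    (hd : DenseRange p) : IsTopologicalBasis (Set.range (boxSet p)) := by
  refine isTopologicalBasis_of_isOpen_of_nhds ?_ fun g W hg hW => ?_
  · rintro _ ⟨t, rfl⟩
    have : boxSet p t = ⋂ a ∈ t, {g | (a.2 : ℝ) < g.1 (p a.1)} := by
      ext g
      simp [boxSet]
    rw [this]
    exact isOpen_biInter_finset fun a _ => isOpen_lt continuous_const (continuous_weakStarBall_apply _)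
  · obtain ⟨U, hU, rfl⟩ := (isInducing_apply hd).isOpen_iff.1 hW
    obtain ⟨s, u, hu, hsu⟩ := isOpen_pi_iff.1 hU _ hg
    have : ∀ x, ∃ ε : ℝ, x ∈ s → 0 < ε ∧ Metric.ball (g.1 (p x)) ε ⊆ u x := fun x => by
      by_cases hx : x ∈ s
      · obtain ⟨ε, hε, h⟩ := Metric.isOpen_iff.1 (hu x hx).1 _ (hu x hx).2
        exact ⟨ε, fun _ => ⟨hε, h⟩⟩
      · exact ⟨0, fun h => (hx h).elim⟩
    choose ε hε using this
    obtain ⟨t, ht, ht'⟩ := exists_box_near (f := fun x => g.1 (p x)) (hp.apply_neg g) s fun x hx => (hε x hx).1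
    refine ⟨_, ⟨t, rfl⟩, ht, fun g' hg' => hsu fun x hx => (hε x hx).2 ?_⟩
    rw [Metric.mem_ball, Real.dist_eq]
    exact ht' (fun x => g'.1 (p x)) (hp.apply_neg g') hg' x hx

end BanachIn

end

section

open TopologicalSpace Filter Topology

variable {M : Set ZFSet.{u}} [hM : Fact (IsTransitiveModel M)]

/-! ### The interpretation of the dual ball -/

namespace BanachIn

theorem mem_boxMem_singleton {X : BanachIn M} {y : X.dualBall} {a : X.carrier × ℚ} :
    (y, {a}) ∈ X.boxMem ↔ (a.2 : ℝ) < X.eval y a.1 := by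
  simp [mem_boxMem]

namespace PreservesStructure

variable {X : BanachIn M} {E : Type v} [NormedAddCommGroup E] [NormedSpace ℝ E] {p : X.carrier → E}
  (hp : X.PreservesStructure p) (hd : DenseRange p)

/-- The interpretation of a functional of the model. -/
def dualMap (y : X.dualBall) : weakStarBall E :=
  (hp.exists_extension hd (isUnitFunctional_eval y).map_add (isUnitFunctional_eval y).bound).choose

theorem dualMap_apply (y : X.dualBall) (x : X.carrier) : (hp.dualMap hd y).1 (p x) = X.eval y x :=
  (hp.exists_extension hd (isUnitFunctional_eval y).map_add
    (isUnitFunctional_eval y).bound).choose_spec x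

theorem mem_boxMem_iff (y : X.dualBall) (t : Finset (X.carrier × ℚ)) :
    (y, t) ∈ X.boxMem ↔ hp.dualMap hd y ∈ boxSet p t := by
  rw [mem_boxMem]
  simp only [boxSet, Set.mem_ofPred_eq, dualMap_apply]

include hp

omit hM in
theorem apply_le (g : weakStarBall E) (x : X.carrier) : g.1 (p x) ≤ X.norm x :=
  (le_abs_self _).trans ((norm_apply_le g (p x)).trans (hp.norm_map x).le)

omit hM in
theorem apply_add (g : weakStarBall E) (x y : X.carrier) :
    g.1 (p (x + y)) = g.1 (p x) + g.1 (p y) := by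
  rw [hp.map_add]
  exact _root_.map_add g.1 _ _

/-- A family of `M` of basic weak-star open sets which covers the closed set given by some lower
bounds has a finite subfamily which covers the interpretation of this closed set. -/
theorem exists_finite_cover (t₀ : Finset (X.carrier × ℚ)) (H : MSet M (Finset (X.carrier × ℚ)))
    (hH : ∀ y, (∀ a ∈ t₀, (a.2 : ℝ) ≤ X.eval y a.1) → ∃ t ∈ H, (y, t) ∈ X.boxMem) :
    ∃ H₀ : Finset (Finset (X.carrier × ℚ)), (∀ t ∈ H₀, t ∈ H) ∧
      ∀ g : weakStarBall E, (∀ a ∈ t₀, (a.2 : ℝ) ≤ g.1 (p a.1)) → ∃ t ∈ H₀, g ∈ boxSet p t := by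
  classical
  by_contra! hcon
  -- The atom `(x, q)` stands for `q < f x`. In order, the clauses express the norm bound,
  -- monotonicity in `q`, additivity, `f x + f (-x) ≥ 0`, the lower bounds in `t₀`, and avoidance of
  -- each box of `H`. Clauses with superfluous atoms are weaker, hence harmless.
  let Γ : MSet M (Finset (X.carrier × ℚ) × Finset (X.carrier × ℚ)) := MSet.sep fun γ =>
    (∃ a, a ∈ γ.2 ∧ ¬ (a.2 : ℝ) < X.norm a.1) ∨
    (∃ a b, a ∈ γ.1 ∧ b ∈ γ.2 ∧ a.1 = b.1 ∧ a.2 < b.2) ∨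
    (∃ a b c, a ∈ γ.1 ∧ b ∈ γ.2 ∧ c ∈ γ.2 ∧ a.1 = b.1 + c.1 ∧ a.2 = b.2 + c.2) ∨
    (∃ a b, a ∈ γ.1 ∧ b ∈ γ.1 ∧ b.1 = -a.1 ∧ a.2 < -b.2) ∨
    (∃ a b, a ∈ γ.1 ∧ b ∈ t₀ ∧ a.1 = b.1 ∧ a.2 < b.2) ∨ γ.2 ∈ H
  obtain ⟨v, hv⟩ := exists_valuation Γ (by
    intro G hG
    -- Finitely many clauses mention finitely many boxes of `H`, and a functional of the outer
    -- universe which avoids these satisfies them.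
    obtain ⟨g, hg, hgt⟩ := hcon ((G.image Prod.snd).filter (· ∈ H))
      fun t ht => (Finset.mem_filter.1 ht).2
    refine ⟨{a | (a.2 : ℝ) < g.1 (p a.1)}, fun γ hγ => ?_⟩
    rcases hG γ hγ with ⟨a, ha, hna⟩ | ⟨a, b, ha, hb, hab, hab'⟩ | ⟨a, b, c, ha, hb, hc, h₁, h₂⟩ |
      ⟨a, b, ha, hb, h₁, h₂⟩ | ⟨a, b, ha, hb, hab, hab'⟩ | hγH
    · exact Or.inr ⟨a, ha, fun h => hna (lt_of_lt_of_le h (hp.apply_le g a.1))⟩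
    · by_cases h : (b.2 : ℝ) < g.1 (p b.1)
      · refine Or.inl ⟨a, ha, ?_⟩
        have : (a.2 : ℝ) < b.2 := by exact_mod_cast hab'
        change (a.2 : ℝ) < g.1 (p a.1)
        rw [hab]
        exact this.trans h
      · exact Or.inr ⟨b, hb, h⟩
    · by_cases hb' : (b.2 : ℝ) < g.1 (p b.1)
      · by_cases hc' : (c.2 : ℝ) < g.1 (p c.1)
        · refine Or.inl ⟨a, ha, ?_⟩
          change (a.2 : ℝ) < g.1 (p a.1)
          rw [h₁, h₂, hp.apply_add]
          push_cast
          exact add_lt_add hb' hc'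
        · exact Or.inr ⟨c, hc, hc'⟩
      · exact Or.inr ⟨b, hb, hb'⟩
    · by_cases ha' : (a.2 : ℝ) < g.1 (p a.1)
      · exact Or.inl ⟨a, ha, ha'⟩
      · refine Or.inl ⟨b, hb, ?_⟩
        change (b.2 : ℝ) < g.1 (p b.1)
        rw [h₁, hp.apply_neg]
        have : (a.2 : ℝ) < -b.2 := by exact_mod_cast h₂
        linarith [not_lt.1 ha']
    · refine Or.inl ⟨a, ha, ?_⟩
      have : (a.2 : ℝ) < b.2 := by exact_mod_cast hab'
      change (a.2 : ℝ) < g.1 (p a.1)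
      rw [hab]
      exact lt_of_lt_of_le this (hg b hb)
    · have := hgt γ.2 (Finset.mem_filter.2 ⟨Finset.mem_image_of_mem _ hγ, hγH⟩)
      simp only [boxSet, Set.mem_ofPred_eq, not_forall] at this
      obtain ⟨a, ha, h⟩ := this
      exact Or.inr ⟨a, ha, h⟩)
  have hmono : ∀ x (q q' : ℚ), q < q' → (x, q') ∈ v → (x, q) ∈ v := fun x q q' hq h => by
    simpa [h] using hv ({(x, q)}, {(x, q')})
      (Or.inr (Or.inl ⟨(x, q), (x, q'), by simp, by simp, rfl, hq⟩))
  obtain ⟨f, hadd, hle, hf⟩ := exists_additive (X := X) (v : Set (X.carrier × ℚ))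
    (fun x q h => by
      by_contra hq
      simpa [show (x, q) ∈ v from h] using hv (∅, {(x, q)})
        (Or.inl ⟨(x, q), by simp, not_lt.2 (not_le.1 hq).le⟩))
    (fun x y q r hx hy => by
      simpa [show (x, q) ∈ v from hx, show (y, r) ∈ v from hy] using
        hv ({(x + y, q + r)}, {(x, q), (y, r)}) (Or.inr (Or.inr (Or.inl
          ⟨(x + y, q + r), (x, q), (y, r), by simp, by simp, by simp, rfl, rfl⟩))))
    (fun x q r hqr => by
      simpa using hv ({(x, q), (-x, -r)}, ∅) (Or.inr (Or.inr (Or.inr (Or.inl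
          ⟨(x, q), (-x, -r), by simp, by simp, rfl, by simpa using hqr⟩)))))
  have : DefPred M fun t : X.carrier × ℚ => (t.2 : ℝ) < f t.1 :=
    DefPred.congr (φ := fun t : X.carrier × ℚ => ∃ q' : ℚ, t.2 < q' ∧ (t.1, q') ∈ v) inferInstance
      fun t => hf t.1 t.2
  obtain ⟨y, rfl⟩ := exists_eval f hadd hle
  obtain ⟨t, ht, hyt⟩ := hH y (by
    refine fun a ha => le_of_forall_rat_lt_imp_le fun q hq => ?_
    have hq : q < a.2 := by exact_mod_cast hq
    obtain ⟨r, hqr, hr⟩ := exists_between hq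
    refine ((hf a.1 q).2 ⟨r, hqr, ?_⟩).le
    simpa using hv ({(a.1, r)}, ∅) (Or.inr (Or.inr (Or.inr (Or.inr (Or.inl
      ⟨(a.1, r), a, by simp, ha, rfl, hr⟩))))))
  -- The functional `y` of `M` read off from the valuation lies in some box `t ∈ H`, although the
  -- clause `(∅, t)` forbids it.
  rcases hv (∅, t) (Or.inr (Or.inr (Or.inr (Or.inr (Or.inr ht))))) with ⟨a, ha, -⟩ | ⟨a, ha, hav⟩
  · simp at ha
  · obtain ⟨q, hq, hqv⟩ := (hf a.1 a.2).1 (mem_boxMem.1 hyt a ha)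
    exact hav (hmono _ _ _ hq hqv)

omit hp in
variable (p) in
/-- A basic weak-star open set contains a slightly smaller closed one. -/
theorem exists_shrink {g : weakStarBall E} {t : Finset (X.carrier × ℚ)} (hg : g ∈ boxSet p t) :
    ∃ t', g ∈ boxSet p t' ∧ ∀ y, (∀ a ∈ t', (a.2 : ℝ) ≤ X.eval y a.1) → (y, t) ∈ X.boxMem := by
  classical
  obtain ⟨ε, hε, h⟩ := exists_rat_pos_forall_lt t (fun a => g.1 (p a.1) - a.2)
    fun a ha => sub_pos.2 (hg a ha)
  refine ⟨t.image fun a => (a.1, a.2 + ε), fun a ha => ?_, fun y hy a ha => ?_⟩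
  · obtain ⟨b, hb, rfl⟩ := Finset.mem_image.1 ha
    have := h b hb
    push_cast
    linarith
  · have := hy _ (Finset.mem_image_of_mem _ ha)
    have hε : (0 : ℝ) < ε := by exact_mod_cast hε
    push_cast at this
    linarith

/-- Compactness is about closed sets, so the open box is first shrunk to a closed one which still
contains `g`. -/
theorem cover_boxMem (g : weakStarBall E) (t₀ : Finset (X.carrier × ℚ))
    (G : MSet M (Finset (X.carrier × ℚ))) (hg : g ∈ boxSet p t₀)
    (hG : ∀ y, (y, t₀) ∈ X.boxMem → ∃ t ∈ G, (y, t) ∈ X.boxMem) : ∃ t ∈ G, g ∈ boxSet p t := by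
  obtain ⟨t₁, hg₁, ht₁⟩ := exists_shrink p hg
  obtain ⟨H₀, hH₀, h⟩ := hp.exists_finite_cover t₁ G fun y hy => hG y (ht₁ y hy)
  obtain ⟨t, ht, hgt⟩ := h g fun a ha => (hg₁ a ha).le
  exact ⟨t, hH₀ t ht, hgt⟩

theorem interpretedBasis_boxMem :
    InterpretedBasis X.boxMem X.weakStarOpens (hp.dualMap hd) (boxSet p) where
  mem_opens _ := mem_weakStarOpens
  basis := hp.isTopologicalBasis_boxSet hd
  mem_iff := hp.mem_boxMem_iff hd
  cover := hp.cover_boxMem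

-- The singleton boxes of a prime family satisfy the hypotheses of `exists_additive`: the
-- alternative for `x` and `-x` holds because two boxes cover the dual ball. The resulting additive
-- function need not belong to `M`, but it extends to `E`.
include hd in
theorem exists_point_boxMem (F : Set (Finset (X.carrier × ℚ))) (hF : IsPrimeFamily X.boxMem F) :
    ∃ g : weakStarBall E, ∀ t, g ∈ boxSet p t → t ∈ F := by
  classical
  have hempty : ∅ ∈ F := by
    obtain ⟨t, ht⟩ := hF.nonempty
    exact hF.mono t ht ∅ fun y _ => mem_boxMem.2 (by simp)
  have hmono : ∀ x (q q' : ℚ), q < q' → {(x, q')} ∈ F → {(x, q)} ∈ F := fun x q q' hq h =>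
    hF.mono _ h _ fun y hy => by
      rw [mem_boxMem_singleton] at hy ⊢
      exact lt_trans (Rat.cast_lt.2 hq) hy
  obtain ⟨f, hadd, hle, hf⟩ := exists_additive (X := X) {a | {a} ∈ F}
    (fun x q h => by
      obtain ⟨y, hy⟩ := hF.exists_mem h
      rw [mem_boxMem_singleton] at hy
      exact hy.le.trans ((isUnitFunctional_iff.1 (isUnitFunctional_eval y)).2 x))
    (fun x y q r hx hy => by
      obtain ⟨t, ht, hsub⟩ := hF.inter _ hx _ hy
      refine hF.mono t ht _ fun z hz => ?_
      obtain ⟨h₁, h₂⟩ := hsub z hz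
      rw [mem_boxMem_singleton] at h₁ h₂ ⊢
      rw [(isUnitFunctional_eval z).map_add]
      push_cast
      exact add_lt_add h₁ h₂)
    (fun x q r hqr => by
      obtain ⟨t, ht, htF⟩ := hF.cover ∅ hempty
        (.ofFinite {{(x, q)}, {(-x, -r)}} (Set.toFinite _)) fun y _ => by
          by_cases h : (q : ℝ) < X.eval y x
          · exact ⟨{(x, q)}, by simp, by simpa [mem_boxMem] using h⟩
          · refine ⟨{(-x, -r)}, by simp, ?_⟩
            rw [mem_boxMem_singleton, eval_neg]
            have : (q : ℝ) < r := by exact_mod_cast hqr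
            push_cast
            linarith [not_lt.1 h]
      rcases ht with rfl | rfl
      · exact Or.inl htF
      · exact Or.inr htF)
  obtain ⟨g, hg⟩ := hp.exists_extension hd hadd fun x => abs_le'.2 ⟨hle x, by
    have : f (-x) = -f x := map_neg (AddMonoidHom.mk' f hadd) x
    rw [← this, ← norm_neg]
    exact hle _⟩
  refine ⟨g, fun t ht => ?_⟩
  induction t using Finset.induction_on with
  | empty => exact hempty
  | insert a t _ ih =>
    have h₁ := ih fun b hb => ht b (Finset.mem_insert_of_mem hb)
    have h₂ := ht a (Finset.mem_insert_self a t)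
    rw [hg] at h₂
    obtain ⟨q, hq, hqF⟩ := (hf _ _).1 h₂
    obtain ⟨s, hs, hsub⟩ := hF.inter _ h₁ _ (hmono _ _ _ hq hqF)
    refine hF.mono s hs _ fun y hy => ?_
    obtain ⟨h₃, h₄⟩ := hsub y hy
    rw [mem_boxMem_singleton] at h₄
    rw [mem_boxMem] at h₃ ⊢
    exact (Finset.forall_mem_insert _ _ _).2 ⟨h₄, h₃⟩

theorem extendsToInterpretation_dualMap :
    ExtendsToInterpretation M X.dualBall X.weakStarOpens (hp.dualMap hd) :=
  ⟨_, (hp.interpretedBasis_boxMem hd).isInterpretation (hp.exists_point_boxMem hd)⟩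

end PreservesStructure

end BanachIn

end

section

open TopologicalSpace Filter Topology

variable {M : Set ZFSet.{u}} [hM : Fact (IsTransitiveModel M)]

/-! ### Interpretations of products -/

section

variable {X Y : ZFSet.{u}} [Fact (X ∈ M)] [Fact (Y ∈ M)] {B : Type w} {B' : Type w₁}
  [Coded M B] [Coded M B'] [SetCoded M B] [SetCoded M B'] {mem : MSet M (X × B)}
  {mem' : MSet M (Y × B')}

/-- The membership relation between points of the product and products of basic sets. -/
def prodMem (mem : MSet M (X × B)) (mem' : MSet M (Y × B')) : MSet M (X.prod Y × (B × B')) :=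
  MSet.sep fun t => ((coords t.1).1, t.2.1) ∈ mem ∧ ((coords t.1).2, t.2.2) ∈ mem'

theorem mem_prodMem {z : X.prod Y} {b : B × B'} : (z, b) ∈ prodMem mem mem' ↔
    ((coords z).1, b.1) ∈ mem ∧ ((coords z).2, b.2) ∈ mem' := Iff.rfl

theorem prodMk_mem_prodMem {x : X} {y : Y} {b : B × B'} : (prodMk x y, b) ∈ prodMem mem mem' ↔
    (x, b.1) ∈ mem ∧ (y, b.2) ∈ mem' := by
  rw [mem_prodMem, coords_prodMk]

omit hM in
theorem prodMk_coords (z : X.prod Y) : prodMk (coords z).1 (coords z).2 = z :=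
  Subtype.ext (pair_coords z).symm

omit hM in
theorem prodMk_mem_prod {x : X} {y : Y} {U V : ZFSet.{u}} :
    (prodMk x y).1 ∈ U.prod V ↔ x.1 ∈ U ∧ y.1 ∈ V := ZFSet.pair_mem_prod

variable {τ σ : ZFSet.{u}} {E : Type v} [TopologicalSpace E] {p : X → E} {P : B → Set E}
  {E' : Type w₂} [TopologicalSpace E'] {p' : Y → E'} {P' : B' → Set E'}

theorem InterpretedBasis.prod (h : InterpretedBasis mem τ p P) (h' : InterpretedBasis mem' σ p' P')
    (cover : ∀ (e : E × E') (b₀ : B × B') (G : MSet M (B × B')), e ∈ P b₀.1 ×ˢ P' b₀.2 →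
      (∀ x y, (x, b₀.1) ∈ mem → (y, b₀.2) ∈ mem' → ∃ b ∈ G, (x, b.1) ∈ mem ∧ (y, b.2) ∈ mem') →
        ∃ b ∈ G, e ∈ P b.1 ×ˢ P' b.2) :
    InterpretedBasis (prodMem mem mem') (prodOpens M X τ Y σ) (prodMap p p')
      fun b => P b.1 ×ˢ P' b.2 where
  mem_opens O := by
    rw [prodOpens, ZFSet.mem_sep, ZFSet.mem_powerset, ← and_assoc, and_comm (a := O ⊆ _)]
    refine and_congr_right fun _ => ?_
    constructor
    · intro hO z hz
      rw [pair_coords z] at hz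
      obtain ⟨U, hU, V, hV, hxU, hyV, hUV⟩ := hO _ _ hz
      obtain ⟨b, hb, hbU⟩ := ((h.mem_opens U).1 hU).2 _ hxU
      obtain ⟨b', hb', hbV⟩ := ((h'.mem_opens V).1 hV).2 _ hyV
      refine ⟨(b, b'), ⟨hb, hb'⟩, fun w hw => hUV ?_⟩
      rw [← prodMk_coords w]
      exact prodMk_mem_prod.2 ⟨hbU _ hw.1, hbV _ hw.2⟩
    · intro hO x y hxy
      obtain ⟨b, hb, hbO⟩ := hO (prodMk x y) hxy
      rw [prodMk_mem_prodMem] at hb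
      refine ⟨_, (h.basicOpen b.1).2, _, (h'.basicOpen b.2).2, (h.mem_basicOpen _ _).2 hb.1,
        (h'.mem_basicOpen _ _).2 hb.2, fun w hw => ?_⟩
      obtain ⟨c, hc, d, hd, rfl⟩ := ZFSet.mem_prod.1 hw
      have hc' : c ∈ X := ((h.mem_opens _).1 (h.basicOpen b.1).2).1.2 hc
      have hd' : d ∈ Y := ((h'.mem_opens _).1 (h'.basicOpen b.2).2).1.2 hd
      exact hbO (prodMk ⟨c, hc'⟩ ⟨d, hd'⟩) (prodMk_mem_prodMem.2
        ⟨(h.mem_basicOpen b.1 ⟨c, hc'⟩).1 hc, (h'.mem_basicOpen b.2 ⟨d, hd'⟩).1 hd⟩)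
  basis := by
    convert! h.basis.prod h'.basis using 1
    ext s
    simp only [Set.mem_range, Set.mem_image2, Prod.exists, exists_exists_eq_and]
  mem_iff z b := by
    rw [mem_prodMem, h.mem_iff, h'.mem_iff]
    rfl
  cover e b₀ G he hG := cover e b₀ G he fun x y hx hy => by
    obtain ⟨b, hb, hxy⟩ := hG (prodMk x y) (prodMk_mem_prodMem.2 ⟨hx, hy⟩)
    exact ⟨b, hb, prodMk_mem_prodMem.1 hxy⟩

/-- Coverings of one factor become coverings of the product with the other side held fixed. A pair
in the family has a point, whose second coordinate serves to recover inclusions of the first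
factors. -/
theorem IsPrimeFamily.fst {F : Set (B × B')} (hF : IsPrimeFamily (prodMem mem mem') F) :
    IsPrimeFamily mem {b | ∃ b', (b, b') ∈ F} where
  nonempty := by
    obtain ⟨b, hb⟩ := hF.nonempty
    exact ⟨b.1, b.2, hb⟩
  cover := by
    rintro b ⟨b', hb⟩ G hG
    obtain ⟨c, ⟨hcG, -⟩, hcF⟩ := hF.cover _ hb (MSet.sep fun c => c.1 ∈ G ∧ c.2 = b') fun z hz => by
      obtain ⟨c, hc, hzc⟩ := hG _ hz.1
      exact ⟨(c, b'), ⟨hc, rfl⟩, hzc, hz.2⟩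
    exact ⟨c.1, hcG, c.2, hcF⟩
  inter := by
    rintro b ⟨b', hb⟩ c ⟨c', hc⟩
    obtain ⟨d, hd, hsub⟩ := hF.inter _ hb _ hc
    obtain ⟨z, hz⟩ := hF.exists_mem hd
    refine ⟨d.1, ⟨d.2, hd⟩, fun x hx => ?_⟩
    have := hsub (prodMk x (coords z).2) (prodMk_mem_prodMem.2 ⟨hx, hz.2⟩)
    rw [prodMk_mem_prodMem, prodMk_mem_prodMem] at this
    exact ⟨this.1.1, this.2.1⟩
  mono := by
    rintro b ⟨b', hb⟩ c hc
    exact ⟨b', hF.mono _ hb _ fun z hz => ⟨hc _ hz.1, hz.2⟩⟩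

theorem IsPrimeFamily.snd {F : Set (B × B')} (hF : IsPrimeFamily (prodMem mem mem') F) :
    IsPrimeFamily mem' {b' | ∃ b, (b, b') ∈ F} where
  nonempty := by
    obtain ⟨b, hb⟩ := hF.nonempty
    exact ⟨b.2, b.1, hb⟩
  cover := by
    rintro b' ⟨b, hb⟩ G hG
    obtain ⟨c, ⟨hcG, -⟩, hcF⟩ := hF.cover _ hb (MSet.sep fun c => c.2 ∈ G ∧ c.1 = b) fun z hz => by
      obtain ⟨c, hc, hzc⟩ := hG _ hz.2
      exact ⟨(b, c), ⟨hc, rfl⟩, hz.1, hzc⟩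
    exact ⟨c.2, hcG, c.1, hcF⟩
  inter := by
    rintro b' ⟨b, hb⟩ c' ⟨c, hc⟩
    obtain ⟨d, hd, hsub⟩ := hF.inter _ hb _ hc
    obtain ⟨z, hz⟩ := hF.exists_mem hd
    refine ⟨d.2, ⟨d.1, hd⟩, fun y hy => ?_⟩
    have := hsub (prodMk (coords z).1 y) (prodMk_mem_prodMem.2 ⟨hz.1, hy⟩)
    rw [prodMk_mem_prodMem, prodMk_mem_prodMem] at this
    exact ⟨this.1.2, this.2.2⟩
  mono := by
    rintro b' ⟨b, hb⟩ c hc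
    exact ⟨b, hF.mono _ hb _ fun z hz => ⟨hz.1, hc _ hz.2⟩⟩

omit [TopologicalSpace E] [TopologicalSpace E'] in
theorem exists_point_prodMem
    (conv : ∀ F : Set B, IsPrimeFamily mem F → ∃ e, ∀ b, e ∈ P b → b ∈ F)
    (conv' : ∀ F : Set B', IsPrimeFamily mem' F → ∃ e, ∀ b, e ∈ P' b → b ∈ F)
    (F : Set (B × B')) (hF : IsPrimeFamily (prodMem mem mem') F) :
    ∃ e, ∀ b : B × B', e ∈ P b.1 ×ˢ P' b.2 → b ∈ F := by
  obtain ⟨e, he⟩ := conv _ hF.fst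
  obtain ⟨e', he'⟩ := conv' _ hF.snd
  refine ⟨(e, e'), fun b hb => ?_⟩
  obtain ⟨c', hc'⟩ := he _ hb.1
  obtain ⟨c, hc⟩ := he' _ hb.2
  obtain ⟨d, hd, hsub⟩ := hF.inter _ hc' _ hc
  exact hF.mono d hd b fun z hz => ⟨(hsub z hz).1.1, (hsub z hz).2.2⟩

end

/-! ### The product of a Banach space and its dual ball -/

namespace BanachIn

namespace PreservesStructure

variable {X : BanachIn M} {E : Type v} [NormedAddCommGroup E] [NormedSpace ℝ E] {p : X.carrier → E}
  (hp : X.PreservesStructure p) (hd : DenseRange p)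

include hp in
theorem interpretedBasis_ballMem (hd : DenseRange p) :
    InterpretedBasis (ballMem X.dist) X.opens p (ballSet p) :=
  interpretedBasis hp.map_add hp.norm_map hd

variable (X) in
/-- The pairs of balls such that the first one is contained in the second one in a formal way. -/
def formalSubset : MSet M ((X.carrier × ℚ) × (X.carrier × ℚ)) :=
  MSet.sep fun t => ∀ q : ℚ, (q, (t.1.1, t.2.1)) ∈ X.dist → q + t.1.2 ≤ t.2.2

include hp hd in
theorem mem_formalSubset (b c : X.carrier × ℚ) :
    (b, c) ∈ formalSubset X ↔ Dist.dist (p b.1) (p c.1) + b.2 ≤ c.2 := by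
  obtain ⟨-, h⟩ := interpretedMetric hp.map_add hp.norm_map hd
  change (∀ q : ℚ, _) ↔ _
  simp only [h.mem_iff]
  constructor
  · intro hq
    rw [← le_sub_iff_add_le]
    refine le_of_forall_rat_lt_imp_le fun q hq' => ?_
    have : ((q + b.2 : ℚ) : ℝ) ≤ c.2 := by exact_mod_cast hq q hq'
    push_cast at this
    linarith
  · intro hle q hq
    have : ((q + b.2 : ℚ) : ℝ) ≤ c.2 := by
      push_cast
      linarith
    exact_mod_cast this

-- The tube lemma, once inside and once outside `M`. Over a point `x`, finitely many members of `G`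
-- cover the closed box `t₁`, so some ball around `x` works for all of them. These good balls form a
-- family in `M`, to which the metric case applies; a second use of compactness handles the
-- functional.
include hp hd in
theorem cover_prodMem (e : E × weakStarBall E)
    (b₀ : (X.carrier × ℚ) × Finset (X.carrier × ℚ))
    (G : MSet M ((X.carrier × ℚ) × Finset (X.carrier × ℚ)))
    (he : e ∈ ballSet p b₀.1 ×ˢ boxSet p b₀.2)
    (hG : ∀ x y, (x, b₀.1) ∈ ballMem X.dist → (y, b₀.2) ∈ X.boxMem →
      ∃ b ∈ G, (x, b.1) ∈ ballMem X.dist ∧ (y, b.2) ∈ X.boxMem) :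
    ∃ b ∈ G, e ∈ ballSet p b.1 ×ˢ boxSet p b.2 := by
  obtain ⟨t₁, hg₁, ht₁⟩ := exists_shrink p he.2
  obtain ⟨-, hm⟩ := interpretedMetric hp.map_add hp.norm_map hd
  -- Non-strict bounds are written through strict rational ones (see `hy₁`), for which definability
  -- is available. Formal inclusion of balls passes to `E` by the triangle inequality.
  let good : MSet M (X.carrier × ℚ) := MSet.sep fun c =>
    ∀ y, (∀ a, a ∈ t₁ → ∀ q : ℚ, q < a.2 → (q : ℝ) < X.eval y a.1) →
      ∃ b, b ∈ G ∧ (y, b.2) ∈ X.boxMem ∧ (c, b.1) ∈ formalSubset X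
  have hy₁ : ∀ y, (∀ a ∈ t₁, ∀ q : ℚ, q < a.2 → (q : ℝ) < X.eval y a.1) ↔
      ∀ a ∈ t₁, (a.2 : ℝ) ≤ X.eval y a.1 := by
    refine fun y => forall₂_congr fun a _ => ⟨fun h => ?_, fun h q hq => ?_⟩
    · exact le_of_forall_rat_lt_imp_le fun q hq => (h q (by exact_mod_cast hq)).le
    · exact lt_of_lt_of_le (Rat.cast_lt.2 hq) h
  obtain ⟨c, hc, hec⟩ := hm.cover e.1 b₀.1 good he.1 (by
    intro x hx
    obtain ⟨H₀, hH₀, h⟩ := hp.exists_finite_cover t₁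
      (MSet.sep fun t => ∃ b, b ∈ G ∧ b.2 = t ∧ (x, b.1) ∈ ballMem X.dist) (by
        intro y hy
        obtain ⟨b, hb, hxb, hyb⟩ := hG x y hx (ht₁ y hy)
        exact ⟨b.2, ⟨b, hb, rfl, hxb⟩, hyb⟩)
    choose b hb hbt hxb using fun t : H₀ => hH₀ t t.2
    -- The radius is smaller than the margin by which `x` lies inside each of the finitely many
    -- balls.
    obtain ⟨r, hr, hrb⟩ := exists_rat_pos_forall_lt H₀.attach
      (fun t => (b t).1.2 - Dist.dist (p x) (p (b t).1.1))
      fun t _ => sub_pos.2 ((hm.mem_ballMem x _).1 (hxb t))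
    refine ⟨(x, r), fun y hy => ?_, (hm.mem_ballMem x _).2 ?_⟩
    · obtain ⟨t, ht, hyt⟩ := h (hp.dualMap hd y) (by
        simp only [dualMap_apply]
        exact (hy₁ y).1 hy)
      refine ⟨b ⟨t, ht⟩, hb _, ?_, (hp.mem_formalSubset hd _ _).2 ?_⟩
      · rw [hbt]
        exact (hp.mem_boxMem_iff hd y t).2 hyt
      · have := hrb ⟨t, ht⟩ (Finset.mem_attach _ _)
        simp only
        linarith
    · simpa using hr)
  obtain ⟨H₀, hH₀, h⟩ := hp.exists_finite_cover t₁
    (MSet.sep fun t => ∃ b, b ∈ G ∧ b.2 = t ∧ (c, b.1) ∈ formalSubset X) (by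
      intro y hy
      obtain ⟨b, hb, hyb, hcb⟩ := hc y ((hy₁ y).2 hy)
      exact ⟨b.2, ⟨b, hb, rfl, hcb⟩, hyb⟩)
  obtain ⟨t, ht, het⟩ := h e.2 fun a ha => (hg₁ a ha).le
  obtain ⟨b, hb, rfl, hcb⟩ := hH₀ t ht
  refine ⟨b, hb, ?_, het⟩
  rw [mem_formalSubset hp hd] at hcb
  rw [mem_ballSet] at hec ⊢
  have := dist_triangle e.1 (p c.1) (p b.1.1)
  linarith

theorem extendsToInterpretation_prodMap [CompleteSpace E] :
    ExtendsToInterpretation M (X.carrier.prod X.dualBall)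
      (prodOpens M X.carrier X.opens X.dualBall X.weakStarOpens) (prodMap p (hp.dualMap hd)) :=
  ⟨_, ((hp.interpretedBasis_ballMem hd).prod (hp.interpretedBasis_boxMem hd)
    (hp.cover_prodMem hd)).isInterpretation
      (exists_point_prodMem (interpretedMetric hp.map_add hp.norm_map hd).2.exists_point
        (hp.exists_point_boxMem hd))⟩

end PreservesStructure

end BanachIn

end

section

open TopologicalSpace Filter Topology

variable {M : Set ZFSet.{u}}

/-! ### Uniqueness of interpretations -/

theorem IsPreinterpretation.ext_of_mem_iff {X τ : ZFSet.{u}} {E : Type v} [TopologicalSpace E]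
    {p : X → E} {P : τ → Set E} (h : IsPreinterpretation M X τ p P) {a b : E}
    (hab : ∀ O, a ∈ P O ↔ b ∈ P O) : a = b := by
  have := h.t0
  refine Inseparable.eq (h.basis.inseparable_iff.2 ?_)
  rintro _ ⟨O, rfl⟩
  exact hab O

/-- Preinterpretations are preserved under homeomorphisms. -/
theorem IsPreinterpretation.homeomorph {X τ : ZFSet.{u}} {E : Type v} [TopologicalSpace E]
    {p : X → E} {P : τ → Set E} (h : IsPreinterpretation M X τ p P) {E' : Type w}
    [TopologicalSpace E'] (f : E ≃ₜ E') :
    IsPreinterpretation M X τ (f ∘ p) fun O => f.symm ⁻¹' P O where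
  t0 := by
    have := h.t0
    exact f.symm.isEmbedding.t0Space
  isOpen O := (h.isOpen O).preimage f.symm.continuous
  mem_iff x O := by
    rw [h.mem_iff, Set.mem_preimage, Function.comp_apply, f.symm_apply_apply]
  inter O₁ O₂ O₃ e := by rw [h.inter O₁ O₂ O₃ e, Set.preimage_inter]
  sUnion 𝒜 h𝒜 hτ O hO := by
    rw [h.sUnion 𝒜 h𝒜 hτ O hO]
    rfl
  empty O hO := by rw [h.empty O hO, Set.preimage_empty]
  univ O hO := by rw [h.univ O hO, Set.preimage_univ]
  basis := by
    convert! h.basis.isInducing f.symm.isInducing using 1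
    ext s
    simp

/-- A preinterpretation to which all preinterpretations of arbitrary size reduce is homeomorphic to
every interpretation. -/
theorem IsInterpretation.exists_homeomorph {X τ : ZFSet.{u}} {E : Type u} [TopologicalSpace E]
    {p : X → E} {P : τ → Set E} (h : IsInterpretation M X τ p P) {C : Type v} [TopologicalSpace C]
    {i : X → C} {Q : τ → Set C} (hC : IsPreinterpretation M X τ i Q)
    (hmax : ∃ g : E → C, IsReduction p P i Q g) : ∃ e : E ≃ₜ C, ∀ x, e (p x) = i x := by
  -- Maximality of an interpretation quantifies over spaces in `Type u` only, while the completion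
  -- lives one universe higher. A `T₀` space is determined by traces on a basis indexed by the small
  -- type `τ`, so it can be shrunk.
  have : Small.{u} C := by
    refine small_of_injective (f := fun c : C => {O : τ | c ∈ Q O}) fun a b hab => ?_
    exact hC.ext_of_mem_iff fun O => Set.ext_iff.1 hab O
  let f := Shrink.homeomorph.{u} C
  obtain ⟨k, hk, hk'⟩ := h.2 _ _ _ _ (hC.homeomorph f)
  obtain ⟨g, hg, hg'⟩ := hmax
  have hkO : ∀ c O, k (f c) ∈ P O ↔ c ∈ Q O := fun c O => by
    rw [← Set.mem_preimage (f := k), hk', Set.mem_preimage, f.symm_apply_apply]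
  have hgO : ∀ e O, g e ∈ Q O ↔ e ∈ P O := fun e O => Set.ext_iff.1 (hg' O) e
  refine ⟨⟨⟨g, fun c => k (f c), fun e => ?_, fun c => ?_⟩, ?_, ?_⟩, fun x => (hg x).symm⟩
  · exact h.1.ext_of_mem_iff fun O => by rw [hkO, hgO]
  · exact hC.ext_of_mem_iff fun O => by rw [hgO, hkO]
  · refine hC.basis.continuous_iff.2 ?_
    rintro _ ⟨O, rfl⟩
    change IsOpen (g ⁻¹' Q O)
    rw [hg']
    exact h.1.isOpen O
  · refine h.1.basis.continuous_iff.2 ?_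
    rintro _ ⟨O, rfl⟩
    convert! hC.isOpen O using 1
    ext c
    exact hkO c O

/-- A continuous function with prescribed values on a dense set is the unique interpretation of
the corresponding real-valued function of the model. -/
theorem interpretsMap_iff {X : ZFSet.{u}} {E : Type v} [TopologicalSpace E] {p : X → E}
    (hd : DenseRange p) {f : ZFSet.{u}} {r : X → ℝ} (hr : ∀ x, realCode (r x) ∈ M)
    (hf : ∀ x z, ZFSet.pair x.1 z ∈ f ↔ z = realCode (r x)) {G : E → ℝ} (hG : Continuous G)
    (hGr : ∀ x, G (p x) = r x) (g : E → ℝ) :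
    InterpretsMap p (realVal (M := M)) f g ↔ g = G := by
  constructor
  · rintro ⟨hg, hgf⟩
    refine hd.equalizer hg hG (funext fun x => ?_)
    rw [Function.comp_apply, Function.comp_apply, hGr,
      hgf x (toRealSet (r x) (hr x)) ((hf x _).2 rfl), realVal_toRealSet]
  · rintro rfl
    refine ⟨hG, fun x c hc => ?_⟩
    rw [hGr]
    refine realCode_injective ?_
    rw [realCode_realVal]
    exact ((hf x _).1 hc).symm

/-- The bracket is continuous on the product of a normed space and its dual ball. -/
theorem continuous_bracket {E : Type v} [NormedAddCommGroup E] [NormedSpace ℝ E] :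
    Continuous fun z : E × weakStarBall E => z.2.1 z.1 := by
  refine continuous_iff_continuousAt.2 fun z₀ => ?_
  -- Joint continuity uses the unit ball: the variation of the vector contributes at most its norm,
  -- uniformly in the functional.
  have h₁ : Tendsto (fun z : E × weakStarBall E => z.2.1 (z.1 - z₀.1)) (𝓝 z₀) (𝓝 0) := by
    refine squeeze_zero_norm (fun z => norm_apply_le z.2 _) ?_
    have : Continuous fun z : E × weakStarBall E => ‖z.1 - z₀.1‖ := by fun_prop
    simpa using this.tendsto z₀
  have h₂ : Tendsto (fun z : E × weakStarBall E => z.2.1 z₀.1) (𝓝 z₀) (𝓝 (z₀.2.1 z₀.1)) :=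
    ((continuous_weakStarBall_apply z₀.1).comp continuous_snd).tendsto z₀
  have h := h₁.add h₂
  rw [zero_add] at h
  refine h.congr fun z => ?_
  rw [map_sub, sub_add_cancel]

variable [hM : Fact (IsTransitiveModel M)]

/-! ### The Banach space structure of an arbitrary interpretation -/

namespace BanachIn

variable {X : BanachIn M}

/-- Every interpretation of `X` is homeomorphic to its completion. -/
theorem exists_homeomorph_completion {E : Type u} [TopologicalSpace E] {p : X.carrier → E}
    (h : ExtendsToInterpretation M X.carrier X.opens p) :
    ∃ e : E ≃ₜ X.completion, ∀ x, e (p x) = x := by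
  obtain ⟨P, hP⟩ := h
  have hC := X.preservesStructure_coe
  have hd := UniformSpace.Completion.denseRange_coe (α := X.carrier)
  have hB := hC.interpretedBasis_ballMem hd
  exact hP.exists_homeomorph hB.isPreinterpretation
    (hB.exists_reduction (interpretedMetric hC.map_add hC.norm_map hd).2.exists_point hP.1)

/-- The structure of the completion is transported along the homeomorphism. -/
theorem exists_banachSpace {E : Type u} [t : TopologicalSpace E] {p : X.carrier → E}
    (h : ExtendsToInterpretation M X.carrier X.opens p) :
    ∃ (N : NormedAddCommGroup E) (_ : NormedSpace ℝ E),
      N.toMetricSpace.toPseudoMetricSpace.toUniformSpace.toTopologicalSpace = t ∧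
      CompleteSpace E ∧ X.PreservesStructure p := by
  obtain ⟨e, he⟩ := exists_homeomorph_completion h
  have hC := X.preservesStructure_coe
  refine ⟨e.toEquiv.normedAddCommGroup, e.toEquiv.normedSpace ℝ, e.isInducing.eq_induced.symm,
    ?_, ?_⟩
  · let _ := e.toEquiv.normedAddCommGroup
    exact (IsometryEquiv.mk e.toEquiv fun _ _ => rfl).completeSpace
  · let _ := e.toEquiv.normedAddCommGroup
    let _ := e.toEquiv.normedSpace ℝ
    refine ⟨fun x y => e.injective ?_, fun r x => e.injective ?_, fun x => ?_⟩
    · refine ((he _).trans (hC.map_add x y)).trans ?_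
      rw [← he, ← he]
      exact (e.apply_symm_apply _).symm
    · refine ((he _).trans (hC.map_smul r x)).trans ?_
      rw [← he]
      exact (e.apply_symm_apply _).symm
    · rw [← hC.norm_map, ← he]
      rfl

omit hM in
theorem denseRange_of_extendsToInterpretation {E : Type u} [TopologicalSpace E] {p : X.carrier → E}
    (h : ExtendsToInterpretation M X.carrier X.opens p) : DenseRange p := by
  obtain ⟨P, hP⟩ := h
  exact hP.1.denseRange fun O hO => (mem_opens.1 hO).1.2

/-- Completeness is not a property of the topology alone. But the homeomorphism with the completion
preserves distances on the dense image of `X`, hence everywhere. -/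
theorem PreservesStructure.completeSpace {E : Type u} [NormedAddCommGroup E] [NormedSpace ℝ E]
    {p : X.carrier → E} (hp : X.PreservesStructure p)
    (h : ExtendsToInterpretation M X.carrier X.opens p) : CompleteSpace E := by
  have hd := denseRange_of_extendsToInterpretation h
  obtain ⟨e, he⟩ := exists_homeomorph_completion h
  have hC := X.preservesStructure_coe
  have hiso : Isometry e := by
    refine Isometry.of_dist_eq fun a b => ?_
    refine hd.induction_on₂ (p := fun a b => Dist.dist (e a) (e b) = Dist.dist a b)
      (isClosed_eq ?_ continuous_dist) (fun x y => ?_) a b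
    · exact (e.continuous.comp continuous_fst).dist (e.continuous.comp continuous_snd)
    · rw [he, he, (interpretedMetric hp.map_add hp.norm_map hd).1,
        (interpretedMetric hC.map_add hC.norm_map UniformSpace.Completion.denseRange_coe).1]
  exact (IsometryEquiv.mk e.toEquiv hiso).completeSpace

omit hM in
theorem mem_bracket {z : X.carrier.prod X.dualBall} {w : ZFSet.{u}} :
    ZFSet.pair z.1 w ∈ X.bracket ↔ w = realCode (X.eval (coords z).2 (coords z).1) := by
  rw [bracket, ZFSet.mem_range]
  simp only [ZFSet.pair_inj]
  constructor
  · rintro ⟨c, h₁, h₂⟩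
    have : prodMk c.1 c.2 = z := Subtype.ext h₁
    rw [← this, coords_prodMk, h₂]
  · rintro rfl
    exact ⟨coords z, (pair_coords z).symm, rfl⟩

end BanachIn

end

end ZModel

end

theorem mainTheorem10 (M : Set ZFSet.{u}) (hM : ZModel.IsTransitiveModel M)
    (X : ZModel.BanachIn M) :
    -- the interpretation of the space `X` carries the interpreted Banach space structure
    (∀ (E : Type u) (t : TopologicalSpace E) (π : X.carrier → E),
      ZModel.ExtendsToInterpretation M X.carrier X.opens π →
        ∃ (N : NormedAddCommGroup E) (_ : NormedSpace ℝ E),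
          N.toMetricSpace.toPseudoMetricSpace.toUniformSpace.toTopologicalSpace = t ∧
          CompleteSpace E ∧ X.PreservesStructure π) ∧
    (∀ (E : Type u) [NormedAddCommGroup E] [NormedSpace ℝ E] (π : X.carrier → E),
      ZModel.ExtendsToInterpretation M X.carrier X.opens π → X.PreservesStructure π →
        ∃ χ : X.dualBall → ZModel.weakStarBall E,
          -- `χ y` is the interpretation of the function `y`
          (∀ (y : X.dualBall) (g : E → ℝ),
            ZModel.InterpretsMap π (ZModel.realVal (M := M)) y.1 g ↔
              g = fun e : E => (χ y).1 e) ∧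
          ZModel.ExtendsToInterpretation M X.dualBall X.weakStarOpens χ ∧
          -- the bracket is interpreted as the bracket
          ZModel.ExtendsToInterpretation M (ZModel.realSet M) (ZModel.realOpens M)
            (ZModel.realVal (M := M)) ∧
          ZModel.ExtendsToInterpretation M (X.carrier.prod X.dualBall)
            (ZModel.prodOpens M X.carrier X.opens X.dualBall X.weakStarOpens)
            (ZModel.prodMap π χ) ∧
          (∀ g : E × ZModel.weakStarBall E → ℝ,
            ZModel.InterpretsMap (ZModel.prodMap π χ) (ZModel.realVal (M := M)) X.bracket g ↔
              g = fun z => z.2.1 z.1)) := by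
  have := Fact.mk hM
  refine ⟨fun E _ π hπ => ZModel.BanachIn.exists_banachSpace hπ, fun E _ _ π hπ hp => ?_⟩
  -- The norm on `E` is not assumed complete; completeness is needed for the convergence of prime
  -- families in the product.
  have := hp.completeSpace hπ
  have hd := ZModel.BanachIn.denseRange_of_extendsToInterpretation hπ
  have hprod := hp.extendsToInterpretation_prodMap hd
  refine ⟨hp.dualMap hd, fun y g => ?_, hp.extendsToInterpretation_dualMap hd,
    ZModel.extendsToInterpretation_real, hprod, fun g => ?_⟩
  · refine ZModel.interpretsMap_iff hd (ZModel.BanachIn.eval_mem_realsIn y) (fun x z => ?_)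
      (hp.dualMap hd y).1.continuous (hp.dualMap_apply hd y) g
    rw [← X.graph_eval, ZModel.BanachIn.mem_graph]
  · obtain ⟨P, hP⟩ := hprod
    exact ZModel.interpretsMap_iff (hP.1.denseRange fun O hO =>
        ZFSet.mem_powerset.1 (ZFSet.mem_sep.1 hO).1)
      (fun z => ZModel.BanachIn.eval_mem_realsIn _ _) (fun z w => ZModel.BanachIn.mem_bracket)
      ZModel.continuous_bracket (fun z => hp.dualMap_apply hd _ _) g
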